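/- Let $d\in\{2,3\}$, $\mathbb T^d=\mathbb R^d/\mathbb Z^d$, and let $s\in\mathbb N$ with $s\ge[d/2]+2$, where $[\cdot]$ is the integer part. For $\epsilon>0$ the (pressureless) Euler–Poisson system $(EP_\epsilon)$ on $\mathbb T^d$ for a velocity $v(t,x)\in\mathbb R^d$ and a density $\rho(t,x)\ge 0$ with $\int_{\mathbb T^d}\rho(t,x)\,dx=1$ is $$\partial_t\rho+\nabla\cdot(\rho v)=0,\qquad \partial_t v+v\cdot\nabla v=\frac{\nabla\phi}{\epsilon},\qquad \epsilon\Delta\phi=\rho-1 .$$ Let $0<T\le+\infty$, let $\bar v_0$ be a divergence-free vector field on $\mathbb T^d$, and let $(\bar v,p)$ be a classical solution of the incompressible Euler system $$\partial_t \bar v+\bar v\cdot\nabla\bar v=\nabla p,\qquad \nabla\cdot\bar v=0$$ on $[0,T]\times\mathbb T^d$ (on $[0,\infty)\times\mathbb T^d$ if $T=+\infty$), with $\bar v$ and $\nabla p$ respectively of class $C^1$ and continuous in $(t,x)$, with initial datum $\bar v_0$ and with $\bar v\in L^\infty([0,T],H^{s+1}(\mathbb T^d))$ (only $\bar v\in L^\infty_{loc}([0,\infty),H^{s+1}(\mathbb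 T^d))$ if $T=+\infty$). Let $\epsilon$ range over a set $E\subset(0,\infty)$ (for example an interval $(0,\epsilon_*)$ or a sequence tending to $0$), and let $(v_0^\epsilon,\rho_0^\epsilon)_{\epsilon\in E}$ be initial data such that $\rho_0^\epsilon\ge0$, $\int_{\mathbb T^d}\rho_0^\epsilon\,dx=1$, and such that $\left(\epsilon^{-1}(v_0^\epsilon-\bar v_0),\ \epsilon^{-2}(\rho_0^\epsilon-1)\right)$ is bounded in $H^s\times H^{s-1}(\mathbb T^d)$ uniformly in $\epsilon\in E$. Then there exist times $T_\epsilon\in(0,\infty)$ and, for every $\epsilon\in E$, a solution $(v^\epsilon,\rho^\epsilon)$ of $(EP_\epsilon)$ on $[0,T_\epsilon]\times\mathbb T^d$ with initial data $(v_0^\epsilon,\rho_0^\epsilon)$, belonging to $L^\infty([0,T_\epsilon],H^s\times H^{s-1}(\mathbb T^d))$, such that, with limits taken along $\epsilon\in E$, the following hold. 1. $\liminf_{\epsilon\to0}T_\epsilon\ge T$. 2. For every real $T'<T$ there are $\epsilon_0>0$ and $C$ such that for every $\epsilon\in E$ with $\epsilon<\epsilon_0$ one has $T_\epsilon\ge T'$,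 and the norms of $\left(\epsilon^{-1}(v^\epsilon-\bar v),\ \epsilon^{-2}(\rho^\epsilon-1)\right)$ in $L^\infty([0,T'],H^s\times H^{s-1}(\mathbb T^d))$ are at most $C$. 3. If $T=+\infty$, then $T_\epsilon\to+\infty$ as $\epsilon\to0$. Here $v^\epsilon$ is of class $C^1$ in $(t,x)$, $\rho^\epsilon$ is continuous and $\phi^\epsilon(t,\cdot)$ is of class $C^2$; the momentum and Poisson equations hold pointwise, and the continuity equation holds in the sense of distributions, in the form that for every $\psi\in C^\infty(\mathbb T^d)$ the function $t\mapsto\int\rho^\epsilon\psi\,dx$ is differentiable on $[0,T_\epsilon]$ with derivative $\int\rho^\epsilon v^\epsilon\cdot\nabla\psi\,dx$. -/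

import Mathlib

open MeasureTheory Filter Topology
open scoped ContDiff

noncomputable section

namespace EulerPoisson

/-- The flat torus `ℝ^d / ℤ^d`. -/
abbrev Torus (d : ℕ) : Type := UnitAddTorus (Fin d)

/-- The Lebesgue (normalised Haar) measure on the torus; its total mass is `1`. -/
def torusMeasure (d : ℕ) : Measure (Torus d) :=
  Measure.pi fun _ => AddCircle.haarAddCircle

/-- The `ℤ^d`-periodic function on `ℝ^d` that corresponds to a function on the torus. -/
def lift {d : ℕ} (f : Torus d → ℝ) : (Fin d → ℝ) → ℝ :=
  fun y => f fun i => (y i : UnitAddCircle)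

/-- `f` is of class `C^n` on the torus, for `n` a natural number or `n = ∞` (which is `⊤ : ℕ∞`). -/
def IsCn {d : ℕ} (n : ℕ∞) (f : Torus d → ℝ) : Prop :=
  ContDiff ℝ n (lift f)

/-- The partial derivative `∂_i f` on the torus. -/
def pd {d : ℕ} (i : Fin d) (f : Torus d → ℝ) (x : Torus d) : ℝ :=
  deriv (fun h : ℝ => f (x + Pi.single i (h : UnitAddCircle))) 0

/-- The divergence of a vector field. -/
def divergence {d : ℕ} (v : Torus d → Fin d → ℝ) (x : Torus d) : ℝ :=
  ∑ i, pd i (fun y => v y i) x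

/-- The Laplacian. -/
def laplacian {d : ℕ} (f : Torus d → ℝ) (x : Torus d) : ℝ :=
  ∑ i, pd i (pd i f) x

/-- The `i`-th component of `(v · ∇) v`. -/
def convection {d : ℕ} (v : Torus d → Fin d → ℝ) (i : Fin d) (x : Torus d) : ℝ :=
  ∑ j, v x j * pd j (fun y => v y i) x

/-- The term `(1 + |k|²)^s |f̂(k)|²` of the squared Sobolev norm. -/
def hsTerm {d : ℕ} (s : ℕ) (f : Torus d → ℝ) (k : Fin d → ℤ) : ℝ :=
  (1 + ∑ i, (k i : ℝ) ^ 2) ^ s * ‖UnitAddTorus.mFourierCoeff (fun x => (f x : ℂ)) k‖ ^ 2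

/-- `f` belongs to the Sobolev space `H^s` of the torus. -/
def MemHs {d : ℕ} (s : ℕ) (f : Torus d → ℝ) : Prop :=
  MemLp f 2 (torusMeasure d) ∧ Summable (hsTerm s f)

/-- The norm of `H^s` (meaningful for functions in `H^s`). -/
def hsNorm {d : ℕ} (s : ℕ) (f : Torus d → ℝ) : ℝ :=
  Real.sqrt (∑' k, hsTerm s f k)

/-- A vector field all of whose components belong to `H^s`. -/
def MemHsVec {d : ℕ} (s : ℕ) (v : Torus d → Fin d → ℝ) : Prop :=
  ∀ i, MemHs s fun x => v x i

/-- The norm of `H^s` for vector fields. -/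
def hsNormVec {d : ℕ} (s : ℕ) (v : Torus d → Fin d → ℝ) : ℝ :=
  Real.sqrt (∑ i, hsNorm s (fun x => v x i) ^ 2)

/-- `(v, ρ)` belongs to `H^s × H^(s-1)`, with both norms at most `C`. -/
def BoundedPair {d : ℕ} (s : ℕ) (v : Torus d → Fin d → ℝ) (ρ : Torus d → ℝ) (C : ℝ) : Prop :=
  (MemHsVec s v ∧ hsNormVec s v ≤ C) ∧ (MemHs (s - 1) ρ ∧ hsNorm (s - 1) ρ ≤ C)

/-- The interval `[0, T]`, read as `[0, ∞)` if `T = ∞`. -/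
def timeInterval (T : EReal) : Set ℝ := {t | 0 ≤ t ∧ (t : EReal) ≤ T}

/-- `f` and its first-order derivatives in space are defined and continuous on `I × 𝕋^d`. -/
def ContC1 {d : ℕ} (I : Set ℝ) (f : ℝ → Torus d → ℝ) : Prop :=
  ContinuousOn (fun q : ℝ × Torus d => f q.1 q.2) (I ×ˢ Set.univ) ∧
  (∀ t ∈ I, IsCn 1 (f t)) ∧
  ∀ j, ContinuousOn (fun q : ℝ × Torus d => pd j (f q.1) q.2) (I ×ˢ Set.univ)

/-- `(v, p)` is a classical solution of the incompressible Euler system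
`∂ₜ v + v · ∇ v = ∇ p`, `div v = 0` on `[0, T] × 𝕋^d` with initial datum `v₀`.
The equation makes `∂ₜ v` continuous, so `v` is of class `C¹` in `(t, x)`. -/
structure IsEulerSolution {d : ℕ} (T : EReal) (v₀ : Torus d → Fin d → ℝ)
    (v : ℝ → Torus d → Fin d → ℝ) (p : ℝ → Torus d → ℝ) : Prop where
  velocity_regular : ∀ i, ContC1 (timeInterval T) fun t x => v t x i
  pressure_regular : ∀ t ∈ timeInterval T, IsCn 1 (p t)
  pressure_gradient : ∀ i, ContinuousOn (fun q : ℝ × Torus d => pd i (p q.1) q.2)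
    (timeInterval T ×ˢ Set.univ)
  momentum : ∀ t ∈ timeInterval T, ∀ x i,
    HasDerivWithinAt (fun τ => v τ x i) (-convection (v t) i x + pd i (p t) x)
      (timeInterval T) t
  incompressible : ∀ t ∈ timeInterval T, ∀ x, divergence (v t) x = 0
  initial : v 0 = v₀

/-- `(v, ρ)` is a solution on `[0, T] × 𝕋^d` of the Euler–Poisson system
`∂ₜ ρ + div (ρ v) = 0`, `∂ₜ v + v · ∇ v = ∇ φ / ε`, `ε Δ φ = ρ - 1`, with initial data `(v₀, ρ₀)`
and with nonnegative density of mass one.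
The velocity is of class `C¹` in `(t, x)`, the density is continuous, the potential is of class
`C²` in `x`; the momentum and Poisson equations hold pointwise, and the conservation of mass
holds in the sense of distributions (`ρ` has values in `H^(s-1)` and need not be differentiable).
The data are functions defined almost everywhere. -/
structure IsEPSolution {d : ℕ} (ε T : ℝ) (v₀ : Torus d → Fin d → ℝ) (ρ₀ : Torus d → ℝ)
    (v : ℝ → Torus d → Fin d → ℝ) (ρ : ℝ → Torus d → ℝ) : Prop where
  velocity_regular : ∀ i, ContC1 (Set.Icc 0 T) fun t x => v t x i
  density_continuous : ContinuousOn (fun q : ℝ × Torus d => ρ q.1 q.2) (Set.Icc 0 T ×ˢ Set.univ)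
  density_nonneg : ∀ t ∈ Set.Icc 0 T, ∀ x, 0 ≤ ρ t x
  density_mass : ∀ t ∈ Set.Icc 0 T, ∫ x, ρ t x ∂(torusMeasure d) = 1
  mass_conservation : ∀ ψ : Torus d → ℝ, IsCn ⊤ ψ → ∀ t ∈ Set.Icc 0 T,
    HasDerivWithinAt (fun τ => ∫ x, ρ τ x * ψ x ∂(torusMeasure d))
      (∫ x, ρ t x * ∑ i, v t x i * pd i ψ x ∂(torusMeasure d)) (Set.Icc 0 T) t
  momentum_poisson : ∃ φ : ℝ → Torus d → ℝ,
    (∀ t ∈ Set.Icc 0 T, IsCn 2 (φ t)) ∧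
    (∀ i, ContinuousOn (fun q : ℝ × Torus d => pd i (φ q.1) q.2) (Set.Icc 0 T ×ˢ Set.univ)) ∧
    (∀ t ∈ Set.Icc 0 T, ∀ x i,
      HasDerivWithinAt (fun τ => v τ x i) (-convection (v t) i x + pd i (φ t) x / ε)
        (Set.Icc 0 T) t) ∧
    ∀ t ∈ Set.Icc 0 T, ∀ x, ε * laplacian (φ t) x = ρ t x - 1
  initial_velocity : v 0 =ᵐ[torusMeasure d] v₀
  initial_density : ρ 0 =ᵐ[torusMeasure d] ρ₀

end EulerPoisson

end

open scoped ComplexConjugate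

noncomputable section

namespace EulerPoisson

variable {d : ℕ}
open scoped ContDiff

/-! Write `a` for the Euler flow, `q = ∂ᵢaⱼ∂ⱼaᵢ = Δp`, `|D|` for the multiplier `2π|k|` and `θ =
k/|k|`. The unknowns are rescaled by `v = a + εu` and `ρ = 1 + ε²(q + |D|σ)`. The corrector `ε²q` is
the density whose electric force is exactly `∇p`, and `σ` measures the rest of the electric field.
In these variables the Euler–Poisson system becomes `∂ₜu = -(a + εu)·∇u - u·∇a - iθσ/ε`, `∂ₜσ =
-iθ·((a + εu)|D|σ + εqu + u/ε) - h`, with `h = |D|⁻¹∂ₜq + iθ·(qa)` (`epVelocity_pert`,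
`epDensity_pert`). The source `h` is in `H^s` as soon as `a` is in `H^(s+1)`, because `|D|⁻¹`
returns one of the two derivatives spent on `∂ₜq` (`exists_sobBound_fieldSource`).

The terms of size `1/ε` form a skew-adjoint Fourier multiplier, so they do not contribute to the
`H^s` energy `𝓔` of `(u, σ)`. The term `iθ·(b|D|σ)` is `b·∇σ` plus an operator with symbol `θ_k|l| -
l`, which is bounded by `2|k-l|` and by `2|l|` and therefore acts like a term of order zero.
Transport terms are controlled by symmetrization and a commutator (`re_transport_le`). The outcome,
`energy_inequality`, is `d𝓔/dt ≤ C(1+A)(1+ε(1+√𝓔))(1+𝓔)`, where `A` bounds `a`, `q` and `h`. The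
superlinear part carries a factor `ε`: on the range `𝓔 ≤ 2M` with `ε(1+√(2M)) ≤ 1` the rate depends
neither on `ε` nor on `M`. Taking for `M` the size that Gronwall's inequality allows up to a
prescribed time, one reaches that time for all small `ε`.

Solutions `(u, σ)` come from Galerkin systems on finite symmetric sets of frequencies
(`exists_galerkin`), which obey the same inequality, and from compactness in each Fourier
coefficient (`exists_perturbation`). The analysis is done on coefficient sequences. A Sobolev bound
is a bound on all finite partial sums, and since `d ≤ 3` a sequence in `H²` is absolutely summable,
which gives the algebra property and pointwise sums.

Nonnegativity of the density is not visible in Sobolev norms. It follows because transport does not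
increase `∫|ρ|`, while the mass remains `1`; since `ρ` is not smooth, this is shown for frequency
truncations and a smoothed absolute value (`IsEPFlow.integral_abs_density_le`,
`IsEPFlow.density_nonneg`).

Finally, `exists_isEPSolution_time` selects for each `ε` the farthest of a list of target times for
which `ε` is small enough. Its bounds at time `t` involve the Euler flow only up to `t`, so they
stay uniform on `[0, T']` even when the times of existence tend to infinity. -/

/-- The frequencies of Fourier series on the torus. -/
abbrev Freq (d : ℕ) : Type := Fin d → ℤ

/-! ### Lengths of frequencies and Sobolev weights -/

/-- The Euclidean length of a frequency. -/
def modulus (k : Freq d) : ℝ := Real.sqrt (∑ i, (k i : ℝ) ^ 2)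

/-- The Japanese bracket `(1 + |k|²)^(1/2)`. -/
def jb (k : Freq d) : ℝ := Real.sqrt (1 + ∑ i, (k i : ℝ) ^ 2)

lemma modulus_sq (k : Freq d) : modulus k ^ 2 = ∑ i, (k i : ℝ) ^ 2 :=
  Real.sq_sqrt (Finset.sum_nonneg fun _ _ => sq_nonneg _)

lemma modulus_nonneg (k : Freq d) : 0 ≤ modulus k := Real.sqrt_nonneg _

lemma jb_sq (k : Freq d) : jb k ^ 2 = 1 + ∑ i, (k i : ℝ) ^ 2 :=
  Real.sq_sqrt (add_nonneg zero_le_one (Finset.sum_nonneg fun _ _ => sq_nonneg _))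

lemma jb_sq' (k : Freq d) : jb k ^ 2 = 1 + modulus k ^ 2 := by rw [jb_sq, modulus_sq]

lemma one_le_jb (k : Freq d) : 1 ≤ jb k :=
  Real.one_le_sqrt.mpr (le_add_of_nonneg_right (Finset.sum_nonneg fun _ _ => sq_nonneg _))

lemma jb_pos (k : Freq d) : 0 < jb k := zero_lt_one.trans_le (one_le_jb k)

lemma jb_neg (k : Freq d) : jb (-k) = jb k := by simp [jb]

lemma modulus_neg (k : Freq d) : modulus (-k) = modulus k := by simp [modulus]

lemma modulus_zero : modulus (0 : Freq d) = 0 := by simp [modulus]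

lemma modulus_le_jb (k : Freq d) : modulus k ≤ jb k :=
  Real.sqrt_le_sqrt (by linarith)

lemma abs_coord_le_modulus (k : Freq d) (i : Fin d) : |(k i : ℝ)| ≤ modulus k := by
  rw [← Real.sqrt_sq_eq_abs]
  exact Real.sqrt_le_sqrt
    (Finset.single_le_sum (f := fun i => (k i : ℝ) ^ 2) (fun _ _ => sq_nonneg _) (Finset.mem_univ i))

lemma abs_coord_le_jb (k : Freq d) (i : Fin d) : |(k i : ℝ)| ≤ jb k :=
  (abs_coord_le_modulus k i).trans (modulus_le_jb k)

lemma modulus_eq_norm (k : Freq d) :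
    modulus k = ‖(WithLp.toLp 2 (fun i => (k i : ℝ)) : EuclideanSpace ℝ (Fin d))‖ := by
  rw [EuclideanSpace.norm_eq]; simp [modulus]

lemma modulus_pos {k : Freq d} (hk : k ≠ 0) : 0 < modulus k := by
  rw [modulus_eq_norm, norm_pos_iff]
  intro h
  refine hk (funext fun i => ?_)
  have := congrArg (fun v : EuclideanSpace ℝ (Fin d) => v i) h
  simpa using this

lemma modulus_add_le (k l : Freq d) : modulus (k + l) ≤ modulus k + modulus l := by
  simp only [modulus_eq_norm]
  refine le_trans (le_of_eq ?_) (norm_add_le _ _)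
  congr 1
  ext i
  simp

lemma abs_modulus_sub_le (k l : Freq d) : |modulus k - modulus l| ≤ modulus (k - l) := by
  have h1 := modulus_add_le (k - l) l
  have h2 := modulus_add_le (l - k) k
  rw [sub_add_cancel] at h1 h2
  rw [← neg_sub k l, modulus_neg] at h2
  rw [abs_le]
  constructor <;> linarith

/-- The function `√(1 + r²)` is 1-Lipschitz: the two differences of squares agree, and the bracket
dominates the modulus. -/
lemma abs_jb_sub_le (k l : Freq d) : |jb k - jb l| ≤ modulus (k - l) := by
  refine le_trans ?_ (abs_modulus_sub_le k l)
  have hk := jb_sq' k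
  have hl := jb_sq' l
  have pk := jb_pos k
  have pl := jb_pos l
  have mk := modulus_le_jb k
  have ml := modulus_le_jb l
  have nk := modulus_nonneg k
  have nl := modulus_nonneg l
  have e : (jb k - jb l) * (jb k + jb l) = (modulus k - modulus l) * (modulus k + modulus l) := by
    linear_combination hk - hl
  have e' := congrArg abs e
  rw [abs_mul, abs_mul, abs_of_pos (a := jb k + jb l) (by linarith),
    abs_of_nonneg (a := modulus k + modulus l) (by linarith)] at e'
  have : |jb k - jb l| * (jb k + jb l) ≤ |modulus k - modulus l| * (jb k + jb l) := by
    rw [e']; gcongr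
  exact le_of_mul_le_mul_right this (by linarith)

lemma jb_le_add (k l : Freq d) : jb k ≤ jb (k - l) + jb l := by
  have := (abs_le.mp (abs_jb_sub_le k l)).2
  linarith [modulus_le_jb (k - l)]

lemma jb_le_mul (k l : Freq d) : jb k ≤ 2 * (jb (k - l) * jb l) := by
  have h := jb_le_add k l
  have h1 := one_le_jb (k - l)
  have h2 := one_le_jb l
  nlinarith

/-- The larger of the weights at `k - l` and `l` is at least half of the weight at `k`. In a
product, all derivatives may thus be put on one factor. -/
lemma jb_pow_le (m : ℕ) (k l : Freq d) :
    jb k ^ m ≤ 2 ^ m * (jb (k - l) ^ m + jb l ^ m) := by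
  have h := jb_le_add k l
  have p1 := (jb_pos (k - l)).le
  have p2 := (jb_pos l).le
  rcases le_total (jb (k - l)) (jb l) with hle | hle
  · calc jb k ^ m ≤ (2 * jb l) ^ m := pow_le_pow_left₀ (jb_pos k).le (by linarith) m
      _ = 2 ^ m * jb l ^ m := mul_pow _ _ _
      _ ≤ _ := by gcongr; linarith [pow_nonneg p1 m]
  · calc jb k ^ m ≤ (2 * jb (k - l)) ^ m := pow_le_pow_left₀ (jb_pos k).le (by linarith) m
      _ = 2 ^ m * jb (k - l) ^ m := mul_pow _ _ _
      _ ≤ _ := by gcongr; linarith [pow_nonneg p2 m]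

/-- The commutator gain: one power of the weight at `k` or `l` is replaced by one at `k - l`, which
pays for the derivative in a transport term. It comes from factoring the difference of powers. -/
lemma abs_jb_pow_sub_le (m : ℕ) (k l : Freq d) :
    |jb k ^ (m + 1) - jb l ^ (m + 1)| ≤
      (m + 1) * 2 ^ m * jb (k - l) * (jb (k - l) ^ m + jb l ^ m) := by
  have h := jb_le_add k l
  have p0 := (jb_pos k).le
  have p1 := (jb_pos (k - l)).le
  have p2 := (jb_pos l).le
  -- `M` will be twice the larger of the weights at `k - l` and `l`.
  have hM : ∀ M : ℝ, jb k ≤ M → jb l ≤ M →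
      |jb k ^ (m + 1) - jb l ^ (m + 1)| ≤ (m + 1) * jb (k - l) * M ^ m := by
    intro M h1 h2
    have h0 : 0 ≤ M := p0.trans h1
    rw [← Commute.geom_sum₂_mul (Commute.all _ _), abs_mul, mul_comm, mul_comm ((m : ℝ) + 1),
      mul_assoc]
    have hs : |∑ i ∈ Finset.range (m + 1), jb k ^ i * jb l ^ (m + 1 - 1 - i)|
        ≤ (m + 1) * M ^ m := by
      rw [abs_of_nonneg (Finset.sum_nonneg fun i _ => by positivity)]
      refine (Finset.sum_le_card_nsmul _ _ (M ^ m) fun i hi => ?_).trans ?_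
      · have hi' : i + (m + 1 - 1 - i) = m := by
          have := Finset.mem_range.mp hi; omega
        calc _ ≤ M ^ i * M ^ (m + 1 - 1 - i) := by gcongr
          _ = M ^ m := by rw [← pow_add, hi']
      · simp
    exact mul_le_mul ((abs_jb_sub_le k l).trans (modulus_le_jb _)) hs (abs_nonneg _) p1
  rcases le_total (jb (k - l)) (jb l) with hle | hle
  · refine (hM (2 * jb l) (by linarith) (by linarith)).trans ?_
    rw [mul_pow]
    have : 0 ≤ (m + 1) * 2 ^ m * jb (k - l) * jb (k - l) ^ m := by positivity
    nlinarith
  · refine (hM (2 * jb (k - l)) (by linarith) (by linarith)).trans ?_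
    rw [mul_pow]
    have : 0 ≤ (m + 1) * 2 ^ m * jb (k - l) * jb l ^ m := by positivity
    nlinarith

/-- The exponent `4` exceeds the rank of the lattice. This is the only place where the dimension
enters analytically. -/
lemma summable_inv_jb_pow (hd : d ≤ 3) : Summable fun k : Freq d => (jb k ^ 4)⁻¹ := by
  let L : Submodule ℤ (Fin d → ℝ) := Submodule.span ℤ (Set.range (Pi.basisFun ℝ (Fin d)))
  have hfin : Module.finrank ℤ L = d := by
    rw [ZLattice.rank ℝ L]; simp
  have hsum := ZLattice.summable_norm_pow_inv L 4 (by omega)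
  let e : Freq d → L := fun k => ⟨fun i => (k i : ℝ), by
    rw [Module.Basis.mem_span_iff_repr_mem]
    intro i
    exact ⟨k i, by simp⟩⟩
  have he : Function.Injective e := by
    intro k l h
    funext i
    have := congrFun (congrArg Subtype.val h) i
    simpa [e] using this
  have h2 := hsum.comp_injective he
  refine Summable.of_norm_bounded_eventually h2 ?_
  rw [Filter.eventually_cofinite]
  refine (Set.finite_singleton (0 : Freq d)).subset fun k hk => ?_
  by_contra hk0
  refine hk ?_
  have hk0 : k ≠ 0 := hk0
  have hn : ‖e k‖ ≤ jb k := by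
    rw [Submodule.coe_norm, pi_norm_le_iff_of_nonneg (jb_pos k).le]
    intro i
    exact abs_coord_le_jb k i
  have hn0 : 0 < ‖e k‖ := by
    rw [norm_pos_iff]
    intro h
    exact hk0 (he (h.trans (by ext; simp [e])))
  have p := jb_pos k
  rw [Real.norm_of_nonneg (by positivity)]
  simp only [Function.comp_apply, inv_pow]
  gcongr

open scoped ContDiff

/-! ### Sobolev bounds for sequences of coefficients -/

/-- The sequence `f` has `H^m` norm at most `R`. -/
def SobBound (m : ℕ) (f : Freq d → ℂ) (R : ℝ) : Prop :=
  0 ≤ R ∧ ∀ S : Finset (Freq d), ∑ k ∈ S, jb k ^ (2 * m) * ‖f k‖ ^ 2 ≤ R ^ 2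

lemma sum_mul_le_of_sq_le {ι : Type*} (S : Finset ι) (x y : ι → ℝ) {X Y : ℝ} (hX : 0 ≤ X)
    (hY : 0 ≤ Y) (hx : ∑ k ∈ S, x k ^ 2 ≤ X ^ 2) (hy : ∑ k ∈ S, y k ^ 2 ≤ Y ^ 2) :
    ∑ k ∈ S, x k * y k ≤ X * Y := by
  refine (Real.sum_mul_le_sqrt_mul_sqrt S x y).trans ?_
  exact mul_le_mul ((Real.sqrt_le_sqrt hx).trans_eq (Real.sqrt_sq hX))
    ((Real.sqrt_le_sqrt hy).trans_eq (Real.sqrt_sq hY)) (Real.sqrt_nonneg _) hX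

namespace SobBound

variable {m n : ℕ} {f g : Freq d → ℂ} {R R' : ℝ}

lemma sum_sq_le (h : SobBound m f R) (S : Finset (Freq d)) :
    ∑ k ∈ S, (jb k ^ m * ‖f k‖) ^ 2 ≤ R ^ 2 := by
  simpa only [mul_pow, ← pow_mul, mul_comm m 2] using h.2 S

lemma of_sum_sq_le (hR : 0 ≤ R)
    (h : ∀ S : Finset (Freq d), ∑ k ∈ S, (jb k ^ m * ‖f k‖) ^ 2 ≤ R ^ 2) : SobBound m f R := by
  refine ⟨hR, fun S => ?_⟩
  simpa only [mul_pow, ← pow_mul, mul_comm m 2] using h S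

lemma zero (m : ℕ) (hR : 0 ≤ R) : SobBound m (0 : Freq d → ℂ) R :=
  ⟨hR, fun S => by simpa using sq_nonneg R⟩

/-- The common source of the bounds for Fourier multipliers, including those that change the order.
-/
lemma dominated {c : ℝ} (hc : 0 ≤ c) (h : SobBound m f R)
    (hg : ∀ k, jb k ^ n * ‖g k‖ ≤ c * (jb k ^ m * ‖f k‖)) : SobBound n g (c * R) := by
  refine of_sum_sq_le (mul_nonneg hc h.1) fun S => ?_
  calc _ ≤ ∑ k ∈ S, (c * (jb k ^ m * ‖f k‖)) ^ 2 := by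
        refine Finset.sum_le_sum fun k _ => pow_le_pow_left₀ ?_ (hg k) 2
        have := (jb_pos k).le
        positivity
    _ = c ^ 2 * ∑ k ∈ S, (jb k ^ m * ‖f k‖) ^ 2 := by
        rw [Finset.mul_sum]; exact Finset.sum_congr rfl fun _ _ => mul_pow _ _ _
    _ ≤ c ^ 2 * R ^ 2 := by gcongr; exact h.sum_sq_le S
    _ = _ := (mul_pow _ _ _).symm

lemma multiplier {c : ℝ} (hc : 0 ≤ c) (h : SobBound m f R) (hg : ∀ k, ‖g k‖ ≤ c * ‖f k‖) :
    SobBound m g (c * R) := by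
  refine h.dominated hc fun k => ?_
  calc _ ≤ jb k ^ m * (c * ‖f k‖) := by gcongr; exacts [pow_nonneg (jb_pos k).le m, hg k]
    _ = _ := by ring

lemma mono (h : SobBound m f R) (hR : R ≤ R') : SobBound m f R' :=
  ⟨h.1.trans hR, fun S => (h.2 S).trans (pow_le_pow_left₀ h.1 hR 2)⟩

lemma of_norm_le (h : SobBound m f R) (hg : ∀ k, ‖g k‖ ≤ ‖f k‖) : SobBound m g R := by
  simpa using h.multiplier zero_le_one (g := g) (by simpa using hg)

lemma of_le (h : SobBound m f R) (hn : n ≤ m) : SobBound n f R := by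
  have := h.dominated zero_le_one (n := n) (g := f) fun k => by
    rw [one_mul]
    exact mul_le_mul_of_nonneg_right (pow_le_pow_right₀ (one_le_jb k) hn) (norm_nonneg _)
  simpa using this

lemma smul (h : SobBound m f R) (c : ℂ) : SobBound m (fun k => c * f k) (‖c‖ * R) :=
  h.multiplier (norm_nonneg c) fun _ => (norm_mul _ _).le

lemma neg (h : SobBound m f R) : SobBound m (fun k => - f k) R :=
  h.of_norm_le fun _ => (norm_neg _).le

lemma add (hf : SobBound m f R) (hg : SobBound m g R') :
    SobBound m (fun k => f k + g k) (R + R') := by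
  refine of_sum_sq_le (add_nonneg hf.1 hg.1) fun S => ?_
  calc _ ≤ ∑ k ∈ S, (jb k ^ m * ‖f k‖ + jb k ^ m * ‖g k‖) ^ 2 := by
        refine Finset.sum_le_sum fun k _ => ?_
        have := (jb_pos k).le
        rw [← mul_add]
        gcongr
        exact norm_add_le _ _
    _ = ∑ k ∈ S, (jb k ^ m * ‖f k‖) ^ 2 + ∑ k ∈ S, (jb k ^ m * ‖g k‖) ^ 2
        + 2 * ∑ k ∈ S, (jb k ^ m * ‖f k‖) * (jb k ^ m * ‖g k‖) := by
        rw [Finset.mul_sum, ← Finset.sum_add_distrib, ← Finset.sum_add_distrib]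
        exact Finset.sum_congr rfl fun _ _ => by ring
    _ ≤ R ^ 2 + R' ^ 2 + 2 * (R * R') := by
        gcongr
        exacts [hf.sum_sq_le S, hg.sum_sq_le S,
          sum_mul_le_of_sq_le S _ _ hf.1 hg.1 (hf.sum_sq_le S) (hg.sum_sq_le S)]
    _ = _ := by ring

lemma sub (hf : SobBound m f R) (hg : SobBound m g R') :
    SobBound m (fun k => f k - g k) (R + R') := by
  simpa only [sub_eq_add_neg] using hf.add hg.neg

lemma sum {ι : Type*} (s : Finset ι) {f : ι → Freq d → ℂ} {R : ι → ℝ}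
    (h : ∀ i ∈ s, SobBound m (f i) (R i)) :
    SobBound m (fun k => ∑ i ∈ s, f i k) (∑ i ∈ s, R i) := by
  classical
  induction s using Finset.induction_on with
  | empty => simpa [Pi.zero_def] using zero (d := d) m le_rfl
  | insert i s hi ih =>
    simp only [Finset.sum_insert hi]
    exact (h i (Finset.mem_insert_self _ _)).add
      (ih fun j hj => h j (Finset.mem_insert_of_mem hj))

lemma apply_le (h : SobBound m f R) (k : Freq d) : jb k ^ m * ‖f k‖ ≤ R := by
  have := h.sum_sq_le {k}
  rw [Finset.sum_singleton] at this
  exact abs_le_of_sq_le_sq' this h.1 |>.2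

lemma norm_le (h : SobBound m f R) (k : Freq d) : ‖f k‖ ≤ R :=
  le_trans (le_mul_of_one_le_left (norm_nonneg _) (one_le_pow₀ (one_le_jb k))) (h.apply_le k)

lemma norm_le_div (h : SobBound m f R) (k : Freq d) : ‖f k‖ ≤ R * (jb k ^ m)⁻¹ := by
  rw [← div_eq_mul_inv, le_div_iff₀ (pow_pos (jb_pos k) m), mul_comm]
  exact h.apply_le k

/-- Lower semicontinuity of the norm. Only finite sums are involved, so convergence of each
coefficient suffices. -/
lemma of_tendsto {ι : Type*} {l : Filter ι} [l.NeBot] {F : ι → Freq d → ℂ}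
    (h : ∀ᶠ i in l, SobBound m (F i) R) (hF : ∀ k, Tendsto (fun i => F i k) l (𝓝 (f k))) :
    SobBound m f R := by
  refine ⟨h.exists.choose_spec.1, fun S => ?_⟩
  refine le_of_tendsto (f := fun i => ∑ k ∈ S, jb k ^ (2 * m) * ‖F i k‖ ^ 2) ?_
    (h.mono fun i hi => hi.2 S)
  exact tendsto_finsetSum _ fun k _ => ((hF k).norm.pow 2).const_mul _

end SobBound

/-! ### The embedding of `H²` into absolutely summable sequences -/

/-- The constant of the embedding of `H²` into the absolutely convergent Fourier series. -/
def embConst (d : ℕ) : ℝ := Real.sqrt (∑' k : Freq d, (jb k ^ 4)⁻¹)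

lemma embConst_nonneg : 0 ≤ embConst d := Real.sqrt_nonneg _

lemma sum_inv_jb_sq_le (hd : d ≤ 3) (S : Finset (Freq d)) :
    ∑ k ∈ S, ((jb k ^ 2)⁻¹) ^ 2 ≤ embConst d ^ 2 := by
  have h0 : ∀ k : Freq d, 0 ≤ (jb k ^ 4)⁻¹ := fun k => by have := jb_pos k; positivity
  rw [embConst, Real.sq_sqrt (tsum_nonneg h0)]
  refine le_trans (le_of_eq ?_) ((summable_inv_jb_pow hd).sum_le_tsum S fun k _ => h0 k)
  exact Finset.sum_congr rfl fun k _ => by rw [inv_pow, ← pow_mul]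

namespace SobBound

variable {m n : ℕ} {f g : Freq d → ℂ} {R R' : ℝ}

/-- Cauchy–Schwarz against the weight to the power `-2`, whose square is summable. -/
lemma sum_weighted_norm_le (hd : d ≤ 3) (h : SobBound m f R) (hm : n + 2 ≤ m)
    (S : Finset (Freq d)) : ∑ k ∈ S, jb k ^ n * ‖f k‖ ≤ embConst d * R := by
  refine le_trans (le_of_eq ?_) (sum_mul_le_of_sq_le S _ _ embConst_nonneg h.1
    (sum_inv_jb_sq_le hd S) ((h.of_le hm).sum_sq_le S))
  refine Finset.sum_congr rfl fun k _ => ?_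
  have := (jb_pos k).ne'
  rw [pow_add]
  field_simp

lemma sum_norm_le (hd : d ≤ 3) (h : SobBound m f R) (hm : 2 ≤ m)
    (S : Finset (Freq d)) : ∑ k ∈ S, ‖f k‖ ≤ embConst d * R := by
  simpa using h.sum_weighted_norm_le hd (n := 0) (by omega) S

lemma summable_norm (hd : d ≤ 3) (h : SobBound m f R) (hm : 2 ≤ m) : Summable fun k => ‖f k‖ :=
  summable_of_sum_le (fun _ => norm_nonneg _) (h.sum_norm_le hd hm)

lemma summable_weighted_norm (hd : d ≤ 3) (h : SobBound m f R) (hm : n + 2 ≤ m) :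
    Summable fun k => jb k ^ n * ‖f k‖ :=
  summable_of_sum_le (fun k => mul_nonneg (pow_nonneg (jb_pos k).le _) (norm_nonneg _))
    (h.sum_weighted_norm_le hd hm)

end SobBound

/-- The `ℓ¹` tails are small uniformly on bounded sets of `H²`. -/
lemma exists_tail_le (hd : d ≤ 3) {δ : ℝ} (hδ : 0 < δ) : ∃ S₀ : Finset (Freq d),
    ∀ (f : Freq d → ℂ) (R : ℝ), SobBound 2 f R → ∀ S : Finset (Freq d), Disjoint S S₀ →
      ∑ k ∈ S, ‖f k‖ ≤ δ * R := by
  obtain ⟨S₀, hS₀⟩ := summable_iff_vanishing_norm.mp (summable_inv_jb_pow hd) (δ ^ 2) (by positivity)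
  refine ⟨S₀, fun f R h S hS => ?_⟩
  refine le_trans (le_of_eq ?_) (sum_mul_le_of_sq_le S (fun k => (jb k ^ 2)⁻¹) _ hδ.le h.1
    ?_ (h.sum_sq_le S))
  · refine Finset.sum_congr rfl fun k _ => ?_
    have := (jb_pos k).ne'
    field_simp
  · have := (Real.le_norm_self _).trans (hS₀ S hS).le
    refine le_trans (le_of_eq ?_) this
    exact Finset.sum_congr rfl fun k _ => by rw [inv_pow, ← pow_mul]

/-! ### Young's inequality for convolutions -/

section Young

variable {G : Type*} [AddCommGroup G]

lemma sum_sub_left_le {y : G → ℝ} {Y : ℝ}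
    (hY : ∀ S : Finset G, ∑ k ∈ S, y k ≤ Y) (L : Finset G) (k : G) :
    ∑ l ∈ L, y (k - l) ≤ Y := by
  classical
  have := hY (L.image fun l => k - l)
  rwa [Finset.sum_image fun a _ b _ h => sub_right_injective h] at this

lemma sum_sub_right_le {y : G → ℝ} {Y : ℝ}
    (hY : ∀ S : Finset G, ∑ k ∈ S, y k ≤ Y) (S : Finset G) (l : G) :
    ∑ k ∈ S, y (k - l) ≤ Y := by
  classical
  have := hY (S.image fun k => k - l)
  rwa [Finset.sum_image fun a _ b _ h => sub_left_injective h] at this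

/-- Young's inequality with the convolution kernel in `ℓ¹`. -/
lemma young_kernel_l1 {x y z : G → ℝ} {X Y Z : ℝ} (hX : 0 ≤ X) (hZ : 0 ≤ Z)
    (hy : ∀ k, 0 ≤ y k) (hY : ∀ S : Finset G, ∑ k ∈ S, y k ≤ Y) (S L : Finset G)
    (hx : ∑ k ∈ S, x k ^ 2 ≤ X ^ 2) (hz : ∑ k ∈ L, z k ^ 2 ≤ Z ^ 2) :
    ∑ k ∈ S, ∑ l ∈ L, x k * (y (k - l) * z l) ≤ X * (Y * Z) := by
  have hY0 : 0 ≤ Y := by simpa using hY ∅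
  rw [← Finset.sum_product']
  have h1 : ∑ p ∈ S ×ˢ L, (x p.1 * Real.sqrt (y (p.1 - p.2))) ^ 2 ≤ (X * Real.sqrt Y) ^ 2 := by
    rw [Finset.sum_product' (f := fun k l => (x k * Real.sqrt (y (k - l))) ^ 2), mul_pow,
      Real.sq_sqrt hY0]
    calc _ = ∑ k ∈ S, x k ^ 2 * ∑ l ∈ L, y (k - l) := by
          refine Finset.sum_congr rfl fun k _ => ?_
          rw [Finset.mul_sum]
          exact Finset.sum_congr rfl fun l _ => by rw [mul_pow, Real.sq_sqrt (hy _)]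
      _ ≤ ∑ k ∈ S, x k ^ 2 * Y := by
          gcongr with k
          exact sum_sub_left_le hY L k
      _ ≤ _ := by rw [← Finset.sum_mul]; gcongr
  have h2 : ∑ p ∈ S ×ˢ L, (Real.sqrt (y (p.1 - p.2)) * z p.2) ^ 2 ≤ (Real.sqrt Y * Z) ^ 2 := by
    rw [Finset.sum_product_right' (f := fun k l => (Real.sqrt (y (k - l)) * z l) ^ 2), mul_pow,
      Real.sq_sqrt hY0]
    calc _ = ∑ l ∈ L, (∑ k ∈ S, y (k - l)) * z l ^ 2 := by
          refine Finset.sum_congr rfl fun k _ => ?_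
          rw [Finset.sum_mul]
          exact Finset.sum_congr rfl fun l _ => by rw [mul_pow, Real.sq_sqrt (hy _)]
      _ ≤ ∑ l ∈ L, Y * z l ^ 2 := by
          gcongr with l
          exact sum_sub_right_le hY S l
      _ ≤ _ := by rw [← Finset.mul_sum]; gcongr
  have h3 := sum_mul_le_of_sq_le (S ×ˢ L) _ _ (by positivity) (by positivity) h1 h2
  calc _ = _ := Finset.sum_congr rfl fun p _ => ?_
    _ ≤ _ := h3
    _ = X * (Real.sqrt Y * Real.sqrt Y * Z) := by ring
    _ = _ := by rw [Real.mul_self_sqrt hY0]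
  calc x p.1 * (y (p.1 - p.2) * z p.2)
      = x p.1 * ((Real.sqrt (y (p.1 - p.2)) * Real.sqrt (y (p.1 - p.2))) * z p.2) := by
        rw [Real.mul_self_sqrt (hy _)]
    _ = _ := by ring

/-- Young's inequality with the convolution kernel in `ℓ²`. -/
lemma young_kernel_l2 {x y z : G → ℝ} {X Y Z : ℝ} (hX : 0 ≤ X) (hY0 : 0 ≤ Y)
    (hz : ∀ k, 0 ≤ z k) (hY : ∀ S : Finset G, ∑ k ∈ S, y k ^ 2 ≤ Y ^ 2) (S L : Finset G)
    (hx : ∑ k ∈ S, x k ^ 2 ≤ X ^ 2) (hZ : ∑ k ∈ L, z k ≤ Z) :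
    ∑ k ∈ S, ∑ l ∈ L, x k * (y (k - l) * z l) ≤ X * (Y * Z) := by
  rw [Finset.sum_comm]
  calc _ = ∑ l ∈ L, (∑ k ∈ S, x k * y (k - l)) * z l := by
        refine Finset.sum_congr rfl fun l _ => ?_
        rw [Finset.sum_mul]
        exact Finset.sum_congr rfl fun k _ => by ring
    _ ≤ ∑ l ∈ L, (X * Y) * z l := by
        gcongr with l
        · exact hz l
        · exact sum_mul_le_of_sq_le S _ _ hX hY0 hx
            (sum_sub_right_le (y := fun k => y k ^ 2) hY S l)
    _ ≤ X * Y * Z := by rw [← Finset.mul_sum]; gcongr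
    _ = _ := by ring

end Young

/-! ### Products, derivatives and real sequences on the Fourier side -/

/-- The convolution of sequences, which corresponds to the product of functions. -/
def conv (f g : Freq d → ℂ) (k : Freq d) : ℂ := ∑' l, f (k - l) * g l

/-- The Fourier multiplier of `∂_j`. -/
def dseq (j : Fin d) (f : Freq d → ℂ) (k : Freq d) : ℂ :=
  2 * Real.pi * Complex.I * (k j : ℂ) * f k

/-- The sequences of Fourier coefficients of real functions. -/
def IsRealSeq (f : Freq d → ℂ) : Prop := ∀ k, f (-k) = conj (f k)

variable {m n s : ℕ} {f g b : Freq d → ℂ} {R R' : ℝ}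

lemma norm_dseq (j : Fin d) (f : Freq d → ℂ) (k : Freq d) :
    ‖dseq j f k‖ = 2 * Real.pi * |(k j : ℝ)| * ‖f k‖ := by
  simp only [dseq, norm_mul, Complex.norm_I, Complex.norm_real, Complex.norm_ofNat, mul_one,
    Real.norm_eq_abs, abs_of_pos Real.pi_pos]
  congr 2
  exact Complex.norm_intCast _

lemma norm_dseq_le (j : Fin d) (f : Freq d → ℂ) (k : Freq d) :
    ‖dseq j f k‖ ≤ 2 * Real.pi * (jb k * ‖f k‖) := by
  rw [norm_dseq, mul_assoc]
  have := Real.pi_pos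
  gcongr
  exact abs_coord_le_jb k j

lemma SobBound.dseq (h : SobBound (m + 1) f R) (j : Fin d) :
    SobBound m (dseq j f) (2 * Real.pi * R) := by
  refine h.dominated (by positivity) fun k => ?_
  calc _ ≤ jb k ^ m * (2 * Real.pi * (jb k * ‖f k‖)) := by
        have := (jb_pos k).le
        gcongr
        exact norm_dseq_le j f k
    _ = _ := by ring

/-- By Cauchy–Schwarz, convolution makes sense already for square-summable factors, so the orders
`m` and `n` are arbitrary. -/
lemma SobBound.summable_mul (hf : SobBound m f R) (hg : SobBound n g R') (k : Freq d) :
    Summable fun l => ‖f (k - l) * g l‖ := by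
  refine summable_of_sum_le (c := R * R') (fun _ => norm_nonneg _) fun S => ?_
  simp only [norm_mul]
  refine sum_mul_le_of_sq_le S _ _ hf.1 hg.1 ?_ ?_
  · refine sum_sub_left_le (y := fun k => ‖f k‖ ^ 2) (fun S => ?_) S k
    simpa using (hf.of_le (Nat.zero_le m)).sum_sq_le S
  · simpa using (hg.of_le (Nat.zero_le n)).sum_sq_le S

lemma SobBound.norm_conv_le (hf : SobBound m f R) (hg : SobBound n g R') (k : Freq d) :
    ‖conv f g k‖ ≤ R * R' := by
  refine (norm_tsum_le_tsum_norm (hf.summable_mul hg k)).trans ?_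
  refine (hf.summable_mul hg k).tsum_le_of_sum_le fun S => ?_
  simp only [norm_mul]
  refine sum_mul_le_of_sq_le S _ _ hf.1 hg.1 ?_ ?_
  · refine sum_sub_left_le (y := fun k => ‖f k‖ ^ 2) (fun S => ?_) S k
    simpa using (hf.of_le (Nat.zero_le m)).sum_sq_le S
  · simpa using (hg.of_le (Nat.zero_le n)).sum_sq_le S

lemma conv_comm (f g : Freq d → ℂ) : conv f g = conv g f := by
  funext k
  unfold conv
  rw [← (Equiv.subLeft k).tsum_eq]
  exact tsum_congr fun l => by simp [mul_comm]

lemma conv_smul_left (c : ℂ) (f g : Freq d → ℂ) (k : Freq d) :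
    conv (fun l => c * f l) g k = c * conv f g k := by
  unfold conv
  rw [← tsum_mul_left]
  exact tsum_congr fun l => by ring

lemma conv_add_left {f' : Freq d → ℂ} {m' : ℕ} {R'' : ℝ} (hf : SobBound m f R)
    (hf' : SobBound m' f' R'') (hg : SobBound n g R') (k : Freq d) :
    conv (fun l => f l + f' l) g k = conv f g k + conv f' g k := by
  unfold conv
  rw [← Summable.tsum_add (hf.summable_mul hg k).of_norm (hf'.summable_mul hg k).of_norm]
  exact tsum_congr fun l => by ring

lemma conv_add_right {g' : Freq d → ℂ} {m' : ℕ} {R'' : ℝ} (hf : SobBound m f R)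
    (hg : SobBound n g R') (hg' : SobBound m' g' R'') (k : Freq d) :
    conv f (fun l => g l + g' l) k = conv f g k + conv f g' k := by
  rw [conv_comm, conv_add_left hg hg' hf, conv_comm f g, conv_comm f g']

lemma conv_smul_right (c : ℂ) (f g : Freq d → ℂ) (k : Freq d) :
    conv f (fun l => c * g l) k = c * conv f g k := by
  rw [conv_comm, conv_smul_left, conv_comm]

lemma IsRealSeq.conv (hf : IsRealSeq f) (hg : IsRealSeq g) : IsRealSeq (conv f g) := by
  intro k
  unfold EulerPoisson.conv
  rw [Complex.conj_tsum, ← (Equiv.neg (Freq d)).tsum_eq]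
  refine tsum_congr fun l => ?_
  rw [map_mul, ← hf, ← hg]
  simp only [Equiv.neg_apply]
  congr 2
  abel

lemma IsRealSeq.dseq (hf : IsRealSeq f) (j : Fin d) : IsRealSeq (dseq j f) := by
  intro k
  simp only [EulerPoisson.dseq, hf k, Pi.neg_apply, map_mul, Complex.conj_I, Complex.conj_ofReal,
    map_ofNat, map_intCast]
  push_cast
  ring

lemma IsRealSeq.add (hf : IsRealSeq f) (hg : IsRealSeq g) : IsRealSeq fun k => f k + g k := by
  intro k
  simp only [hf k, hg k, map_add]

lemma IsRealSeq.smul (hf : IsRealSeq f) (c : ℝ) : IsRealSeq fun k => (c : ℂ) * f k := by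
  intro k
  simp only [hf k, map_mul, Complex.conj_ofReal]

lemma IsRealSeq.sum {ι : Type*} (s : Finset ι) {f : ι → Freq d → ℂ}
    (h : ∀ i ∈ s, IsRealSeq (f i)) : IsRealSeq fun k => ∑ i ∈ s, f i k := by
  intro k
  simp only [map_sum]
  exact Finset.sum_congr rfl fun i hi => h i hi k

/-- A convolution is in `H^m` as soon as the weighted product is dominated by two products that
Young's inequality controls. -/
lemma sobBound_conv_of_dominated {y₁ z₁ y₂ z₂ : Freq d → ℝ} {Y₁ Z₁ Y₂ Z₂ : ℝ}
    (hf : SobBound m f R) (hg : SobBound m g R')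
    (hY₁ : 0 ≤ Y₁) (hZ₁ : 0 ≤ Z₁) (hY₂ : 0 ≤ Y₂) (hZ₂ : 0 ≤ Z₂)
    (hz₁ : ∀ k, 0 ≤ z₁ k) (hy₂ : ∀ k, 0 ≤ y₂ k)
    (h₁ : ∀ S : Finset (Freq d), ∑ k ∈ S, y₁ k ^ 2 ≤ Y₁ ^ 2)
    (h₁' : ∀ S : Finset (Freq d), ∑ k ∈ S, z₁ k ≤ Z₁)
    (h₂ : ∀ S : Finset (Freq d), ∑ k ∈ S, y₂ k ≤ Y₂)
    (h₂' : ∀ S : Finset (Freq d), ∑ k ∈ S, z₂ k ^ 2 ≤ Z₂ ^ 2)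
    (h : ∀ k l, jb k ^ n * (‖f (k - l)‖ * ‖g l‖) ≤ y₁ (k - l) * z₁ l + y₂ (k - l) * z₂ l) :
    SobBound n (conv f g) (Y₁ * Z₁ + Y₂ * Z₂) := by
  refine SobBound.of_sum_sq_le (by positivity) fun S => ?_
  set x : Freq d → ℝ := fun k => jb k ^ n * ‖conv f g k‖ with hx
  set X := Real.sqrt (∑ k ∈ S, x k ^ 2) with hXdef
  have hX : ∑ k ∈ S, x k ^ 2 = X ^ 2 :=
    (Real.sq_sqrt (Finset.sum_nonneg fun _ _ => sq_nonneg _)).symm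
  have hX0 : 0 ≤ X := Real.sqrt_nonneg _
  have hx0 : ∀ k, 0 ≤ x k := fun k => mul_nonneg (pow_nonneg (jb_pos k).le _) (norm_nonneg _)
  -- Duality: the weighted convolution on `S` is tested against itself, which gives the trilinear
  -- sums in Young's inequality. One factor `X` is cancelled at the end.
  have key : X ^ 2 ≤ X * (Y₁ * Z₁ + Y₂ * Z₂) := by
    rw [← hX]
    have hsum : ∀ k, Summable fun l => x k * (jb k ^ n * (‖f (k - l)‖ * ‖g l‖)) := fun k => by
      have := hf.summable_mul hg k
      simp only [norm_mul] at this
      exact (this.mul_left _).mul_left _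
    calc ∑ k ∈ S, x k ^ 2 ≤ ∑ k ∈ S, ∑' l, x k * (jb k ^ n * (‖f (k - l)‖ * ‖g l‖)) := by
          refine Finset.sum_le_sum fun k _ => ?_
          rw [tsum_mul_left, tsum_mul_left, sq]
          refine mul_le_mul_of_nonneg_left ?_ (hx0 k)
          refine mul_le_mul_of_nonneg_left ?_ (pow_nonneg (jb_pos k).le _)
          exact (norm_tsum_le_tsum_norm (hf.summable_mul hg k)).trans_eq (by simp only [norm_mul])
      _ = ∑' l, ∑ k ∈ S, x k * (jb k ^ n * (‖f (k - l)‖ * ‖g l‖)) :=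
          (Summable.tsum_finsetSum fun k _ => hsum k).symm
      _ ≤ X * (Y₁ * Z₁ + Y₂ * Z₂) := by
          refine (summable_sum fun k _ => hsum k).tsum_le_of_sum_le fun L => ?_
          rw [Finset.sum_comm]
          calc _ ≤ ∑ k ∈ S, ∑ l ∈ L, (x k * (y₁ (k - l) * z₁ l) + x k * (y₂ (k - l) * z₂ l)) := by
                refine Finset.sum_le_sum fun k _ => Finset.sum_le_sum fun l _ => ?_
                rw [← mul_add]
                exact mul_le_mul_of_nonneg_left (h k l) (hx0 k)
            _ = _ + _ := by simp only [Finset.sum_add_distrib]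
            _ ≤ X * (Y₁ * Z₁) + X * (Y₂ * Z₂) := add_le_add
                (young_kernel_l2 hX0 hY₁ hz₁ h₁ S L hX.le (h₁' L))
                (young_kernel_l1 hX0 hZ₂ hy₂ h₂ S L hX.le (h₂' L))
            _ = _ := by ring
  rw [hX]
  rcases hX0.eq_or_lt with h0 | h0
  · rw [← h0, zero_pow two_ne_zero]; positivity
  · rw [sq, mul_le_mul_iff_right₀ h0] at key
    exact pow_le_pow_left₀ hX0 key 2

/-- `H^m` is an algebra for `m ≥ 2`. -/
lemma SobBound.conv (hd : d ≤ 3) (hm : 2 ≤ m) (hf : SobBound m f R) (hg : SobBound m g R') :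
    SobBound m (conv f g) (2 ^ (m + 1) * embConst d * (R * R')) := by
  have hC := embConst_nonneg (d := d)
  have hR := hf.1
  have hR' := hg.1
  have := sobBound_conv_of_dominated (n := m) hf hg (y₁ := fun k => 2 ^ m * (jb k ^ m * ‖f k‖))
    (z₁ := fun k => ‖g k‖) (y₂ := fun k => 2 ^ m * ‖f k‖) (z₂ := fun k => jb k ^ m * ‖g k‖)
    (Y₁ := 2 ^ m * R) (Z₁ := embConst d * R') (Y₂ := 2 ^ m * (embConst d * R)) (Z₂ := R')
    (by positivity) (by positivity) (by positivity) hR' (fun _ => norm_nonneg _)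
    (fun _ => by positivity)
    (fun S => by
      simp only [mul_pow (2 ^ m : ℝ), ← Finset.mul_sum]
      have := hf.sum_sq_le S
      gcongr)
    (fun S => hg.sum_norm_le hd hm S)
    (fun S => by
      simp only [← Finset.mul_sum]
      have := hf.sum_norm_le hd hm S
      gcongr)
    (fun S => hg.sum_sq_le S)
    (fun k l => by
      have := jb_pow_le m k l
      calc _ ≤ (2 ^ m * (jb (k - l) ^ m + jb l ^ m)) * (‖f (k - l)‖ * ‖g l‖) := by gcongr
        _ = _ := by ring)
  convert this using 1
  ring

/-- The product of a function in `H^3` and one in `H^1` is in `H^1`. -/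
lemma SobBound.conv_one (hd : d ≤ 3) (hf : SobBound 3 f R) (hg : SobBound 1 g R') :
    SobBound 1 (EulerPoisson.conv f g) (2 * (embConst d * R) * R') := by
  have hC := embConst_nonneg (d := d)
  have hR := hf.1
  have hR' := hg.1
  have := sobBound_conv_of_dominated (n := 1) (hf.of_le (by norm_num)) hg (y₁ := fun k => 0)
    (z₁ := fun k => 0) (y₂ := fun k => 2 * (jb k ^ 1 * ‖f k‖)) (z₂ := fun k => jb k ^ 1 * ‖g k‖)
    (Y₁ := 0) (Z₁ := 0) (Y₂ := 2 * (embConst d * R)) (Z₂ := R')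
    le_rfl le_rfl (by positivity) hR' (fun _ => le_rfl)
    (fun k => by have := (jb_pos k).le; positivity)
    (fun S => by simp) (fun S => by simp)
    (fun S => by
      simp only [← Finset.mul_sum]
      have := hf.sum_weighted_norm_le hd (n := 1) le_rfl S
      gcongr)
    (fun S => hg.sum_sq_le S)
    (fun k l => by
      have := jb_le_mul k l
      calc _ ≤ (2 * (jb (k - l) * jb l)) ^ 1 * (‖f (k - l)‖ * ‖g l‖) := by
            have := (jb_pos k).le
            gcongr
        _ = _ := by ring)
  simpa using this

/-! ### Trilinear and commutator estimates -/

section Trilinear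

variable {x : Freq d → ℝ} {X : ℝ}

/-- Only one derivative falls on `b`, so for `s ≥ 3` the kernel is summable. -/
lemma trilinear_low (hd : d ≤ 3) (hs : 3 ≤ s) (hb : SobBound s b R) (hg : SobBound s g R')
    (hX : 0 ≤ X) (S L : Finset (Freq d)) (hx : ∑ k ∈ S, x k ^ 2 ≤ X ^ 2) :
    ∑ k ∈ S, ∑ l ∈ L, x k * ((jb (k - l) * ‖b (k - l)‖) * (jb l ^ s * ‖g l‖)) ≤
      X * (embConst d * R * R') :=
  young_kernel_l1 (y := fun k => jb k * ‖b k‖) (z := fun k => jb k ^ s * ‖g k‖) hX hg.1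
    (fun k => mul_nonneg (jb_pos k).le (norm_nonneg _))
    (fun S => by simpa using hb.sum_weighted_norm_le hd (n := 1) (by omega) S) S L hx
    (hg.sum_sq_le L)

/-- Here all `s` derivatives fall on `b`. The kernel is in `ℓ²`, and the other factor, with one
derivative, is summable. -/
lemma trilinear_high (hd : d ≤ 3) (hs : 3 ≤ s) (hb : SobBound s b R) (hg : SobBound s g R')
    (hX : 0 ≤ X) (S L : Finset (Freq d)) (hx : ∑ k ∈ S, x k ^ 2 ≤ X ^ 2) :
    ∑ k ∈ S, ∑ l ∈ L, x k * ((jb (k - l) ^ s * ‖b (k - l)‖) * (jb l * ‖g l‖)) ≤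
      X * (embConst d * R * R') := by
  refine (young_kernel_l2 (y := fun k => jb k ^ s * ‖b k‖) (z := fun k => jb k * ‖g k‖) hX hb.1
    (fun k => mul_nonneg (jb_pos k).le (norm_nonneg _)) hb.sum_sq_le S L hx
    (by simpa using hg.sum_weighted_norm_le hd (n := 1) (by omega) L)).trans (le_of_eq (by ring))

/-- The trilinear estimate behind all energy estimates. -/
lemma trilinear (hd : d ≤ 3) (hs : 3 ≤ s) (hb : SobBound s b R) (hg : SobBound s g R')
    (hX : 0 ≤ X) (S L : Finset (Freq d)) (hx : ∑ k ∈ S, x k ^ 2 ≤ X ^ 2) :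
    ∑ k ∈ S, ∑ l ∈ L, x k * ((jb (k - l) ^ s * jb l + jb (k - l) * jb l ^ s) *
      (‖b (k - l)‖ * ‖g l‖)) ≤ 2 * embConst d * (X * R * R') := by
  calc _ = ∑ k ∈ S, ∑ l ∈ L, x k * ((jb (k - l) ^ s * ‖b (k - l)‖) * (jb l * ‖g l‖)) +
        ∑ k ∈ S, ∑ l ∈ L, x k * ((jb (k - l) * ‖b (k - l)‖) * (jb l ^ s * ‖g l‖)) := by
        simp only [← Finset.sum_add_distrib]
        exact Finset.sum_congr rfl fun k _ => Finset.sum_congr rfl fun l _ => by ring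
    _ ≤ _ := add_le_add (trilinear_high hd hs hb hg hX S L hx) (trilinear_low hd hs hb hg hX S L hx)
    _ = _ := by ring

/-- Terms whose coefficients are dominated by the kernel of the trilinear estimate. -/
lemma norm_sum_le_of_kernel (hd : d ≤ 3) (hs : 3 ≤ s) (hf : SobBound s f X)
    (hb : SobBound s b R) (hg : SobBound s g R') (S L : Finset (Freq d)) {c : ℝ} (hc : 0 ≤ c)
    (w : Freq d → Freq d → ℂ)
    (hw : ∀ k l, ‖w k l‖ ≤ c * ((jb k ^ s * ‖f k‖) *
      ((jb (k - l) ^ s * jb l + jb (k - l) * jb l ^ s) * (‖b (k - l)‖ * ‖g l‖)))) :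
    ‖∑ k ∈ S, ∑ l ∈ L, w k l‖ ≤ c * (2 * embConst d * (X * R * R')) := by
  refine (norm_sum_le _ _).trans ?_
  calc _ ≤ ∑ k ∈ S, ∑ l ∈ L, c * ((jb k ^ s * ‖f k‖) *
      ((jb (k - l) ^ s * jb l + jb (k - l) * jb l ^ s) * (‖b (k - l)‖ * ‖g l‖))) :=
        Finset.sum_le_sum fun k _ => (norm_sum_le _ _).trans (Finset.sum_le_sum fun l _ => hw k l)
    _ ≤ _ := by
        simp only [← Finset.mul_sum]
        gcongr
        simp only [Finset.mul_sum]
        exact trilinear hd hs hb hg hf.1 S L (hf.sum_sq_le S)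

/-- The energy estimate for a transport term. -/
lemma re_transport_le (hd : d ≤ 3) (hs : 3 ≤ s) (hb : SobBound s b R) (hbr : IsRealSeq b)
    (hf : SobBound s f R') (j : Fin d) (S : Finset (Freq d)) :
    |(∑ k ∈ S, ∑ l ∈ S, (jb k ^ (2 * s) : ℂ) * conj (f k) * (b (k - l) * dseq j f l)).re| ≤
      2 * Real.pi * (s * 2 ^ s + 1) * (2 * embConst d * (R' * R * R')) := by
  obtain ⟨m, rfl⟩ : ∃ m, s = m + 1 := ⟨s - 1, by omega⟩
  -- `A` is the transport term with one weight moved onto each copy of `f`; `B` is the commutator of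
  -- the weight with the transport.
  set A : Freq d → Freq d → ℂ := fun k l =>
    ((jb k : ℂ) ^ (m + 1) * conj (f k)) * (b (k - l) * dseq j (fun l => (jb l : ℂ) ^ (m + 1) * f l) l)
    with hA
  set B : Freq d → Freq d → ℂ := fun k l => ((jb k : ℂ) ^ (m + 1) * conj (f k)) *
    (b (k - l) * (((jb k : ℂ) ^ (m + 1) - (jb l : ℂ) ^ (m + 1)) * dseq j f l)) with hB
  have hpi := Real.pi_pos
  have hsplit : ∑ k ∈ S, ∑ l ∈ S, (jb k ^ (2 * (m + 1)) : ℂ) * conj (f k) *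
      (b (k - l) * dseq j f l) = ∑ k ∈ S, ∑ l ∈ S, A k l + ∑ k ∈ S, ∑ l ∈ S, B k l := by
    simp only [← Finset.sum_add_distrib]
    refine Finset.sum_congr rfl fun k _ => Finset.sum_congr rfl fun l _ => ?_
    simp only [hA, hB, dseq]
    ring
  -- Integration by parts in Fourier variables: exchanging `k` and `l` and conjugating leaves only
  -- the factor `l j - k j`, so the derivative falls on `b`. No condition on the divergence of `b`
  -- is needed.
  have hsymm : 2 * (∑ k ∈ S, ∑ l ∈ S, A k l).re =
      (∑ k ∈ S, ∑ l ∈ S, (A k l + conj (A l k))).re := by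
    have : ∑ k ∈ S, ∑ l ∈ S, (A k l + conj (A l k)) =
        ∑ k ∈ S, ∑ l ∈ S, A k l + conj (∑ k ∈ S, ∑ l ∈ S, A k l) := by
      simp only [Finset.sum_add_distrib]
      congr 1
      rw [Finset.sum_comm]
      simp only [map_sum]
    rw [this, Complex.add_re, Complex.conj_re]
    ring
  have hAbound : ‖∑ k ∈ S, ∑ l ∈ S, (A k l + conj (A l k))‖ ≤
      2 * Real.pi * (2 * embConst d * (R' * R * R')) := by
    refine norm_sum_le_of_kernel hd hs hf hb hf S S (by positivity) _ fun k l => ?_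
    have e : A k l + conj (A l k) = 2 * Real.pi * Complex.I * ((l j : ℂ) - k j) *
        (((jb k : ℂ) ^ (m + 1) * conj (f k)) * (b (k - l) * ((jb l : ℂ) ^ (m + 1) * f l))) := by
      have hb' : conj (b (l - k)) = b (k - l) := by rw [← hbr, neg_sub]
      simp only [hA, dseq, map_mul, hb', Complex.conj_conj, Complex.conj_I, Complex.conj_ofReal,
        map_ofNat, map_pow, map_intCast]
      ring
    have hk : ‖(l j : ℂ) - k j‖ ≤ jb (k - l) := by
      rw [← jb_neg, neg_sub]
      refine le_trans (le_of_eq ?_) (abs_coord_le_jb (l - k) j)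
      rw [← Complex.norm_intCast]
      push_cast [Pi.sub_apply]
      rfl
    have h1 := (jb_pos k).le
    have h2 := (jb_pos l).le
    have h3 := (jb_pos (k - l)).le
    rw [e]
    simp only [norm_mul, Complex.norm_I, Complex.norm_real, Complex.norm_ofNat, mul_one, norm_pow,
      Real.norm_eq_abs, abs_of_pos hpi, abs_of_nonneg h1, abs_of_nonneg h2, RCLike.norm_conj]
    rw [mul_assoc (2 * Real.pi)]
    refine mul_le_mul_of_nonneg_left ?_ (by positivity)
    calc _ ≤ jb (k - l) * (jb k ^ (m + 1) * ‖f k‖ * (‖b (k - l)‖ * (jb l ^ (m + 1) * ‖f l‖))) := by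
          gcongr
      _ = (jb k ^ (m + 1) * ‖f k‖) * ((0 + jb (k - l) * jb l ^ (m + 1)) *
            (‖b (k - l)‖ * ‖f l‖)) := by ring
      _ ≤ _ := by gcongr; positivity
  have hBbound : ‖∑ k ∈ S, ∑ l ∈ S, B k l‖ ≤
      (2 * Real.pi * ((m + 1 : ℕ) * 2 ^ m)) * (2 * embConst d * (R' * R * R')) := by
    refine norm_sum_le_of_kernel hd hs hf hb hf S S (by positivity) _ fun k l => ?_
    have h1 := (jb_pos k).le
    have h2 := (jb_pos l).le
    have h3 := (jb_pos (k - l)).le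
    have hd1 : ‖(jb k : ℂ) ^ (m + 1) - (jb l : ℂ) ^ (m + 1)‖ ≤
        (m + 1) * 2 ^ m * jb (k - l) * (jb (k - l) ^ m + jb l ^ m) := by
      refine le_trans (le_of_eq ?_) (abs_jb_pow_sub_le m k l)
      rw [← Real.norm_eq_abs, ← Complex.norm_real]
      push_cast
      rfl
    simp only [hB, norm_mul, norm_pow, Complex.norm_real, RCLike.norm_conj,
      Real.norm_eq_abs, abs_of_nonneg h1]
    calc _ ≤ jb k ^ (m + 1) * ‖f k‖ * (‖b (k - l)‖ *
          (((m + 1) * 2 ^ m * jb (k - l) * (jb (k - l) ^ m + jb l ^ m)) *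
            (2 * Real.pi * (jb l * ‖f l‖)))) := by
          gcongr
          exact norm_dseq_le j f l
      _ = _ := by push_cast; ring
  rw [hsplit, Complex.add_re]
  have hA2 : |(∑ k ∈ S, ∑ l ∈ S, A k l).re| ≤ Real.pi * (2 * embConst d * (R' * R * R')) := by
    have := (Complex.abs_re_le_norm _).trans hAbound
    rw [← hsymm, abs_mul, abs_two] at this
    linarith
  have hB2 := (Complex.abs_re_le_norm _).trans hBbound
  refine (abs_add_le _ _).trans ((add_le_add hA2 hB2).trans ?_)
  have hW : 0 ≤ 2 * embConst d * (R' * R * R') :=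
    mul_nonneg (mul_nonneg zero_le_two embConst_nonneg)
      (mul_nonneg (mul_nonneg hf.1 hb.1) hf.1)
  rw [← add_mul]
  refine mul_le_mul_of_nonneg_right ?_ hW
  have : (0 : ℝ) ≤ (m + 1 : ℕ) * 2 ^ m := by positivity
  rw [pow_succ]
  nlinarith

end Trilinear

/-! ### Gronwall's inequality and ordinary differential equations -/

/-- Gronwall's inequality for `1 + y` with a constant rate. -/
lemma gronwall_one_add {y y' : ℝ → ℝ} {T μ : ℝ} (hT : 0 ≤ T)
    (hy : ContinuousOn y (Set.Icc 0 T)) (hd : ∀ t ∈ Set.Ioo 0 T, HasDerivAt y (y' t) t)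
    (hle : ∀ t ∈ Set.Ioo 0 T, y' t ≤ μ * (1 + y t)) :
    1 + y T ≤ (1 + y 0) * Real.exp (μ * T) := by
  have hd' : ∀ t ∈ Set.Ioo 0 T, HasDerivAt (fun t => (1 + y t) * Real.exp (-(μ * t)))
      (y' t * Real.exp (-(μ * t)) + (1 + y t) * (Real.exp (-(μ * t)) * -(μ * 1))) t := fun t ht =>
    ((hd t ht).const_add 1).mul (((hasDerivAt_id t).const_mul μ).neg.exp)
  have hanti : AntitoneOn (fun t => (1 + y t) * Real.exp (-(μ * t))) (Set.Icc 0 T) := by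
    refine antitoneOn_of_deriv_nonpos (convex_Icc 0 T) ?_ ?_ ?_
    · exact (continuousOn_const.add hy).mul (by fun_prop)
    · rw [interior_Icc]
      exact fun t ht => (hd' t ht).differentiableAt.differentiableWithinAt
    · rw [interior_Icc]
      intro t ht
      rw [(hd' t ht).deriv]
      have := hle t ht
      have := Real.exp_pos (-(μ * t))
      nlinarith
  have h := hanti ⟨le_rfl, hT⟩ ⟨hT, le_rfl⟩ hT
  simp only [mul_zero, neg_zero, Real.exp_zero, mul_one, Real.exp_neg] at h
  rwa [← div_eq_mul_inv, div_le_iff₀ (Real.exp_pos _)] at h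

section ODE

variable {X P : Type*} [NormedAddCommGroup X] [NormedSpace ℝ X] [FiniteDimensional ℝ X]
  [NormedAddCommGroup P] [NormedSpace ℝ P] [FiniteDimensional ℝ P]

/-- Solvability on a given time interval of an ordinary differential equation whose vector field
is of class `C¹`, bounded, and zero for large arguments. -/
lemma exists_solution_of_compact (F : P × X → X) (hF : ContDiff ℝ 1 F) {r : ℝ}
    (hr : ∀ c x, r < ‖x‖ → F (c, x) = 0) {T : ℝ} (hT : 0 ≤ T) (c : ℝ → P)
    (hc : ContinuousOn c (Set.Icc 0 T)) (x₀ : X) :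
    ∃ x : ℝ → X, x 0 = x₀ ∧
      ∀ t ∈ Set.Icc 0 T, HasDerivWithinAt x (F (c t, x t)) (Set.Icc 0 T) t := by
  have : ProperSpace P := FiniteDimensional.proper_real P
  have : ProperSpace X := FiniteDimensional.proper_real X
  obtain ⟨rc, hrc⟩ := isCompact_Icc.exists_bound_of_continuousOn hc
  obtain ⟨L, hL⟩ := ((isCompact_closedBall (0 : P) rc).prod
    (isCompact_closedBall (0 : X) r)).exists_bound_of_continuousOn hF.continuous.continuousOn
  have hbound : ∀ t ∈ Set.Icc 0 T, ∀ x, ‖F (c t, x)‖ ≤ max L 0 := by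
    intro t ht x
    by_cases hx : r < ‖x‖
    · rw [hr _ _ hx, norm_zero]; exact le_max_right _ _
    · exact (hL (c t, x) ⟨by simpa using hrc t ht, by simpa using hx⟩).trans (le_max_left _ _)
  let L' : NNReal := ⟨max L 0, le_max_right _ _⟩
  -- With speed at most `L'`, the solution stays within this distance of `x₀` up to time `T`;
  -- Picard–Lindelöf therefore applies on the whole interval at once.
  let a : NNReal := L' * ⟨T, hT⟩
  obtain ⟨K, hK⟩ := (hF.contDiffOn (s := Metric.closedBall (0 : P) rc ×ˢ
    Metric.closedBall x₀ a)).exists_lipschitzOnWith one_ne_zero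
    ((convex_closedBall _ _).prod (convex_closedBall _ _))
    ((isCompact_closedBall _ _).prod (isCompact_closedBall _ _))
  have hPL : IsPicardLindelof (fun t x => F (c t, x)) (⟨0, le_rfl, hT⟩ : Set.Icc (0 : ℝ) T)
      x₀ a 0 L' K := by
    refine ⟨fun t ht => ?_, fun x _ => ?_, fun t ht x _ => hbound t ht x, ?_⟩
    · refine LipschitzOnWith.of_dist_le_mul fun x hx y hy => ?_
      refine (hK.dist_le_mul (c t, x) ⟨by simpa using hrc t ht, hx⟩ (c t, y)
        ⟨by simpa using hrc t ht, hy⟩).trans_eq ?_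
      simp [Prod.dist_eq]
    · exact hF.continuous.comp_continuousOn (hc.prodMk continuousOn_const)
    · simp only [sub_zero, max_eq_left hT, NNReal.coe_zero, sub_self]
      exact (NNReal.coe_mul L' ⟨T, hT⟩).ge
  obtain ⟨x, hx0, hx⟩ := hPL.exists_eq_forall_mem_Icc_hasDerivWithinAt₀
  exact ⟨x, hx0, hx⟩

/-- An energy inequality on the range `E ≤ 2 M` gives a solution on the whole time interval on
which Gronwall's inequality keeps the energy below `M`. The linear involution `J` is a symmetry:
the energy inequality is only required on its fixed points. -/
lemma exists_solution_of_energy (Φ : P × X → X) (hΦ : ContDiff ℝ 1 Φ) {T : ℝ} (hT : 0 ≤ T)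
    (c : ℝ → P) (hc : ContinuousOn c (Set.Icc 0 T)) (J : X →L[ℝ] X) (hJ : ∀ x, J (J x) = x)
    (hΦJ : ∀ t ∈ Set.Icc 0 T, ∀ x, J x = x → J (Φ (c t, x)) = Φ (c t, x))
    (E : X → ℝ) (hE : ContDiff ℝ 1 E) (hE0 : ∀ x, 0 ≤ E x) {r : ℝ} (hcoer : ∀ x, ‖x‖ ^ 2 ≤ r * E x)
    (hr : 0 ≤ r) {M : ℝ} (hM : 0 < M) (μ : ℝ → ℝ) (hμ : MonotoneOn μ (Set.Icc 0 T))
    (hμ0 : ∀ t ∈ Set.Icc 0 T, 0 ≤ μ t)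
    (henergy : ∀ t ∈ Set.Icc 0 T, ∀ x, J x = x → E x ≤ 2 * M →
      fderiv ℝ E x (Φ (c t, x)) ≤ μ t * (1 + E x))
    (x₀ : X) (hx₀ : J x₀ = x₀) (hgrow : (1 + E x₀) * Real.exp (μ T * T) ≤ 1 + M) :
    ∃ x : ℝ → X, x 0 = x₀ ∧ ∀ t ∈ Set.Icc 0 T,
      HasDerivWithinAt x (Φ (c t, x t)) (Set.Icc 0 T) t ∧ J (x t) = x t ∧
      1 + E (x t) ≤ (1 + E x₀) * Real.exp (μ t * t) := by
  -- A cutoff equal to `1` where `E ≤ M` and to `0` where `E ≥ 2 * M`; by coercivity the truncated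
  -- field vanishes for large arguments.
  let χ : X → ℝ := fun x => Real.smoothTransition (2 - E x / M)
  have hχ : ContDiff ℝ 1 χ := Real.smoothTransition.contDiff.comp
    (contDiff_const.sub (hE.div_const M))
  have hχ1 : ∀ x, E x ≤ M → χ x = 1 := fun x hx => Real.smoothTransition.one_of_one_le (by
    have := (div_le_one hM).mpr hx; linarith)
  have hχ0 : ∀ x, 2 * M ≤ E x → χ x = 0 := fun x hx => Real.smoothTransition.zero_of_nonpos (by
    have := (le_div_iff₀ hM).mpr hx; linarith)
  -- The projection onto the fixed points of `J`. Composing with it makes the flow preserve the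
  -- fixed points, although nothing is known about the field outside them.
  let Q : X →L[ℝ] X := (1 / 2 : ℝ) • (ContinuousLinearMap.id ℝ X + J)
  have hQ : ∀ x, J (Q x) = Q x := fun x => by simp [Q, hJ, add_comm]
  have hQfix : ∀ x, J x = x → Q x = x := fun x hx => by
    simp only [Q, smul_apply, add_apply,
      ContinuousLinearMap.id_apply, hx, ← two_smul ℝ x, smul_smul]
    norm_num
  obtain ⟨x, hx0, hx⟩ := exists_solution_of_compact (fun p : P × X => χ p.2 • Q (Φ p))
    ((hχ.comp contDiff_snd).smul (Q.contDiff.comp hΦ)) (r := Real.sqrt (r * (2 * M)))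
    (fun c x hx => by
      have : 2 * M ≤ E x := by
        by_contra hlt
        push Not at hlt
        have h1 := hcoer x
        refine absurd hx (not_lt.mpr (Real.le_sqrt_of_sq_le (h1.trans ?_)))
        gcongr
      simp [hχ0 x this]) hT c hc x₀
  have hxc : ContinuousOn x (Set.Icc 0 T) := fun t ht => (hx t ht).continuousWithinAt
  have hderiv : ∀ t ∈ Set.Ioo 0 T, HasDerivAt x (χ (x t) • Q (Φ (c t, x t))) t := fun t ht =>
    (hx t ⟨ht.1.le, ht.2.le⟩).hasDerivAt (Icc_mem_nhds ht.1 ht.2)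
  have hreal : ∀ t ∈ Set.Icc 0 T, J (x t) = x t := by
    intro t ht
    have hd : ∀ t ∈ Set.Icc 0 T,
        HasDerivWithinAt (fun t => J (x t) - x t) 0 (Set.Icc 0 T) t := fun t ht => by
      have := (J.hasFDerivAt.comp_hasDerivWithinAt t (hx t ht)).sub (hx t ht)
      simp only [map_smul, hQ, sub_self] at this
      exact this
    have := constant_of_derivWithin_zero (f := fun t => J (x t) - x t) (a := 0) (b := T)
      (fun t ht => (hd t ht).differentiableWithinAt)
      (fun t ht => (hd t ⟨ht.1, ht.2.le⟩).derivWithin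
        (uniqueDiffOn_Icc (ht.1.trans_lt ht.2) t ⟨ht.1, ht.2.le⟩)) t ht
    simp only [hx0, hx₀, sub_self] at this
    exact sub_eq_zero.mp this
  -- The cutoff lies in `[0, 1]`, so it can only lower the nonnegative upper bound. Freezing the
  -- rate at its value at `t` permits Gronwall's inequality with a constant rate on `[0, t]`.
  have henergy' : ∀ t ∈ Set.Icc 0 T, ∀ τ ∈ Set.Icc 0 t,
      fderiv ℝ E (x τ) (χ (x τ) • Q (Φ (c τ, x τ))) ≤ μ t * (1 + E (x τ)) := by
    intro t ht τ hτ
    have hτT : τ ∈ Set.Icc 0 T := ⟨hτ.1, hτ.2.trans ht.2⟩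
    have h0 := hE0 (x τ)
    have hμt := hμ0 t ht
    rcases le_total (2 * M) (E (x τ)) with h | h
    · rw [hχ0 _ h, zero_smul, map_zero]
      positivity
    · rw [hQfix _ (hΦJ τ hτT _ (hreal τ hτT)), map_smul, smul_eq_mul]
      have h1 := henergy τ hτT _ (hreal τ hτT) h
      have h2 : μ τ ≤ μ t := hμ hτT ht hτ.2
      have h3 : μ τ * (1 + E (x τ)) ≤ μ t * (1 + E (x τ)) := by gcongr
      have hc0 : 0 ≤ χ (x τ) := Real.smoothTransition.nonneg _
      have hc1 : χ (x τ) ≤ 1 := Real.smoothTransition.le_one _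
      calc _ ≤ χ (x τ) * (μ t * (1 + E (x τ))) := by gcongr; exact h1.trans h3
        _ ≤ _ := mul_le_of_le_one_left (by positivity) hc1
  have hbound : ∀ t ∈ Set.Icc 0 T, 1 + E (x t) ≤ (1 + E x₀) * Real.exp (μ t * t) := by
    intro t ht
    rw [← hx0]
    refine gronwall_one_add (y := fun t => E (x t)) ht.1
      (hE.continuous.comp_continuousOn (hxc.mono (Set.Icc_subset_Icc_right ht.2)))
      (fun τ hτ => ?_) (fun τ hτ => henergy' t ht τ ⟨hτ.1.le, hτ.2.le⟩)
    exact ((hE.differentiable one_ne_zero _).hasFDerivAt.comp_hasDerivAt τ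
      (hderiv τ ⟨hτ.1, hτ.2.trans_le ht.2⟩))
  refine ⟨x, hx0, fun t ht => ⟨?_, hreal t ht, hbound t ht⟩⟩
  -- The solution never reaches the region where the cutoff differs from `1`, so it solves the
  -- original equation.
  have hEt : E (x t) ≤ M := by
    have h1 := hbound t ht
    have h2 : (1 + E x₀) * Real.exp (μ t * t) ≤ (1 + E x₀) * Real.exp (μ T * T) := by
      have := hE0 x₀
      have h3 : μ t ≤ μ T := hμ ht ⟨hT, le_rfl⟩ ht.2
      have h4 := hμ0 t ht
      gcongr
      exacts [ht.1, h4.trans h3, ht.2]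
    linarith
  have := hx t ht
  rwa [hχ1 _ hEt, one_smul, hQfix _ (hΦJ t ht _ (hreal t ht))] at this

end ODE

/-! ### The system for the rescaled perturbation -/

/-- The direction `k / |k|` of a frequency; zero for the zero frequency. -/
def dir (k : Freq d) (j : Fin d) : ℝ := k j / modulus k

/-- The Fourier multiplier `2π|k|`. -/
def absD (f : Freq d → ℂ) (k : Freq d) : ℂ := 2 * Real.pi * modulus k * f k

/-- The right-hand side of the equation for the rescaled perturbation `u` of the velocity. -/
def velField (ε : ℝ) (a u : Fin d → Freq d → ℂ) (σ : Freq d → ℂ) (i : Fin d) (k : Freq d) : ℂ :=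
  -∑ j, (conv (fun l => a j l + ε * u j l) (dseq j (u i)) k + conv (u j) (dseq j (a i)) k)
    - Complex.I * dir k i * σ k / ε

/-- The right-hand side of the equation for the rescaled perturbation `σ` of the electric field. -/
def fieldField (ε : ℝ) (a : Fin d → Freq d → ℂ) (q h : Freq d → ℂ) (u : Fin d → Freq d → ℂ)
    (σ : Freq d → ℂ) (k : Freq d) : ℂ :=
  -∑ j, Complex.I * dir k j * (conv (fun l => a j l + ε * u j l) (absD σ) k + ε * conv (u j) q k
    + u j k / ε) - h k

lemma abs_dir_le (k : Freq d) (j : Fin d) : |dir k j| ≤ 1 := by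
  rw [dir, abs_div, abs_of_nonneg (modulus_nonneg k)]
  exact div_le_one_of_le₀ (abs_coord_le_modulus k j) (modulus_nonneg k)

lemma dir_neg (k : Freq d) (j : Fin d) : dir (-k) j = -dir k j := by
  simp [dir, modulus_neg, neg_div]

/-- Also valid at `k = 0`, where both sides vanish. -/
lemma dir_mul_modulus (k : Freq d) (j : Fin d) : dir k j * modulus k = k j := by
  rcases eq_or_ne k 0 with rfl | hk
  · simp [dir]
  · exact div_mul_cancel₀ _ (modulus_pos hk).ne'

/-- At `l = k` the symbol vanishes because the direction times the length is `k`. Replacing `|l|` by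
`|k|` and `l` by `k` costs `|k - l|` each, so the derivative can be moved from `σ` to the velocity.
-/
lemma abs_dir_mul_sub_le_left (k l : Freq d) (j : Fin d) :
    |dir k j * modulus l - l j| ≤ 2 * modulus (k - l) := by
  have e : dir k j * modulus l - l j = dir k j * (modulus l - modulus k) + ((k - l) j : ℤ) := by
    rw [mul_sub, dir_mul_modulus]
    push_cast [Pi.sub_apply]
    ring
  rw [e]
  refine (abs_add_le _ _).trans ?_
  have h1 : |dir k j * (modulus l - modulus k)| ≤ modulus (k - l) := by
    rw [abs_mul, abs_sub_comm]
    exact (mul_le_of_le_one_left (abs_nonneg _) (abs_dir_le k j)).trans (abs_modulus_sub_le k l)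
  have h2 := abs_coord_le_modulus (k - l) j
  linarith

/-- The crude bound, for the case in which the velocity already carries the `s` derivatives. -/
lemma abs_dir_mul_sub_le_right (k l : Freq d) (j : Fin d) :
    |dir k j * modulus l - l j| ≤ 2 * modulus l := by
  refine (abs_sub _ _).trans ?_
  have h1 : |dir k j * modulus l| ≤ modulus l := by
    rw [abs_mul, abs_of_nonneg (modulus_nonneg l)]
    exact mul_le_of_le_one_left (modulus_nonneg l) (abs_dir_le k j)
  have h2 := abs_coord_le_modulus l j
  linarith

lemma conv_eq_sum_right (f : Freq d → ℂ) {g : Freq d → ℂ} {S : Finset (Freq d)}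
    (hg : ∀ k ∉ S, g k = 0) (k : Freq d) : conv f g k = ∑ l ∈ S, f (k - l) * g l :=
  tsum_eq_sum fun l hl => by rw [hg l hl, mul_zero]

lemma conv_eq_sum_left {f : Freq d → ℂ} (g : Freq d → ℂ) {S : Finset (Freq d)}
    (hf : ∀ k ∉ S, f k = 0) (k : Freq d) : conv f g k = ∑ l ∈ S, g (k - l) * f l := by
  rw [conv_comm, conv_eq_sum_right g hf]

lemma dseq_support {f : Freq d → ℂ} {S : Finset (Freq d)} (hf : ∀ k ∉ S, f k = 0) (j : Fin d) :
    ∀ k ∉ S, dseq j f k = 0 := fun k hk => by rw [dseq, hf k hk, mul_zero]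

lemma absD_support {f : Freq d → ℂ} {S : Finset (Freq d)} (hf : ∀ k ∉ S, f k = 0) :
    ∀ k ∉ S, absD f k = 0 := fun k hk => by rw [absD, hf k hk, mul_zero]

/-! ### The energy inequality uniform in `ε` -/

section Energy

variable {s : ℕ} {f g b : Freq d → ℂ} {R R' X : ℝ}

/-- For terms of order zero: half of the weight stays on `f`, and `jb_pow_le` distributes the other
half over the product. -/
lemma norm_sum_product_le (hd : d ≤ 3) (hs : 3 ≤ s) (hf : SobBound s f X)
    (hb : SobBound s b R) (hg : SobBound s g R') (S L : Finset (Freq d))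
    (c : Freq d → ℂ) {C : ℝ} (hC : 0 ≤ C) (hc : ∀ k, ‖c k‖ ≤ C) :
    ‖∑ k ∈ S, ∑ l ∈ L, (jb k ^ (2 * s) : ℂ) * conj (f k) * (c k * (b (k - l) * g l))‖ ≤
      (2 ^ s * C) * (2 * embConst d * (X * R * R')) := by
  refine norm_sum_le_of_kernel hd hs hf hb hg S L (by positivity) _ fun k l => ?_
  have h1 := (jb_pos k).le
  have h2 := one_le_jb l
  have h3 := one_le_jb (k - l)
  have h2' := (jb_pos l).le
  have h3' := (jb_pos (k - l)).le
  simp only [norm_mul, norm_pow, Complex.norm_real, RCLike.norm_conj, Real.norm_eq_abs,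
    abs_of_nonneg h1]
  calc _ ≤ jb k ^ (2 * s) * ‖f k‖ * (C * (‖b (k - l)‖ * ‖g l‖)) := by
        have := hc k
        gcongr
    _ = (jb k ^ s * ‖f k‖) * C * (jb k ^ s * (‖b (k - l)‖ * ‖g l‖)) := by ring
    _ ≤ (jb k ^ s * ‖f k‖) * C * ((2 ^ s * (jb (k - l) ^ s * jb l + jb (k - l) * jb l ^ s)) *
          (‖b (k - l)‖ * ‖g l‖)) := by
        refine mul_le_mul_of_nonneg_left ?_ (by positivity)
        refine mul_le_mul_of_nonneg_right ((jb_pow_le s k l).trans ?_) (by positivity)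
        gcongr
        · exact le_mul_of_one_le_right (by positivity) h2
        · exact le_mul_of_one_le_left (by positivity) h3
    _ = _ := by ring

/-- The error made when the nonlocal term is replaced by a transport term. The two bounds on its
symbol are used in the two regimes of `jb_pow_le`, so that never more than `s` derivatives fall on
one factor. -/
lemma norm_sum_symbol_le (hd : d ≤ 3) (hs : 3 ≤ s) (hf : SobBound s f X)
    (hb : SobBound s b R) (hg : SobBound s g R') (S L : Finset (Freq d)) (j : Fin d) :
    ‖∑ k ∈ S, ∑ l ∈ L, (jb k ^ (2 * s) : ℂ) * conj (f k) * (b (k - l) *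
      (2 * Real.pi * Complex.I * ((dir k j * modulus l - l j : ℝ) : ℂ) * g l))‖ ≤
      (2 * Real.pi * 2 ^ (s + 1)) * (2 * embConst d * (X * R * R')) := by
  have hpi := Real.pi_pos
  refine norm_sum_le_of_kernel hd hs hf hb hg S L (by positivity) _ fun k l => ?_
  have h1 := (jb_pos k).le
  have h2' := (jb_pos l).le
  have h3' := (jb_pos (k - l)).le
  simp only [norm_mul, norm_pow, Complex.norm_real, RCLike.norm_conj, Real.norm_eq_abs,
    abs_of_nonneg h1, Complex.norm_I, Complex.norm_ofNat, mul_one, abs_of_pos hpi]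
  have key : jb k ^ s * |dir k j * modulus l - l j| ≤
      2 ^ (s + 1) * (jb (k - l) ^ s * jb l + jb (k - l) * jb l ^ s) := by
    calc _ ≤ (2 ^ s * (jb (k - l) ^ s + jb l ^ s)) * |dir k j * modulus l - l j| := by
          gcongr
          exact jb_pow_le s k l
      _ = 2 ^ s * (jb (k - l) ^ s * |dir k j * modulus l - l j| +
            jb l ^ s * |dir k j * modulus l - l j|) := by ring
      _ ≤ 2 ^ s * (jb (k - l) ^ s * (2 * jb l) + jb l ^ s * (2 * jb (k - l))) := by
          gcongr
          · exact (abs_dir_mul_sub_le_right k l j).trans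
              (by have := modulus_le_jb l; linarith)
          · exact (abs_dir_mul_sub_le_left k l j).trans
              (by have := modulus_le_jb (k - l); linarith)
      _ = _ := by ring
  calc _ = (2 * Real.pi) * (jb k ^ s * ‖f k‖) * ((jb k ^ s * |dir k j * modulus l - l j|) *
        (‖b (k - l)‖ * ‖g l‖)) := by ring
    _ ≤ (2 * Real.pi) * (jb k ^ s * ‖f k‖) * ((2 ^ (s + 1) *
        (jb (k - l) ^ s * jb l + jb (k - l) * jb l ^ s)) * (‖b (k - l)‖ * ‖g l‖)) := by gcongr
    _ = _ := by ring

/-- The pairing of the vector field with the solution in `H^s`, decomposed into transport terms,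
terms of order zero, and a term without real part. -/
lemma pairing_eq {ε : ℝ} (s : ℕ) (S : Finset (Freq d)) (a : Fin d → Freq d → ℂ) (q h : Freq d → ℂ)
    (u : Fin d → Freq d → ℂ) (σ : Freq d → ℂ) (hu : ∀ i, ∀ k ∉ S, u i k = 0)
    (hσ : ∀ k ∉ S, σ k = 0) :
    (∑ i, ∑ k ∈ S, (jb k ^ (2 * s) : ℂ) * conj (u i k) * velField ε a u σ i k) +
      ∑ k ∈ S, (jb k ^ (2 * s) : ℂ) * conj (σ k) * fieldField ε a q h u σ k =
    -(∑ i, ∑ j, ∑ k ∈ S, ∑ l ∈ S, (jb k ^ (2 * s) : ℂ) * conj (u i k) *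
        ((a j (k - l) + ε * u j (k - l)) * dseq j (u i) l))
    - (∑ i, ∑ j, ∑ k ∈ S, ∑ l ∈ S, (jb k ^ (2 * s) : ℂ) * conj (u i k) *
        (1 * (dseq j (a i) (k - l) * u j l)))
    - (∑ j, ∑ k ∈ S, ∑ l ∈ S, (jb k ^ (2 * s) : ℂ) * conj (σ k) *
        ((a j (k - l) + ε * u j (k - l)) * dseq j σ l))
    - (∑ j, ∑ k ∈ S, ∑ l ∈ S, (jb k ^ (2 * s) : ℂ) * conj (σ k) *
        ((a j (k - l) + ε * u j (k - l)) *
          (2 * Real.pi * Complex.I * ((dir k j * modulus l - l j : ℝ) : ℂ) * σ l)))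
    - (∑ j, ∑ k ∈ S, ∑ l ∈ S, (jb k ^ (2 * s) : ℂ) * conj (σ k) *
        (Complex.I * dir k j * ε * (q (k - l) * u j l)))
    - (∑ k ∈ S, (jb k ^ (2 * s) : ℂ) * conj (σ k) * h k)
    - ∑ k ∈ S, ∑ j, ((jb k ^ (2 * s) * dir k j / ε : ℝ) : ℂ) * Complex.I *
        (conj (u j k) * σ k + u j k * conj (σ k)) := by
  have hvel : ∀ i k, velField ε a u σ i k =
      -∑ j, (∑ l ∈ S, (a j (k - l) + ε * u j (k - l)) * dseq j (u i) l
        + ∑ l ∈ S, dseq j (a i) (k - l) * u j l) - Complex.I * dir k i * σ k / ε := by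
    intro i k
    simp only [velField]
    congr 2
    refine Finset.sum_congr rfl fun j _ => ?_
    rw [conv_eq_sum_right _ (dseq_support (hu i) j), conv_eq_sum_left _ (hu j)]
  have hfld : ∀ k, fieldField ε a q h u σ k =
      -∑ j, Complex.I * dir k j * (∑ l ∈ S, (a j (k - l) + ε * u j (k - l)) * absD σ l
        + ε * ∑ l ∈ S, q (k - l) * u j l + u j k / ε) - h k := by
    intro k
    simp only [fieldField]
    congr 2
    refine Finset.sum_congr rfl fun j _ => ?_
    rw [conv_eq_sum_right _ (absD_support hσ), conv_eq_sum_left _ (hu j)]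
  simp only [hvel, hfld]
  have hA : ∀ i, ∑ k ∈ S, (jb k ^ (2 * s) : ℂ) * conj (u i k) *
      (-∑ j, (∑ l ∈ S, (a j (k - l) + ε * u j (k - l)) * dseq j (u i) l
        + ∑ l ∈ S, dseq j (a i) (k - l) * u j l) - Complex.I * dir k i * σ k / ε) =
      -(∑ j, ∑ k ∈ S, ∑ l ∈ S, (jb k ^ (2 * s) : ℂ) * conj (u i k) *
        ((a j (k - l) + ε * u j (k - l)) * dseq j (u i) l))
      - (∑ j, ∑ k ∈ S, ∑ l ∈ S, (jb k ^ (2 * s) : ℂ) * conj (u i k) *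
        (1 * (dseq j (a i) (k - l) * u j l)))
      - ∑ k ∈ S, ((jb k ^ (2 * s) * dir k i / ε : ℝ) : ℂ) * Complex.I * (conj (u i k) * σ k) := by
    intro i
    rw [Finset.sum_comm (s := Finset.univ), Finset.sum_comm (s := Finset.univ),
      ← Finset.sum_neg_distrib, ← Finset.sum_sub_distrib, ← Finset.sum_sub_distrib]
    refine Finset.sum_congr rfl fun k _ => ?_
    simp only [← Finset.mul_sum, one_mul, Finset.sum_add_distrib]
    push_cast
    ring
  have hB : ∑ k ∈ S, (jb k ^ (2 * s) : ℂ) * conj (σ k) *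
      (-∑ j, Complex.I * dir k j * (∑ l ∈ S, (a j (k - l) + ε * u j (k - l)) * absD σ l
        + ε * ∑ l ∈ S, q (k - l) * u j l + u j k / ε) - h k) =
      -(∑ j, ∑ k ∈ S, ∑ l ∈ S, (jb k ^ (2 * s) : ℂ) * conj (σ k) *
        ((a j (k - l) + ε * u j (k - l)) * dseq j σ l))
      - (∑ j, ∑ k ∈ S, ∑ l ∈ S, (jb k ^ (2 * s) : ℂ) * conj (σ k) *
        ((a j (k - l) + ε * u j (k - l)) *
          (2 * Real.pi * Complex.I * ((dir k j * modulus l - l j : ℝ) : ℂ) * σ l)))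
      - (∑ j, ∑ k ∈ S, ∑ l ∈ S, (jb k ^ (2 * s) : ℂ) * conj (σ k) *
        (Complex.I * dir k j * ε * (q (k - l) * u j l)))
      - (∑ k ∈ S, (jb k ^ (2 * s) : ℂ) * conj (σ k) * h k)
      - ∑ k ∈ S, ∑ j, ((jb k ^ (2 * s) * dir k j / ε : ℝ) : ℂ) * Complex.I *
          (u j k * conj (σ k)) := by
    rw [Finset.sum_comm (s := Finset.univ), Finset.sum_comm (s := Finset.univ),
      Finset.sum_comm (s := Finset.univ),
      ← Finset.sum_neg_distrib, ← Finset.sum_sub_distrib, ← Finset.sum_sub_distrib,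
      ← Finset.sum_sub_distrib, ← Finset.sum_sub_distrib]
    refine Finset.sum_congr rfl fun k _ => ?_
    rw [mul_sub, mul_neg, Finset.mul_sum, ← Finset.sum_neg_distrib, ← Finset.sum_neg_distrib,
      ← Finset.sum_sub_distrib, ← Finset.sum_sub_distrib, sub_right_comm, ← Finset.sum_sub_distrib]
    congr 1
    refine Finset.sum_congr rfl fun j _ => ?_
    -- The nonlocal term is split into the transport term with symbol `l j` and a remainder whose
    -- symbol is of order zero in the sense of the estimates above.
    have e : ∑ l ∈ S, (a j (k - l) + ε * u j (k - l)) * (Complex.I * dir k j * absD σ l) =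
        ∑ l ∈ S, (a j (k - l) + ε * u j (k - l)) * dseq j σ l +
        ∑ l ∈ S, (a j (k - l) + ε * u j (k - l)) *
          (2 * Real.pi * Complex.I * ((dir k j * modulus l - l j : ℝ) : ℂ) * σ l) := by
      rw [← Finset.sum_add_distrib]
      refine Finset.sum_congr rfl fun l _ => ?_
      simp only [absD, dseq]
      push_cast
      ring
    have e' : Complex.I * dir k j * ∑ l ∈ S, (a j (k - l) + ε * u j (k - l)) * absD σ l =
        ∑ l ∈ S, (a j (k - l) + ε * u j (k - l)) * (Complex.I * dir k j * absD σ l) := by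
      rw [Finset.mul_sum]
      exact Finset.sum_congr rfl fun l _ => by ring
    have e2 := e'.trans e
    simp only [← Finset.mul_sum]
    push_cast at e2 ⊢
    linear_combination (-((jb k : ℂ) ^ (2 * s) * conj (σ k))) * e2
  rw [hB, Finset.sum_congr rfl fun i _ => hA i]
  simp only [Finset.sum_sub_distrib, Finset.sum_neg_distrib, mul_add, Finset.sum_add_distrib]
  rw [Finset.sum_comm (s := Finset.univ) (t := S) (f := fun i k =>
    ((jb k ^ (2 * s) * dir k i / ε : ℝ) : ℂ) * Complex.I * (conj (u i k) * σ k))]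
  ring

/-- The constant of the energy inequality. -/
def energyConst (d s : ℕ) : ℝ :=
  2 * ((2 * embConst d) * (d ^ 2 * (2 * Real.pi * (s * 2 ^ s + 1)) + d ^ 2 * (2 ^ s * 1 * (2 * Real.pi))
    + d * (2 * Real.pi * (s * 2 ^ s + 1)) + d * (2 * Real.pi * 2 ^ (s + 1)) + d * 2 ^ s) + 1)

lemma energyConst_nonneg (d s : ℕ) : 0 ≤ energyConst d s := by
  have := embConst_nonneg (d := d)
  have := Real.pi_pos
  unfold energyConst
  positivity

lemma abs_re_sum_le {ι : Type*} [Fintype ι] {z : ι → ℂ} {C : ℝ} (h : ∀ i, |(z i).re| ≤ C) :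
    |(∑ i, z i).re| ≤ Fintype.card ι * C := by
  rw [Complex.re_sum]
  refine (Finset.abs_sum_le_sum_abs _ _).trans ((Finset.sum_le_sum fun i _ => h i).trans ?_)
  simp

/-- The energy inequality. The singular terms cancel, so that the rate does not grow as
`ε → 0`. -/
lemma energy_inequality (hd : d ≤ 3) (hs : 3 ≤ s) {ε : ℝ} (hε : 0 < ε) (S : Finset (Freq d))
    {a : Fin d → Freq d → ℂ} {q h : Freq d → ℂ} {u : Fin d → Freq d → ℂ} {σ : Freq d → ℂ}
    {A Y : ℝ} (hu : ∀ i, ∀ k ∉ S, u i k = 0) (hσ : ∀ k ∉ S, σ k = 0)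
    (har : ∀ i, IsRealSeq (a i)) (hur : ∀ i, IsRealSeq (u i))
    (ha : ∀ i, SobBound (s + 1) (a i) A) (hq : SobBound s q A) (hh : SobBound s h A)
    (hu' : ∀ i, SobBound s (u i) Y) (hσ' : SobBound s σ Y) :
    2 * ((∑ i, ∑ k ∈ S, (jb k ^ (2 * s) : ℂ) * conj (u i k) * velField ε a u σ i k) +
      ∑ k ∈ S, (jb k ^ (2 * s) : ℂ) * conj (σ k) * fieldField ε a q h u σ k).re ≤
    energyConst d s * (1 + A) * (1 + ε * (1 + Y)) * (1 + Y ^ 2) := by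
  have hA0 : 0 ≤ A := hq.1
  have hY0 : 0 ≤ Y := hσ'.1
  have hpi := Real.pi_pos
  have hemb := embConst_nonneg (d := d)
  set Rb : ℝ := A + ε * Y with hRb
  have hb : ∀ j, SobBound s (fun l => a j l + ε * u j l) Rb := fun j => by
    have := ((ha j).of_le (Nat.le_succ s)).add ((hu' j).smul (ε : ℂ))
    rwa [Complex.norm_real, Real.norm_of_nonneg hε.le] at this
  have hbr : ∀ j, IsRealSeq fun l => a j l + ε * u j l := fun j =>
    (har j).add ((hur j).smul ε)
  rw [pairing_eq s S a q h u σ hu hσ]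
  -- A common majorant for all terms. The size of `u` in the transporting velocity enters only
  -- through `ε * Y`.
  set Λ : ℝ := (1 + A) * (1 + ε * (1 + Y)) * (1 + Y ^ 2) with hΛ
  have hRbΛ : Y * Rb * Y ≤ Λ := by
    have h1 : Rb ≤ (1 + A) * (1 + ε * (1 + Y)) := by
      have : 0 ≤ A * (ε * (1 + Y)) := by positivity
      rw [hRb]; nlinarith
    have h2 : Y * Y ≤ 1 + Y ^ 2 := by nlinarith
    calc Y * Rb * Y = Rb * (Y * Y) := by ring
      _ ≤ _ := mul_le_mul h1 h2 (by positivity) (by positivity)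
  have hAΛ : Y * A * Y ≤ Λ := by
    have h1 : A ≤ (1 + A) * (1 + ε * (1 + Y)) := by
      have : 0 ≤ (1 + A) * (ε * (1 + Y)) := by positivity
      nlinarith
    have h2 : Y * Y ≤ 1 + Y ^ 2 := by nlinarith
    calc Y * A * Y = A * (Y * Y) := by ring
      _ ≤ _ := mul_le_mul h1 h2 (by positivity) (by positivity)
  have hεAΛ : ε * (Y * A * Y) ≤ Λ := by
    have h1 : ε * A ≤ (1 + A) * (1 + ε * (1 + Y)) := by
      have : 0 ≤ (1 + A) * (ε * Y) := by positivity
      nlinarith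
    have h2 : Y * Y ≤ 1 + Y ^ 2 := by nlinarith
    calc ε * (Y * A * Y) = ε * A * (Y * Y) := by ring
      _ ≤ _ := mul_le_mul h1 h2 (by positivity) (by positivity)
  have hYAΛ : Y * A ≤ Λ := by
    have h1 : A ≤ (1 + A) * (1 + ε * (1 + Y)) := by
      have : 0 ≤ (1 + A) * (ε * (1 + Y)) := by positivity
      nlinarith
    have h2 : Y ≤ 1 + Y ^ 2 := by nlinarith [sq_nonneg (Y - 1)]
    calc Y * A = A * Y := by ring
      _ ≤ _ := mul_le_mul h1 h2 (by positivity) (by positivity)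
  have t1 : |(∑ i, ∑ j, ∑ k ∈ S, ∑ l ∈ S, (jb k ^ (2 * s) : ℂ) * conj (u i k) *
        ((a j (k - l) + ε * u j (k - l)) * dseq j (u i) l)).re| ≤
      d * (d * ((2 * Real.pi * (s * 2 ^ s + 1)) * (2 * embConst d * Λ))) := by
    have := abs_re_sum_le fun i : Fin d => abs_re_sum_le fun j : Fin d =>
      (re_transport_le hd hs (hb j) (hbr j) (hu' i) j S).trans (show _ ≤
        (2 * Real.pi * (s * 2 ^ s + 1)) * (2 * embConst d * Λ) by gcongr)
    simpa only [Fintype.card_fin] using this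
  have t2 : |(∑ i, ∑ j, ∑ k ∈ S, ∑ l ∈ S, (jb k ^ (2 * s) : ℂ) * conj (u i k) *
        (1 * (dseq j (a i) (k - l) * u j l))).re| ≤
      d * (d * ((2 ^ s * 1) * (2 * embConst d * (2 * Real.pi * Λ)))) := by
    have := abs_re_sum_le fun i : Fin d => abs_re_sum_le fun j : Fin d =>
      ((Complex.abs_re_le_norm _).trans (norm_sum_product_le hd hs (hu' i) ((ha i).dseq j)
        (hu' j) S S (fun _ => 1) zero_le_one (fun _ => by simp))).trans (show _ ≤
        (2 ^ s * 1) * (2 * embConst d * (2 * Real.pi * Λ)) by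
          refine mul_le_mul_of_nonneg_left (mul_le_mul_of_nonneg_left ?_ (by positivity))
            (by positivity)
          calc Y * (2 * Real.pi * A) * Y = 2 * Real.pi * (Y * A * Y) := by ring
            _ ≤ _ := by gcongr)
    simpa only [Fintype.card_fin] using this
  have t3 : |(∑ j, ∑ k ∈ S, ∑ l ∈ S, (jb k ^ (2 * s) : ℂ) * conj (σ k) *
        ((a j (k - l) + ε * u j (k - l)) * dseq j σ l)).re| ≤
      d * ((2 * Real.pi * (s * 2 ^ s + 1)) * (2 * embConst d * Λ)) := by
    have := abs_re_sum_le fun j : Fin d =>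
      (re_transport_le hd hs (hb j) (hbr j) hσ' j S).trans (show _ ≤
        (2 * Real.pi * (s * 2 ^ s + 1)) * (2 * embConst d * Λ) by gcongr)
    simpa only [Fintype.card_fin] using this
  have t4 : |(∑ j, ∑ k ∈ S, ∑ l ∈ S, (jb k ^ (2 * s) : ℂ) * conj (σ k) *
        ((a j (k - l) + ε * u j (k - l)) *
          (2 * Real.pi * Complex.I * ((dir k j * modulus l - l j : ℝ) : ℂ) * σ l))).re| ≤
      d * ((2 * Real.pi * 2 ^ (s + 1)) * (2 * embConst d * Λ)) := by
    have := abs_re_sum_le fun j : Fin d =>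
      ((Complex.abs_re_le_norm _).trans
        (norm_sum_symbol_le hd hs hσ' (hb j) hσ' S S j)).trans (show _ ≤
        (2 * Real.pi * 2 ^ (s + 1)) * (2 * embConst d * Λ) by gcongr)
    simpa only [Fintype.card_fin] using this
  have t5 : |(∑ j, ∑ k ∈ S, ∑ l ∈ S, (jb k ^ (2 * s) : ℂ) * conj (σ k) *
        (Complex.I * dir k j * ε * (q (k - l) * u j l))).re| ≤
      d * (2 ^ s * (2 * embConst d * Λ)) := by
    have := abs_re_sum_le fun j : Fin d =>
      ((Complex.abs_re_le_norm _).trans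
        (norm_sum_product_le hd hs hσ' hq (hu' j) S S (fun k => Complex.I * dir k j * ε) hε.le
          (fun k => by
            simp only [norm_mul, Complex.norm_I, Complex.norm_real, Real.norm_eq_abs, one_mul,
              abs_of_pos hε]
            exact mul_le_of_le_one_left hε.le (abs_dir_le k j)))).trans (show _ ≤
        2 ^ s * (2 * embConst d * Λ) by
          calc 2 ^ s * ε * (2 * embConst d * (Y * A * Y))
              = 2 ^ s * (2 * embConst d * (ε * (Y * A * Y))) := by ring
            _ ≤ _ := by gcongr)
    simpa only [Fintype.card_fin] using this
  have t6 : |(∑ k ∈ S, (jb k ^ (2 * s) : ℂ) * conj (σ k) * h k).re| ≤ Λ := by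
    refine ((Complex.abs_re_le_norm _).trans (norm_sum_le _ _)).trans (le_trans ?_ hYAΛ)
    refine le_trans (le_of_eq ?_) (sum_mul_le_of_sq_le S _ _ hY0 hA0 (hσ'.sum_sq_le S)
      (hh.sum_sq_le S))
    refine Finset.sum_congr rfl fun k _ => ?_
    simp only [norm_mul, norm_pow, Complex.norm_real, RCLike.norm_conj, Real.norm_eq_abs,
      abs_of_pos (jb_pos k)]
    ring
  -- Cancellation of the terms of size `1/ε`: the two couplings add up to `i` times a real number.
  have t7 : (∑ k ∈ S, ∑ j, ((jb k ^ (2 * s) * dir k j / ε : ℝ) : ℂ) * Complex.I *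
        (conj (u j k) * σ k + u j k * conj (σ k))).re = 0 := by
    simp only [Complex.re_sum]
    refine Finset.sum_eq_zero fun k _ => Finset.sum_eq_zero fun j _ => ?_
    have : conj (u j k) * σ k + u j k * conj (σ k) = ((2 * (conj (u j k) * σ k).re : ℝ) : ℂ) := by
      rw [← Complex.add_conj, map_mul, Complex.conj_conj]
    rw [this, mul_right_comm, ← Complex.ofReal_mul, Complex.re_ofReal_mul, Complex.I_re, mul_zero]
  simp only [Complex.sub_re, Complex.neg_re]
  rw [t7, show energyConst d s * (1 + A) * (1 + ε * (1 + Y)) * (1 + Y ^ 2) = energyConst d s * Λ by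
    rw [hΛ]; ring, energyConst]
  have := (abs_le.mp t1).1
  have := (abs_le.mp t2).1
  have := (abs_le.mp t3).1
  have := (abs_le.mp t4).1
  have := (abs_le.mp t5).1
  have := (abs_le.mp t6).1
  linarith

end Energy

/-! ### Galerkin systems -/

section Galerkin

variable (S : Finset (Freq d))

/-- The state space of the Galerkin system with frequencies in `S`. -/
abbrev GalState : Type := (Fin d → S → ℂ) × (S → ℂ)

/-- The space of the coefficients of the Galerkin system with frequencies in `S`. -/
abbrev GalParam : Type :=
  (Fin d → S → S → ℂ) × (Fin d → Fin d → S → S → ℂ) × (S → S → ℂ) × (S → ℂ)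

variable {S}

/-- Extension by zero. -/
def extZero (f : S → ℂ) (k : Freq d) : ℂ := if h : k ∈ S then f ⟨k, h⟩ else 0

lemma extZero_coe (f : S → ℂ) (k : S) : extZero f k = f k := by simp [extZero]

lemma extZero_mem (f : S → ℂ) {k : Freq d} (h : k ∈ S) : extZero f k = f ⟨k, h⟩ := by
  simp [extZero, h]

lemma extZero_of_notMem (f : S → ℂ) {k : Freq d} (h : k ∉ S) : extZero f k = 0 := by
  simp [extZero, h]

@[fun_prop]
lemma contDiff_extZero {E : Type*} [NormedAddCommGroup E] [NormedSpace ℝ E] {f : E → S → ℂ}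
    (hf : ContDiff ℝ 1 f) (k : Freq d) : ContDiff ℝ 1 fun x => extZero (f x) k := by
  unfold extZero
  split_ifs with h
  · exact contDiff_pi.mp hf ⟨k, h⟩
  · exact contDiff_const

/-- The vector field of the Galerkin system. -/
def galField (ε : ℝ) (z : GalParam S × GalState S) : GalState S :=
  (fun i k => -∑ j, (∑ l : S, (z.1.1 j k l + ε * extZero (z.2.1 j) (k - l)) *
      (2 * Real.pi * Complex.I * (l.1 j : ℂ) * z.2.1 i l) +
      ∑ l : S, z.1.2.1 j i k l * z.2.1 j l) - Complex.I * dir k.1 i * z.2.2 k / ε,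
   fun k => -∑ j, Complex.I * dir k.1 j * (∑ l : S, (z.1.1 j k l + ε * extZero (z.2.1 j) (k - l)) *
      (2 * Real.pi * modulus l.1 * z.2.2 l) + ε * ∑ l : S, z.1.2.2.1 k l * z.2.1 j l
      + z.2.1 j k / ε) - z.1.2.2.2 k)

lemma contDiff_galField (ε : ℝ) : ContDiff ℝ 1 (galField (S := S) ε) := by
  unfold galField
  refine ContDiff.prodMk (contDiff_pi.mpr fun i => contDiff_pi.mpr fun k => ?_)
    (contDiff_pi.mpr fun k => ?_)
  · refine (ContDiff.neg (ContDiff.sum fun j _ => ContDiff.add (ContDiff.sum fun l _ => ?_)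
      (ContDiff.sum fun l _ => ?_))).sub ?_
    · fun_prop
    · fun_prop
    · simp only [div_eq_mul_inv]
      fun_prop
  · refine (ContDiff.neg (ContDiff.sum fun j _ => ContDiff.mul contDiff_const
      (ContDiff.add (ContDiff.add (ContDiff.sum fun l _ => ?_)
      (ContDiff.mul contDiff_const (ContDiff.sum fun l _ => ?_))) ?_))).sub ?_
    · fun_prop
    · fun_prop
    · simp only [div_eq_mul_inv]
      fun_prop
    · fun_prop

/-- The coefficients of the Galerkin system. -/
def galParam (S : Finset (Freq d)) (a : Fin d → Freq d → ℂ) (q h : Freq d → ℂ) : GalParam S :=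
  (fun j k l => a j (k - l), fun j i k l => dseq j (a i) (k - l), fun k l => q (k - l),
    fun k => h k)

lemma galField_fst (ε : ℝ) (a : Fin d → Freq d → ℂ) (q h : Freq d → ℂ) (x : GalState S)
    (i : Fin d) (k : S) : (galField ε (galParam S a q h, x)).1 i k =
      velField ε a (fun j => extZero (x.1 j)) (extZero x.2) i k := by
  simp only [galField, velField, galParam, extZero_coe]
  congr 2
  refine Finset.sum_congr rfl fun j _ => ?_
  rw [conv_eq_sum_right _ (dseq_support (fun k hk => extZero_of_notMem _ hk) j),
    conv_eq_sum_left _ (fun k hk => extZero_of_notMem _ hk), ← Finset.sum_coe_sort S,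
    ← Finset.sum_coe_sort S]
  simp only [extZero_coe, dseq]

lemma galField_snd (ε : ℝ) (a : Fin d → Freq d → ℂ) (q h : Freq d → ℂ) (x : GalState S)
    (k : S) : (galField ε (galParam S a q h, x)).2 k =
      fieldField ε a q h (fun j => extZero (x.1 j)) (extZero x.2) k := by
  simp only [galField, fieldField, galParam, extZero_coe]
  congr 2
  refine Finset.sum_congr rfl fun j _ => ?_
  rw [conv_eq_sum_right _ (absD_support (fun k hk => extZero_of_notMem _ hk)),
    conv_eq_sum_left _ (fun k hk => extZero_of_notMem _ hk), ← Finset.sum_coe_sort S,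
    ← Finset.sum_coe_sort S]
  simp only [extZero_coe, absD]

/-- The symmetry whose fixed points are the sequences of real functions. -/
def galConj (hS : ∀ k ∈ S, -k ∈ S) : GalState S →L[ℝ] GalState S :=
  LinearMap.toContinuousLinearMap
    { toFun := fun x => (fun i (k : S) => conj (x.1 i ⟨-k, hS k k.2⟩),
        fun k : S => conj (x.2 ⟨-k, hS k k.2⟩))
      map_add' := fun x y => by ext <;> simp
      map_smul' := fun c x => by ext <;> simp }

lemma galConj_apply (hS : ∀ k ∈ S, -k ∈ S) (x : GalState S) : galConj hS x =
    (fun i (k : S) => conj (x.1 i ⟨-k, hS k k.2⟩), fun k : S => conj (x.2 ⟨-k, hS k k.2⟩)) := rfl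

lemma galConj_galConj (hS : ∀ k ∈ S, -k ∈ S) (x : GalState S) :
    galConj hS (galConj hS x) = x := by
  ext <;> simp [galConj_apply]

lemma isRealSeq_extZero (hS : ∀ k ∈ S, -k ∈ S) {f : S → ℂ} :
    IsRealSeq (extZero f) ↔ ∀ k : S, conj (f ⟨-k, hS k k.2⟩) = f k := by
  constructor
  · intro h k
    have := h k
    rw [extZero_coe, extZero_mem _ (hS k k.2)] at this
    rw [this, Complex.conj_conj]
  · intro h k
    by_cases hk : k ∈ S
    · rw [extZero_mem _ hk, extZero_mem _ (hS k hk), ← h ⟨k, hk⟩, Complex.conj_conj]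
    · have hk' : -k ∉ S := fun h' => hk (by simpa using hS _ h')
      rw [extZero_of_notMem _ hk, extZero_of_notMem _ hk', map_zero]

/-- The energy inequality holds only for real velocities; this identifies real states with the fixed
points required in `exists_solution_of_energy`. -/
lemma galConj_eq_iff (hS : ∀ k ∈ S, -k ∈ S) (x : GalState S) :
    galConj hS x = x ↔ (∀ i, IsRealSeq (extZero (x.1 i))) ∧ IsRealSeq (extZero x.2) := by
  simp only [isRealSeq_extZero hS, galConj_apply, Prod.ext_iff, funext_iff]

lemma IsRealSeq.absD {f : Freq d → ℂ} (hf : IsRealSeq f) : IsRealSeq (absD f) := by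
  intro k
  simp only [EulerPoisson.absD, hf k, modulus_neg, map_mul, Complex.conj_ofReal, map_ofNat]

lemma isRealSeq_velField {ε : ℝ} {a u : Fin d → Freq d → ℂ} {σ : Freq d → ℂ}
    (ha : ∀ i, IsRealSeq (a i)) (hu : ∀ i, IsRealSeq (u i)) (hσ : IsRealSeq σ) (i : Fin d) :
    IsRealSeq (velField ε a u σ i) := by
  intro k
  have h1 : ∀ j, conv (fun l => a j l + ε * u j l) (dseq j (u i)) (-k) =
      conj (conv (fun l => a j l + ε * u j l) (dseq j (u i)) k) := fun j =>
    ((ha j).add ((hu j).smul ε)).conv ((hu i).dseq j) k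
  have h2 : ∀ j, conv (u j) (dseq j (a i)) (-k) = conj (conv (u j) (dseq j (a i)) k) := fun j =>
    (hu j).conv ((ha i).dseq j) k
  simp only [velField, h1, h2, hσ k, dir_neg, map_sub, map_neg, map_sum, map_add, map_mul,
    map_div₀, Complex.conj_I, Complex.conj_ofReal]
  push_cast
  ring

lemma isRealSeq_fieldField {ε : ℝ} {a u : Fin d → Freq d → ℂ} {q h σ : Freq d → ℂ}
    (ha : ∀ i, IsRealSeq (a i)) (hq : IsRealSeq q) (hh : IsRealSeq h)
    (hu : ∀ i, IsRealSeq (u i)) (hσ : IsRealSeq σ) : IsRealSeq (fieldField ε a q h u σ) := by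
  intro k
  have h1 : ∀ j, conv (fun l => a j l + ε * u j l) (absD σ) (-k) =
      conj (conv (fun l => a j l + ε * u j l) (absD σ) k) := fun j =>
    ((ha j).add ((hu j).smul ε)).conv hσ.absD k
  have h2 : ∀ j, conv (u j) q (-k) = conj (conv (u j) q k) := fun j => (hu j).conv hq k
  have h3 : ∀ j, u j (-k) = conj (u j k) := fun j => hu j k
  simp only [fieldField, h1, h2, h3, hh k, dir_neg, map_sub, map_neg, map_sum, map_add, map_mul,
    map_div₀, Complex.conj_I, Complex.conj_ofReal]
  push_cast
  simp only [mul_neg, neg_mul]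

/-- The squared `H^s` norm of the state of the Galerkin system. -/
def galEnergy (s : ℕ) (x : GalState S) : ℝ :=
  (∑ i, ∑ k : S, jb k.1 ^ (2 * s) * ‖x.1 i k‖ ^ 2) + ∑ k : S, jb k.1 ^ (2 * s) * ‖x.2 k‖ ^ 2

lemma galEnergy_nonneg (s : ℕ) (x : GalState S) : 0 ≤ galEnergy s x :=
  add_nonneg (Finset.sum_nonneg fun _ _ => Finset.sum_nonneg fun k _ =>
      mul_nonneg (pow_nonneg (jb_pos k.1).le _) (sq_nonneg _))
    (Finset.sum_nonneg fun k _ => mul_nonneg (pow_nonneg (jb_pos k.1).le _) (sq_nonneg _))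

lemma contDiff_galEnergy (s : ℕ) : ContDiff ℝ 1 (galEnergy (S := S) s) := by
  unfold galEnergy
  refine (ContDiff.sum fun i _ => ContDiff.sum fun k _ => contDiff_const.mul ?_).add
    (ContDiff.sum fun k _ => contDiff_const.mul ?_)
  · exact ContDiff.norm_sq ℝ (by fun_prop)
  · exact ContDiff.norm_sq ℝ (by fun_prop)

/-- Computed along the line through `x` with direction `v`; it is the pairing that
`energy_inequality` estimates. -/
lemma fderiv_galEnergy (s : ℕ) (x v : GalState S) : fderiv ℝ (galEnergy s) x v =
    2 * ((∑ i, ∑ k : S, (jb k.1 ^ (2 * s) : ℂ) * conj (x.1 i k) * v.1 i k) +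
      ∑ k : S, (jb k.1 ^ (2 * s) : ℂ) * conj (x.2 k) * v.2 k).re := by
  have h1 : HasDerivAt (fun τ : ℝ => galEnergy s (x + τ • v)) (fderiv ℝ (galEnergy s) x v) 0 := by
    have hline : HasDerivAt (fun τ : ℝ => x + τ • v) v 0 := by
      simpa using ((hasDerivAt_id (0 : ℝ)).smul_const v).const_add x
    have hd : HasFDerivAt (galEnergy s) (fderiv ℝ (galEnergy s) x) (x + (0 : ℝ) • v) := by
      rw [zero_smul, add_zero]
      exact ((contDiff_galEnergy s).differentiable one_ne_zero x).hasFDerivAt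
    exact hd.comp_hasDerivAt 0 hline
  have hterm : ∀ z w : ℂ, ∀ c : ℝ, HasDerivAt (fun τ : ℝ => c * ‖z + τ • w‖ ^ 2)
      (2 * ((c : ℂ) * conj z * w).re) 0 := by
    intro z w c
    have hline : HasDerivAt (fun τ : ℝ => z + τ • w) w 0 := by
      simpa using ((hasDerivAt_id (0 : ℝ)).smul_const w).const_add z
    have := hline.norm_sq.const_mul c
    simp only [zero_smul, add_zero] at this
    have e : 2 * ((c : ℂ) * conj z * w).re = c * (2 * inner ℝ z w) := by
      simp only [Complex.inner, mul_assoc, Complex.mul_re, Complex.conj_re, Complex.conj_im,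
        Complex.ofReal_re, Complex.ofReal_im]
      ring
    rwa [e]
  have h2 : HasDerivAt (fun τ : ℝ => galEnergy s (x + τ • v))
      ((∑ i, ∑ k : S, 2 * (((jb k.1 ^ (2 * s) : ℝ) : ℂ) * conj (x.1 i k) * v.1 i k).re) +
      ∑ k : S, 2 * (((jb k.1 ^ (2 * s) : ℝ) : ℂ) * conj (x.2 k) * v.2 k).re) 0 := by
    unfold galEnergy
    refine HasDerivAt.add (HasDerivAt.fun_sum fun i _ => HasDerivAt.fun_sum fun k _ => ?_)
      (HasDerivAt.fun_sum fun k _ => ?_)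
    · exact hterm _ _ _
    · exact hterm _ _ _
  rw [h1.unique h2]
  simp only [Complex.add_re, Complex.re_sum, mul_add, Finset.mul_sum, Complex.ofReal_pow]

lemma sobBound_extZero_iff {s : ℕ} {f : S → ℂ} {R : ℝ} (hR : 0 ≤ R) :
    SobBound s (extZero f) R ↔ ∑ k : S, jb k.1 ^ (2 * s) * ‖f k‖ ^ 2 ≤ R ^ 2 := by
  classical
  have e : ∑ k : S, jb k.1 ^ (2 * s) * ‖f k‖ ^ 2 =
      ∑ k ∈ S, jb k ^ (2 * s) * ‖extZero f k‖ ^ 2 := by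
    rw [← Finset.sum_coe_sort S]
    simp only [extZero_coe]
  rw [e]
  refine ⟨fun h => h.2 S, fun h => ⟨hR, fun L => le_trans ?_ h⟩⟩
  have hn : ∀ k, 0 ≤ jb k ^ (2 * s) * ‖extZero f k‖ ^ 2 := fun k =>
    mul_nonneg (pow_nonneg (jb_pos k).le _) (sq_nonneg _)
  calc _ ≤ ∑ k ∈ L ∪ S, jb k ^ (2 * s) * ‖extZero f k‖ ^ 2 :=
        Finset.sum_le_sum_of_subset_of_nonneg Finset.subset_union_left fun k _ _ => hn k
    _ = _ := (Finset.sum_subset Finset.subset_union_right fun k _ hk => by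
        simp [extZero_of_notMem _ hk]).symm

lemma sobBound_fst_of_galEnergy_le {s : ℕ} {x : GalState S} {M : ℝ} (h : galEnergy s x ≤ M)
    (i : Fin d) : SobBound s (extZero (x.1 i)) (Real.sqrt M) := by
  have hM := (galEnergy_nonneg s x).trans h
  rw [sobBound_extZero_iff (Real.sqrt_nonneg _), Real.sq_sqrt hM]
  refine le_trans (le_trans ?_ (le_add_of_nonneg_right ?_)) h
  · exact Finset.single_le_sum (f := fun i => ∑ k : S, jb k.1 ^ (2 * s) * ‖x.1 i k‖ ^ 2)
      (fun i _ => Finset.sum_nonneg fun k _ =>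
        mul_nonneg (pow_nonneg (jb_pos k.1).le _) (sq_nonneg _)) (Finset.mem_univ i)
  · exact Finset.sum_nonneg fun k _ => mul_nonneg (pow_nonneg (jb_pos k.1).le _) (sq_nonneg _)

lemma sobBound_snd_of_galEnergy_le {s : ℕ} {x : GalState S} {M : ℝ} (h : galEnergy s x ≤ M) :
    SobBound s (extZero x.2) (Real.sqrt M) := by
  have hM := (galEnergy_nonneg s x).trans h
  rw [sobBound_extZero_iff (Real.sqrt_nonneg _), Real.sq_sqrt hM]
  refine le_trans (le_add_of_nonneg_left ?_) h
  exact Finset.sum_nonneg fun _ _ => Finset.sum_nonneg fun k _ =>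
    mul_nonneg (pow_nonneg (jb_pos k.1).le _) (sq_nonneg _)

lemma norm_sq_le_galEnergy (s : ℕ) (x : GalState S) : ‖x‖ ^ 2 ≤ 1 * galEnergy s x := by
  have hE := galEnergy_nonneg s x
  rw [one_mul, ← Real.sq_sqrt hE]
  refine pow_le_pow_left₀ (norm_nonneg _) (max_le ?_ ?_) 2
  · refine (pi_norm_le_iff_of_nonneg (Real.sqrt_nonneg _)).mpr fun i =>
      (pi_norm_le_iff_of_nonneg (Real.sqrt_nonneg _)).mpr fun k => ?_
    have := (sobBound_fst_of_galEnergy_le (le_refl (galEnergy s x)) i).norm_le k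
    rwa [extZero_coe] at this
  · refine (pi_norm_le_iff_of_nonneg (Real.sqrt_nonneg _)).mpr fun k => ?_
    have := (sobBound_snd_of_galEnergy_le (le_refl (galEnergy s x))).norm_le k
    rwa [extZero_coe] at this

lemma continuousOn_galParam {a : ℝ → Fin d → Freq d → ℂ} {q h : ℝ → Freq d → ℂ} {I : Set ℝ}
    (ha : ∀ i k, ContinuousOn (fun t => a t i k) I) (hq : ∀ k, ContinuousOn (fun t => q t k) I)
    (hh : ∀ k, ContinuousOn (fun t => h t k) I) :
    ContinuousOn (fun t => galParam S (a t) (q t) (h t)) I := by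
  unfold galParam
  refine ContinuousOn.prodMk (continuousOn_pi.mpr fun j => continuousOn_pi.mpr fun k =>
    continuousOn_pi.mpr fun l => ha _ _) (ContinuousOn.prodMk (continuousOn_pi.mpr fun j =>
    continuousOn_pi.mpr fun i => continuousOn_pi.mpr fun k => continuousOn_pi.mpr fun l => ?_)
    (ContinuousOn.prodMk (continuousOn_pi.mpr fun k => continuousOn_pi.mpr fun l => hq _)
      (continuousOn_pi.mpr fun k => hh _)))
  unfold dseq
  exact continuousOn_const.mul (ha _ _)

/-- The rate of growth of the energy. -/
def energyRate (d s : ℕ) (A : ℝ → ℝ) (ε M t : ℝ) : ℝ :=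
  energyConst d s * (1 + A t) * (1 + ε * (1 + Real.sqrt (2 * M)))

/-- The Galerkin systems have solutions, with bounds that do not depend on the set of
frequencies. -/
lemma exists_galerkin (hd : d ≤ 3) {s : ℕ} (hs : 3 ≤ s) {T : ℝ} (hT : 0 ≤ T)
    {a : ℝ → Fin d → Freq d → ℂ} {q h : ℝ → Freq d → ℂ} {A : ℝ → ℝ}
    (hA : MonotoneOn A (Set.Icc 0 T))
    (hac : ∀ i k, ContinuousOn (fun t => a t i k) (Set.Icc 0 T))
    (hqc : ∀ k, ContinuousOn (fun t => q t k) (Set.Icc 0 T))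
    (hhc : ∀ k, ContinuousOn (fun t => h t k) (Set.Icc 0 T))
    (har : ∀ t ∈ Set.Icc 0 T, ∀ i, IsRealSeq (a t i)) (hqr : ∀ t ∈ Set.Icc 0 T, IsRealSeq (q t))
    (hhr : ∀ t ∈ Set.Icc 0 T, IsRealSeq (h t))
    (ha : ∀ t ∈ Set.Icc 0 T, ∀ i, SobBound (s + 1) (a t i) (A t))
    (hq : ∀ t ∈ Set.Icc 0 T, SobBound s (q t) (A t))
    (hh : ∀ t ∈ Set.Icc 0 T, SobBound s (h t) (A t))
    {ε M y₀ : ℝ} (hε : 0 < ε) (hM : 0 < M) {u₀ : Fin d → Freq d → ℂ} {σ₀ : Freq d → ℂ}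
    (hu₀r : ∀ i, IsRealSeq (u₀ i)) (hσ₀r : IsRealSeq σ₀)
    (hy₀ : ∀ S : Finset (Freq d), (∑ i, ∑ k ∈ S, jb k ^ (2 * s) * ‖u₀ i k‖ ^ 2) +
      ∑ k ∈ S, jb k ^ (2 * s) * ‖σ₀ k‖ ^ 2 ≤ y₀)
    (hgrow : (1 + y₀) * Real.exp (energyRate d s A ε M T * T) ≤ 1 + M)
    (hS : ∀ k ∈ S, -k ∈ S) :
    ∃ (u : ℝ → Fin d → Freq d → ℂ) (σ : ℝ → Freq d → ℂ),
      (∀ i, ∀ k ∈ S, u 0 i k = u₀ i k) ∧ (∀ k ∈ S, σ 0 k = σ₀ k) ∧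
      (∀ t i, ∀ k ∉ S, u t i k = 0) ∧ (∀ t, ∀ k ∉ S, σ t k = 0) ∧
      ∀ t ∈ Set.Icc 0 T, (∀ i, IsRealSeq (u t i)) ∧ IsRealSeq (σ t) ∧
        (∀ i, SobBound s (u t i) (Real.sqrt ((1 + y₀) * Real.exp (energyRate d s A ε M t * t)))) ∧
        SobBound s (σ t) (Real.sqrt ((1 + y₀) * Real.exp (energyRate d s A ε M t * t))) ∧
        ∀ k ∈ S, (∀ i, HasDerivWithinAt (fun τ => u τ i k) (velField ε (a t) (u t) (σ t) i k)
          (Set.Icc 0 T) t) ∧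
          HasDerivWithinAt (fun τ => σ τ k) (fieldField ε (a t) (q t) (h t) (u t) (σ t) k)
            (Set.Icc 0 T) t := by
  let x₀ : GalState S := (fun i k => u₀ i k, fun k => σ₀ k)
  have hext : ∀ f : Freq d → ℂ, IsRealSeq f → IsRealSeq (extZero fun k : S => f k) := by
    intro f hf
    rw [isRealSeq_extZero hS]
    intro k
    rw [hf k, Complex.conj_conj]
  have hx₀ : galConj hS x₀ = x₀ := (galConj_eq_iff hS x₀).mpr
    ⟨fun i => hext _ (hu₀r i), hext _ hσ₀r⟩
  have hEx₀ : galEnergy s x₀ ≤ y₀ := by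
    refine le_trans (le_of_eq ?_) (hy₀ S)
    simp only [galEnergy, ← Finset.sum_coe_sort S, x₀]
  have hEx₀' := galEnergy_nonneg s x₀
  have hA0 : ∀ t ∈ Set.Icc 0 T, 0 ≤ A t := fun t ht => (hq t ht).1
  have hC := energyConst_nonneg d s
  have hμ0 : ∀ t ∈ Set.Icc 0 T, 0 ≤ energyRate d s A ε M t := fun t ht => by
    have := hA0 t ht
    unfold energyRate
    positivity
  obtain ⟨x, hx0, hx⟩ := exists_solution_of_energy (galField (S := S) ε) (contDiff_galField ε) hT
    (fun t => galParam S (a t) (q t) (h t)) (continuousOn_galParam hac hqc hhc) (galConj hS)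
    (galConj_galConj hS)
    (fun t ht x hx => by
      rw [galConj_eq_iff] at hx ⊢
      simp only [isRealSeq_extZero hS]
      refine ⟨fun i k => ?_, fun k => ?_⟩
      · rw [galField_fst, galField_fst, isRealSeq_velField (har t ht) hx.1 hx.2 i k,
          Complex.conj_conj]
      · rw [galField_snd, galField_snd, isRealSeq_fieldField (har t ht) (hqr t ht) (hhr t ht)
          hx.1 hx.2 k, Complex.conj_conj])
    (galEnergy s) (contDiff_galEnergy s) (galEnergy_nonneg s) (norm_sq_le_galEnergy s) zero_le_one
    hM (energyRate d s A ε M)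
    (fun t ht t' ht' htt' => by
      have := hA ht ht' htt'
      unfold energyRate
      gcongr)
    hμ0
    (fun t ht x hx hEx => by
      rw [galConj_eq_iff] at hx
      have hE0 := galEnergy_nonneg s x
      have key := energy_inequality hd hs hε S (a := a t) (q := q t) (h := h t)
        (fun i k hk => extZero_of_notMem (x.1 i) hk) (fun k hk => extZero_of_notMem x.2 hk)
        (har t ht) hx.1 (ha t ht) (hq t ht) (hh t ht)
        (sobBound_fst_of_galEnergy_le le_rfl) (sobBound_snd_of_galEnergy_le le_rfl)
      rw [fderiv_galEnergy]
      simp only [galField_fst, galField_snd]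
      simp only [← Finset.sum_coe_sort S, extZero_coe] at key
      refine key.trans ?_
      rw [Real.sq_sqrt hE0, energyRate]
      have := hA0 t ht
      gcongr)
    x₀ hx₀ (le_trans (by gcongr) hgrow)
  refine ⟨fun t i => extZero ((x t).1 i), fun t => extZero (x t).2, fun i k hk => ?_,
    fun k hk => ?_, fun t i k hk => extZero_of_notMem _ hk, fun t k hk => extZero_of_notMem _ hk,
    fun t ht => ?_⟩
  · change extZero ((x 0).1 i) k = u₀ i k
    rw [hx0, extZero_mem _ hk]
  · change extZero (x 0).2 k = σ₀ k
    rw [hx0, extZero_mem _ hk]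
  · obtain ⟨hd', hJ, hE⟩ := hx t ht
    rw [galConj_eq_iff] at hJ
    have hE' : galEnergy s (x t) ≤ (1 + y₀) * Real.exp (energyRate d s A ε M t * t) := by
      have h1 : (1 + galEnergy s x₀) * Real.exp (energyRate d s A ε M t * t) ≤
        (1 + y₀) * Real.exp (energyRate d s A ε M t * t) := by gcongr
      linarith
    refine ⟨hJ.1, hJ.2, sobBound_fst_of_galEnergy_le hE', sobBound_snd_of_galEnergy_le hE',
      fun k hk => ⟨fun i => ?_, ?_⟩⟩
    · simp only [extZero_mem _ hk]
      rw [← galField_fst ε (a t) (q t) (h t) (x t) i ⟨k, hk⟩]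
      have h1 : HasDerivWithinAt (fun t => (x t).1)
          (galField ε (galParam S (a t) (q t) (h t), x t)).1 (Set.Icc 0 T) t :=
        (ContinuousLinearMap.fst ℝ (Fin d → S → ℂ) (S → ℂ)).hasFDerivAt.comp_hasDerivWithinAt t hd'
      exact hasDerivWithinAt_pi.mp (hasDerivWithinAt_pi.mp h1 i) ⟨k, hk⟩
    · simp only [extZero_mem _ hk]
      rw [← galField_snd ε (a t) (q t) (h t) (x t) ⟨k, hk⟩]
      have h1 : HasDerivWithinAt (fun t => (x t).2)
          (galField ε (galParam S (a t) (q t) (h t), x t)).2 (Set.Icc 0 T) t :=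
        (ContinuousLinearMap.snd ℝ (Fin d → S → ℂ) (S → ℂ)).hasFDerivAt.comp_hasDerivWithinAt t hd'
      exact hasDerivWithinAt_pi.mp h1 ⟨k, hk⟩

end Galerkin

/-! ### Integrated equations and compactness -/

section Calculus

lemma hasDerivWithinAt_of_integral_eq {f V : ℝ → ℂ} {T : ℝ} (hV : ContinuousOn V (Set.Icc 0 T))
    (hf : ∀ t ∈ Set.Icc 0 T, f t = f 0 + ∫ τ in (0 : ℝ)..t, V τ) {t : ℝ} (ht : t ∈ Set.Icc 0 T) :
    HasDerivWithinAt f (V t) (Set.Icc 0 T) t := by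
  have : Fact (t ∈ Set.Icc 0 T) := ⟨ht⟩
  have hInt : IntervalIntegrable V volume 0 t :=
    (hV.mono (by rw [Set.uIcc_of_le ht.1]; exact Set.Icc_subset_Icc_right ht.2)).intervalIntegrable
  have h := (intervalIntegral.integral_hasDerivWithinAt_right hInt
    (s := Set.Icc 0 T) (t := Set.Icc 0 T)
    (hV.stronglyMeasurableAtFilter_nhdsWithin measurableSet_Icc t) (hV t ht)).const_add (f 0)
  exact h.congr_of_mem hf ht

lemma eq_add_integral_of_hasDerivWithinAt {f V : ℝ → ℂ} {T : ℝ}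
    (hV : ContinuousOn V (Set.Icc 0 T))
    (hf : ∀ t ∈ Set.Icc 0 T, HasDerivWithinAt f (V t) (Set.Icc 0 T) t) {t : ℝ}
    (ht : t ∈ Set.Icc 0 T) : f t = f 0 + ∫ τ in (0 : ℝ)..t, V τ := by
  have hInt : IntervalIntegrable V volume 0 t :=
    (hV.mono (by rw [Set.uIcc_of_le ht.1]; exact Set.Icc_subset_Icc_right ht.2)).intervalIntegrable
  rw [intervalIntegral.integral_eq_sub_of_hasDerivAt_of_le ht.1
    (fun τ hτ => ((hf τ ⟨hτ.1, hτ.2.trans ht.2⟩).continuousWithinAt.mono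
      (Set.Icc_subset_Icc_right ht.2)))
    (fun τ hτ => (hf τ ⟨hτ.1.le, hτ.2.le.trans ht.2⟩).hasDerivAt
      (Icc_mem_nhds hτ.1 (hτ.2.trans_le ht.2))) hInt]
  ring

/-- Bounded sequences of functions with countably many components that are eventually
equi-Lipschitz in each component have subsequences that converge pointwise. -/
lemma exists_subseq_tendsto {ι : Type*} [Countable ι] {T : ℝ} (hT : 0 ≤ T) (F : ℕ → ℝ → ι → ℂ)
    {B : ℝ} (hB : ∀ n, ∀ t ∈ Set.Icc 0 T, ∀ i, ‖F n t i‖ ≤ B)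
    (hL : ∀ i, ∃ C : ℝ, ∀ᶠ n in atTop, ∀ t ∈ Set.Icc 0 T, ∀ t' ∈ Set.Icc 0 T,
      ‖F n t i - F n t' i‖ ≤ C * |t - t'|) :
    ∃ (φ : ℕ → ℕ) (f : ℝ → ι → ℂ), StrictMono φ ∧
      ∀ t ∈ Set.Icc 0 T, ∀ i, Tendsto (fun n => F (φ n) t i) atTop (𝓝 (f t i)) := by
  have hclamp : ∀ q : ℝ, max 0 (min q T) ∈ Set.Icc 0 T := fun q =>
    ⟨le_max_left _ _, max_le hT (min_le_right _ _)⟩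
  -- Sampling at rational times, clamped to `[0, T]`, leaves countably many bounded complex
  -- coordinates. A countable product of discs is sequentially compact, and the Lipschitz bounds
  -- extend convergence to all times.
  let x : ℕ → (ι × ℚ → ℂ) := fun n p => F n (max 0 (min (p.2 : ℝ) T)) p.1
  obtain ⟨y, -, φ, hφ, hy⟩ := (isCompact_univ_pi fun _ : ι × ℚ =>
    isCompact_closedBall (0 : ℂ) B).tendsto_subseq (x := x)
    (fun n p _ => by simpa using hB n _ (hclamp _) p.1)
  rw [tendsto_pi_nhds] at hy
  have hcauchy : ∀ t ∈ Set.Icc 0 T, ∀ i, CauchySeq fun n => F (φ n) t i := by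
    intro t ht i
    obtain ⟨C, hC⟩ := hL i
    have hC' := hφ.tendsto_atTop.eventually hC
    rw [Metric.cauchySeq_iff']
    intro δ hδ
    have hpos : 0 < δ / (3 * (|C| + 1)) := by positivity
    obtain ⟨q, hq1, hq2⟩ := exists_rat_btwn (lt_add_of_pos_right t hpos)
    have hq : |t - max 0 (min (q : ℝ) T)| ≤ δ / (3 * (|C| + 1)) := by
      have h1 : t ≤ max 0 (min (q : ℝ) T) := le_max_of_le_right (le_min hq1.le ht.2)
      have h2 : max 0 (min (q : ℝ) T) ≤ q := max_le (ht.1.trans hq1.le) (min_le_left _ _)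
      rw [abs_le]
      constructor <;> linarith
    have hsmall : C * |t - max 0 (min (q : ℝ) T)| ≤ δ / 3 := by
      calc _ ≤ (|C| + 1) * (δ / (3 * (|C| + 1))) := by
            gcongr
            linarith [le_abs_self C]
        _ = _ := by field_simp
    obtain ⟨N₁, hN₁⟩ := (Metric.cauchySeq_iff.mp (hy (i, q)).cauchySeq) (δ / 3) (by positivity)
    obtain ⟨N₂, hN₂⟩ := eventually_atTop.mp hC'
    refine ⟨max N₁ N₂, fun n hn => ?_⟩
    have a1 := hN₂ n (le_of_max_le_right hn) t ht _ (hclamp q)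
    have a2 := hN₂ (max N₁ N₂) (le_max_right _ _) t ht _ (hclamp q)
    have a3 := hN₁ n (le_of_max_le_left hn) (max N₁ N₂) (le_max_left _ _)
    simp only [Function.comp_apply, x, dist_eq_norm] at a3
    rw [dist_eq_norm]
    calc ‖F (φ n) t i - F (φ (max N₁ N₂)) t i‖
        = ‖(F (φ n) t i - F (φ n) (max 0 (min (q : ℝ) T)) i) +
            (F (φ n) (max 0 (min (q : ℝ) T)) i - F (φ (max N₁ N₂)) (max 0 (min (q : ℝ) T)) i) -
            (F (φ (max N₁ N₂)) t i - F (φ (max N₁ N₂)) (max 0 (min (q : ℝ) T)) i)‖ := by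
          congr 1; ring
      _ ≤ _ := (norm_sub_le _ _).trans (add_le_add (norm_add_le _ _) le_rfl)
      _ < δ := by linarith
  refine ⟨φ, fun t i => limUnder atTop fun n => F (φ n) t i, hφ, fun t ht i => ?_⟩
  exact tendsto_nhds_limUnder (cauchySeq_tendsto_of_complete (hcauchy t ht i))

end Calculus

/-! ### Passage to the limit in the quadratic terms -/

section Convergence

variable {ι : Type*} {l : Filter ι} {s : ℕ}

/-- Dominated convergence: a bound in `H²` dominates each coefficient by a multiple of the inverse
squared weight, and products of two such sequences are summable. -/
lemma tendsto_conv (hd : d ≤ 3) {F G : ι → Freq d → ℂ} {f g : Freq d → ℂ} {R R' : ℝ}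
    (hF : ∀ᶠ i in l, SobBound 2 (F i) R) (hG : ∀ᶠ i in l, SobBound 2 (G i) R')
    (hf : ∀ k, Tendsto (fun i => F i k) l (𝓝 (f k)))
    (hg : ∀ k, Tendsto (fun i => G i k) l (𝓝 (g k))) (k : Freq d) :
    Tendsto (fun i => conv (F i) (G i) k) l (𝓝 (conv f g k)) := by
  have hsum : Summable fun j : Freq d => R * (jb (k - j) ^ 2)⁻¹ * (R' * (jb j ^ 2)⁻¹) := by
    have h1 := summable_inv_jb_pow hd
    have h2 : Summable fun j : Freq d => (jb (k - j) ^ 4)⁻¹ :=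
      h1.comp_injective (i := fun j => k - j) sub_right_injective
    refine Summable.of_norm_bounded ((h2.add h1).mul_left |R * R'|) fun j => ?_
    have p1 : 0 ≤ (jb (k - j) ^ 2)⁻¹ := by have := jb_pos (k - j); positivity
    have p2 : 0 ≤ (jb j ^ 2)⁻¹ := by have := jb_pos j; positivity
    rw [show R * (jb (k - j) ^ 2)⁻¹ * (R' * (jb j ^ 2)⁻¹) =
      (R * R') * ((jb (k - j) ^ 2)⁻¹ * (jb j ^ 2)⁻¹) by ring, norm_mul, Real.norm_eq_abs,
      Real.norm_of_nonneg (mul_nonneg p1 p2)]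
    gcongr
    have e : ∀ x : ℝ, (x ^ 4)⁻¹ = ((x ^ 2)⁻¹) ^ 2 := fun x => by rw [inv_pow, ← pow_mul]
    rw [e, e]
    nlinarith [sq_nonneg ((jb (k - j) ^ 2)⁻¹ - (jb j ^ 2)⁻¹)]
  refine tendsto_tsum_of_dominated_convergence hsum
    (fun j => (hf (k - j)).mul (hg j)) ?_
  filter_upwards [hF, hG] with i hFi hGi j
  rw [norm_mul]
  exact mul_le_mul (hFi.norm_le_div _) (hGi.norm_le_div _) (norm_nonneg _)
    (mul_nonneg hFi.1 (by have := jb_pos (k - j); positivity))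

lemma SobBound.absD {m : ℕ} {f : Freq d → ℂ} {R : ℝ} (h : SobBound (m + 1) f R) :
    SobBound m (absD f) (2 * Real.pi * R) := by
  refine h.dominated (by positivity) fun k => ?_
  have h0 := (jb_pos k).le
  have hpi := Real.pi_pos
  simp only [EulerPoisson.absD, norm_mul, Complex.norm_real, Complex.norm_ofNat, Real.norm_eq_abs,
    abs_of_pos hpi, abs_of_nonneg (modulus_nonneg k)]
  calc _ ≤ jb k ^ m * (2 * Real.pi * jb k * ‖f k‖) := by gcongr; exact modulus_le_jb k
    _ = _ := by ring

variable {aF uF : ι → Fin d → Freq d → ℂ} {qF hF σF : ι → Freq d → ℂ}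
  {a u : Fin d → Freq d → ℂ} {q h σ : Freq d → ℂ} {ε A Y : ℝ}

lemma SobBound.add_smul {f g : Freq d → ℂ} {m : ℕ} {R R' : ℝ} (hf : SobBound (m + 1) f R)
    (hg : SobBound m g R') (ε : ℝ) : SobBound m (fun l => f l + ε * g l) (R + |ε| * R') := by
  have := (hf.of_le (Nat.le_succ m)).add (hg.smul (ε : ℂ))
  rwa [Complex.norm_real, Real.norm_eq_abs] at this

lemma tendsto_velField (hd : d ≤ 3) (hs : 3 ≤ s)
    (haF : ∀ᶠ n in l, ∀ i, SobBound (s + 1) (aF n i) A)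
    (huF : ∀ᶠ n in l, ∀ i, SobBound s (uF n i) Y)
    (ha : ∀ i k, Tendsto (fun n => aF n i k) l (𝓝 (a i k)))
    (hu : ∀ i k, Tendsto (fun n => uF n i k) l (𝓝 (u i k)))
    (hσ : ∀ k, Tendsto (fun n => σF n k) l (𝓝 (σ k))) (i : Fin d) (k : Freq d) :
    Tendsto (fun n => velField ε (aF n) (uF n) (σF n) i k) l (𝓝 (velField ε a u σ i k)) := by
  unfold velField
  refine ((tendsto_finsetSum _ fun j _ => ?_).neg).sub (((hσ k).const_mul _).div_const _)
  refine (tendsto_conv hd (R := A + |ε| * Y) (R' := 2 * Real.pi * Y) ?_ ?_ (fun k => ?_)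
    (fun k => ?_) k).add (tendsto_conv hd (R := Y) (R' := 2 * Real.pi * A) ?_ ?_ (fun k => ?_)
    (fun k => ?_) k)
  · filter_upwards [haF, huF] with n h1 h2 using ((h1 j).add_smul (h2 j) ε).of_le (by omega)
  · filter_upwards [huF] with n h2 using
      (((h2 i).of_le (show 2 + 1 ≤ s by omega)).dseq j)
  · exact (ha j k).add ((hu j k).const_mul _)
  · exact (hu i k).const_mul _
  · filter_upwards [huF] with n h2 using (h2 j).of_le (by omega)
  · filter_upwards [haF] with n h1 using (((h1 i).of_le (show 2 + 1 ≤ s + 1 by omega)).dseq j)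
  · exact hu j k
  · exact (ha i k).const_mul _

lemma tendsto_fieldField (hd : d ≤ 3) (hs : 3 ≤ s)
    (haF : ∀ᶠ n in l, ∀ i, SobBound (s + 1) (aF n i) A) (hqF : ∀ᶠ n in l, SobBound s (qF n) A)
    (huF : ∀ᶠ n in l, ∀ i, SobBound s (uF n i) Y) (hσF : ∀ᶠ n in l, SobBound s (σF n) Y)
    (ha : ∀ i k, Tendsto (fun n => aF n i k) l (𝓝 (a i k)))
    (hq : ∀ k, Tendsto (fun n => qF n k) l (𝓝 (q k)))
    (hh : ∀ k, Tendsto (fun n => hF n k) l (𝓝 (h k)))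
    (hu : ∀ i k, Tendsto (fun n => uF n i k) l (𝓝 (u i k)))
    (hσ : ∀ k, Tendsto (fun n => σF n k) l (𝓝 (σ k))) (k : Freq d) :
    Tendsto (fun n => fieldField ε (aF n) (qF n) (hF n) (uF n) (σF n) k) l
      (𝓝 (fieldField ε a q h u σ k)) := by
  unfold fieldField
  refine ((tendsto_finsetSum _ fun j _ => Tendsto.const_mul _ ?_).neg).sub (hh k)
  refine ((tendsto_conv hd (R := A + |ε| * Y) (R' := 2 * Real.pi * Y) ?_ ?_ (fun k => ?_)
    (fun k => ?_) k).add ((tendsto_conv hd (R := Y) (R' := A) ?_ ?_ (fun k => ?_)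
    (fun k => ?_) k).const_mul _)).add ((hu j k).div_const _)
  · filter_upwards [haF, huF] with n h1 h2 using ((h1 j).add_smul (h2 j) ε).of_le (by omega)
  · filter_upwards [hσF] with n h2 using ((h2.of_le (show 2 + 1 ≤ s by omega)).absD)
  · exact (ha j k).add ((hu j k).const_mul _)
  · exact (hσ k).const_mul _
  · filter_upwards [huF] with n h2 using (h2 j).of_le (by omega)
  · filter_upwards [hqF] with n h1 using h1.of_le (by omega)
  · exact hu j k
  · exact hq k

/-- Supplies the Lipschitz constants in time for the Galerkin solutions. They may blow up as `ε →
0`, which is harmless: the compactness argument is for fixed `ε`. -/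
lemma norm_velField_le (hs : 3 ≤ s) (hε : 0 < ε) (ha : ∀ i, SobBound (s + 1) (a i) A)
    (hu : ∀ i, SobBound s (u i) Y) (hσ : SobBound s σ Y) (i : Fin d) (k : Freq d) :
    ‖velField ε a u σ i k‖ ≤
      d * ((A + |ε| * Y) * (2 * Real.pi * Y) + Y * (2 * Real.pi * A)) + Y / ε := by
  unfold velField
  refine (norm_sub_le _ _).trans (add_le_add ?_ ?_)
  · rw [norm_neg]
    refine (norm_sum_le_of_le (f := fun j => _) _ fun j _ => (norm_add_le _ _).trans (add_le_add
      (((ha j).add_smul (hu j) ε).norm_conv_le (((hu i).of_le (show 2 + 1 ≤ s by omega)).dseq j) k)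
      ((hu j).norm_conv_le (((ha i).of_le (show 2 + 1 ≤ s + 1 by omega)).dseq j) k))).trans ?_
    rw [Finset.sum_const, Finset.card_univ, Fintype.card_fin, nsmul_eq_mul]
  · simp only [norm_div, norm_mul, Complex.norm_I, Complex.norm_real, Real.norm_eq_abs, one_mul,
      abs_of_pos hε]
    have := hσ.1
    gcongr
    exact (mul_le_of_le_one_left (norm_nonneg _) (abs_dir_le k i)).trans (hσ.norm_le k)

lemma norm_fieldField_le (hs : 3 ≤ s) (hε : 0 < ε) (ha : ∀ i, SobBound (s + 1) (a i) A)
    (hq : SobBound s q A) (hh : SobBound s h A)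
    (hu : ∀ i, SobBound s (u i) Y) (hσ : SobBound s σ Y) (k : Freq d) :
    ‖fieldField ε a q h u σ k‖ ≤
      d * ((A + |ε| * Y) * (2 * Real.pi * Y) + ε * (Y * A) + Y / ε) + A := by
  unfold fieldField
  refine (norm_sub_le _ _).trans (add_le_add ?_ (hh.norm_le k))
  rw [norm_neg]
  refine (norm_sum_le_of_le (f := fun j => _) (Finset.univ : Finset (Fin d)) fun j _ =>
    (show _ ≤ ((A + |ε| * Y) * (2 * Real.pi * Y) + ε * (Y * A) + Y / ε) from ?_)).trans ?_
  · rw [norm_mul]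
    have h1 : ‖Complex.I * (dir k j : ℂ)‖ ≤ 1 := by
      simpa only [norm_mul, Complex.norm_I, Complex.norm_real, Real.norm_eq_abs, one_mul] using
        abs_dir_le k j
    refine (mul_le_of_le_one_left (norm_nonneg _) h1).trans ((norm_add_le _ _).trans
      (add_le_add ((norm_add_le _ _).trans (add_le_add
        (((ha j).add_smul (hu j) ε).norm_conv_le ((hσ.of_le (show 2 + 1 ≤ s by omega)).absD) k)
        ?_)) ?_))
    · rw [norm_mul, Complex.norm_real, Real.norm_of_nonneg hε.le]
      gcongr
      exact (hu j).norm_conv_le hq k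
    · rw [norm_div, Complex.norm_real, Real.norm_of_nonneg hε.le]
      gcongr
      exact (hu j).norm_le k
  · rw [Finset.sum_const, Finset.card_univ, Fintype.card_fin, nsmul_eq_mul]

end Convergence

/-! ### Existence of the perturbation -/

/-- The frequencies with all coordinates at most `N`. -/
def freqBox (d N : ℕ) : Finset (Freq d) := Fintype.piFinset fun _ => Finset.Icc (-(N : ℤ)) N

lemma mem_freqBox {N : ℕ} {k : Freq d} : k ∈ freqBox d N ↔ ∀ i, -(N : ℤ) ≤ k i ∧ k i ≤ N := by
  simp [freqBox, Fintype.mem_piFinset]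

lemma neg_mem_freqBox {N : ℕ} : ∀ k ∈ freqBox d N, -k ∈ freqBox d N := by
  intro k hk
  rw [mem_freqBox] at hk ⊢
  intro i
  have := hk i
  simp only [Pi.neg_apply]
  omega

lemma eventually_mem_freqBox (k : Freq d) : ∀ᶠ N in atTop, k ∈ freqBox d N := by
  filter_upwards [eventually_ge_atTop (∑ i, (k i).natAbs)] with N hN
  rw [mem_freqBox]
  intro i
  have := Finset.single_le_sum (f := fun i => (k i).natAbs) (fun _ _ => Nat.zero_le _)
    (Finset.mem_univ i)
  omega

lemma IsRealSeq.of_tendsto {ι : Type*} {l : Filter ι} [l.NeBot] {F : ι → Freq d → ℂ}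
    {f : Freq d → ℂ} (h : ∀ᶠ i in l, IsRealSeq (F i))
    (hF : ∀ k, Tendsto (fun i => F i k) l (𝓝 (f k))) : IsRealSeq f := fun k =>
  tendsto_nhds_unique_of_eventuallyEq (hF (-k)) ((Complex.continuous_conj.tendsto _).comp (hF k))
    (h.mono fun _ hi => hi k)

/-- Passing to the limit in a sequence of differential equations. -/
lemma hasDerivWithinAt_of_tendsto {F G : ℕ → ℝ → ℂ} {f g : ℝ → ℂ} {T C : ℝ}
    (hF : ∀ᶠ n in atTop, ∀ t ∈ Set.Icc 0 T, HasDerivWithinAt (F n) (G n t) (Set.Icc 0 T) t)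
    (hGc : ∀ᶠ n in atTop, ContinuousOn (G n) (Set.Icc 0 T))
    (hG : ∀ n, ∀ t ∈ Set.Icc 0 T, ‖G n t‖ ≤ C) (hgc : ContinuousOn g (Set.Icc 0 T))
    (hf : ∀ t ∈ Set.Icc 0 T, Tendsto (fun n => F n t) atTop (𝓝 (f t)))
    (hg : ∀ t ∈ Set.Icc 0 T, Tendsto (fun n => G n t) atTop (𝓝 (g t))) {t : ℝ}
    (ht : t ∈ Set.Icc 0 T) : HasDerivWithinAt f (g t) (Set.Icc 0 T) t := by
  -- The integrated equation passes to the limit by dominated convergence; continuity of `g` then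
  -- allows differentiation, including at the end points.
  refine hasDerivWithinAt_of_integral_eq hgc (fun t ht => ?_) ht
  have h0 : (0 : ℝ) ∈ Set.Icc 0 T := ⟨le_rfl, ht.1.trans ht.2⟩
  have hsub : ∀ τ ∈ Set.uIoc 0 t, τ ∈ Set.Icc 0 T := fun τ hτ => by
    rw [Set.uIoc_of_le ht.1] at hτ
    exact ⟨hτ.1.le, hτ.2.trans ht.2⟩
  have hInt : Tendsto (fun n => ∫ τ in (0 : ℝ)..t, G n τ) atTop (𝓝 (∫ τ in (0 : ℝ)..t, g τ)) := by
    refine intervalIntegral.tendsto_integral_filter_of_dominated_convergence (fun _ => C) ?_ ?_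
      intervalIntegrable_const ?_
    · filter_upwards [hGc] with n hn
      exact (hn.mono hsub).aestronglyMeasurable measurableSet_uIoc
    · exact Eventually.of_forall fun n => ae_of_all _ fun τ hτ => hG n τ (hsub τ hτ)
    · exact ae_of_all _ fun τ hτ => hg τ (hsub τ hτ)
  refine tendsto_nhds_unique_of_eventuallyEq (hf t ht) ((hf 0 h0).add hInt) ?_
  filter_upwards [hF, hGc] with n h1 h2
  exact eq_add_integral_of_hasDerivWithinAt h2 h1 ht

/-- Existence of the rescaled perturbation of the velocity and of the electric field. -/
lemma exists_perturbation (hd : d ≤ 3) {s : ℕ} (hs : 3 ≤ s) {T : ℝ} (hT : 0 ≤ T)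
    {a : ℝ → Fin d → Freq d → ℂ} {q h : ℝ → Freq d → ℂ} {A : ℝ → ℝ}
    (hA : MonotoneOn A (Set.Icc 0 T))
    (hac : ∀ i k, ContinuousOn (fun t => a t i k) (Set.Icc 0 T))
    (hqc : ∀ k, ContinuousOn (fun t => q t k) (Set.Icc 0 T))
    (hhc : ∀ k, ContinuousOn (fun t => h t k) (Set.Icc 0 T))
    (har : ∀ t ∈ Set.Icc 0 T, ∀ i, IsRealSeq (a t i)) (hqr : ∀ t ∈ Set.Icc 0 T, IsRealSeq (q t))
    (hhr : ∀ t ∈ Set.Icc 0 T, IsRealSeq (h t))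
    (ha : ∀ t ∈ Set.Icc 0 T, ∀ i, SobBound (s + 1) (a t i) (A t))
    (hq : ∀ t ∈ Set.Icc 0 T, SobBound s (q t) (A t))
    (hh : ∀ t ∈ Set.Icc 0 T, SobBound s (h t) (A t))
    {ε M y₀ : ℝ} (hε : 0 < ε) (hM : 0 < M) {u₀ : Fin d → Freq d → ℂ} {σ₀ : Freq d → ℂ}
    (hu₀r : ∀ i, IsRealSeq (u₀ i)) (hσ₀r : IsRealSeq σ₀)
    (hy₀ : ∀ S : Finset (Freq d), (∑ i, ∑ k ∈ S, jb k ^ (2 * s) * ‖u₀ i k‖ ^ 2) +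
      ∑ k ∈ S, jb k ^ (2 * s) * ‖σ₀ k‖ ^ 2 ≤ y₀)
    (hgrow : (1 + y₀) * Real.exp (energyRate d s A ε M T * T) ≤ 1 + M) :
    ∃ (u : ℝ → Fin d → Freq d → ℂ) (σ : ℝ → Freq d → ℂ), u 0 = u₀ ∧ σ 0 = σ₀ ∧
      ∀ t ∈ Set.Icc 0 T, (∀ i, IsRealSeq (u t i)) ∧ IsRealSeq (σ t) ∧
        (∀ i, SobBound s (u t i) (Real.sqrt ((1 + y₀) * Real.exp (energyRate d s A ε M t * t)))) ∧
        SobBound s (σ t) (Real.sqrt ((1 + y₀) * Real.exp (energyRate d s A ε M t * t))) ∧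
        ∀ k, (∀ i, HasDerivWithinAt (fun τ => u τ i k) (velField ε (a t) (u t) (σ t) i k)
          (Set.Icc 0 T) t) ∧
          HasDerivWithinAt (fun τ => σ τ k) (fieldField ε (a t) (q t) (h t) (u t) (σ t) k)
            (Set.Icc 0 T) t := by
  have h0T : (0 : ℝ) ∈ Set.Icc 0 T := ⟨le_rfl, hT⟩
  have hTT : T ∈ Set.Icc 0 T := ⟨hT, le_rfl⟩
  have hy₀0 : 0 ≤ y₀ := by simpa using hy₀ ∅
  choose uN σN hu0 hσ0 huS hσS hN using fun N : ℕ => exists_galerkin hd hs hT hA hac hqc hhc har hqr hhr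
    ha hq hh hε hM hu₀r hσ₀r hy₀ hgrow (neg_mem_freqBox (d := d) (N := N))
  set Y : ℝ → ℝ := fun t => Real.sqrt ((1 + y₀) * Real.exp (energyRate d s A ε M t * t)) with hY
  have hYT : ∀ t ∈ Set.Icc 0 T, Y t ≤ Y T := by
    intro t ht
    have hAt := (hq t ht).1
    have hAT := hA ht hTT ht.2
    have hC := energyConst_nonneg d s
    have h0t := ht.1
    have htT := ht.2
    have h1 : 0 ≤ energyRate d s A ε M t := by unfold energyRate; positivity
    have h2 : energyRate d s A ε M t ≤ energyRate d s A ε M T := by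
      unfold energyRate; gcongr
    refine Real.sqrt_le_sqrt ?_
    gcongr
    exact h1.trans h2
  have ha' : ∀ t ∈ Set.Icc 0 T, ∀ i, SobBound (s + 1) (a t i) (A T) := fun t ht i =>
    (ha t ht i).mono (hA ht hTT ht.2)
  have hq' : ∀ t ∈ Set.Icc 0 T, SobBound s (q t) (A T) := fun t ht =>
    (hq t ht).mono (hA ht hTT ht.2)
  have hh' : ∀ t ∈ Set.Icc 0 T, SobBound s (h t) (A T) := fun t ht =>
    (hh t ht).mono (hA ht hTT ht.2)
  have huN : ∀ N, ∀ t ∈ Set.Icc 0 T, ∀ i, SobBound s (uN N t i) (Y T) := fun N t ht i =>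
    ((hN N t ht).2.2.1 i).mono (hYT t ht)
  have hσN : ∀ N, ∀ t ∈ Set.Icc 0 T, SobBound s (σN N t) (Y T) := fun N t ht =>
    ((hN N t ht).2.2.2.1).mono (hYT t ht)
  set Cv : ℝ := d * ((A T + |ε| * Y T) * (2 * Real.pi * Y T) + Y T * (2 * Real.pi * A T)) + Y T / ε
  set Cf : ℝ := d * ((A T + |ε| * Y T) * (2 * Real.pi * Y T) + ε * (Y T * A T) + Y T / ε) + A T
  have hvb : ∀ N, ∀ t ∈ Set.Icc 0 T, ∀ i k, ‖velField ε (a t) (uN N t) (σN N t) i k‖ ≤ Cv :=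
    fun N t ht i k => norm_velField_le hs hε (ha' t ht) (huN N t ht) (hσN N t ht) i k
  have hfb : ∀ N, ∀ t ∈ Set.Icc 0 T, ∀ k,
      ‖fieldField ε (a t) (q t) (h t) (uN N t) (σN N t) k‖ ≤ Cf :=
    fun N t ht k => norm_fieldField_le hs hε (ha' t ht) (hq' t ht) (hh' t ht) (huN N t ht)
      (hσN N t ht) k
  have hlip : ∀ {F G : ℝ → ℂ} {C : ℝ},
      (∀ t ∈ Set.Icc 0 T, HasDerivWithinAt F (G t) (Set.Icc 0 T) t) →
      (∀ t ∈ Set.Icc 0 T, ‖G t‖ ≤ C) → ∀ t ∈ Set.Icc 0 T, ∀ t' ∈ Set.Icc 0 T,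
      ‖F t - F t'‖ ≤ C * |t - t'| := by
    intro F G C h1 h2 t ht t' ht'
    exact (convex_Icc 0 T).norm_image_sub_le_of_norm_hasDerivWithin_le h1 h2 ht' ht
  -- The index `none` stands for `σ`, and `some i` for the `i`-th velocity component. For a fixed
  -- frequency the equation holds only once the box contains it, hence the eventual Lipschitz
  -- bounds.
  obtain ⟨φ, f, hφ, hf⟩ := exists_subseq_tendsto (ι := Option (Fin d) × Freq d) hT
    (fun N t p => p.1.elim (σN N t p.2) fun i => uN N t i p.2) (B := Y T)
    (fun N t ht p => by
      rcases p with ⟨_ | i, k⟩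
      · exact (hσN N t ht).norm_le k
      · exact (huN N t ht i).norm_le k)
    (fun p => by
      rcases p with ⟨_ | i, k⟩
      · refine ⟨Cf, (eventually_mem_freqBox k).mono fun N hk => ?_⟩
        exact hlip (fun t ht => ((hN N t ht).2.2.2.2 k hk).2) (fun t ht => hfb N t ht k)
      · refine ⟨Cv, (eventually_mem_freqBox k).mono fun N hk => ?_⟩
        exact hlip (fun t ht => ((hN N t ht).2.2.2.2 k hk).1 i) (fun t ht => hvb N t ht i k))
  have hu : ∀ t ∈ Set.Icc 0 T, ∀ i k,
      Tendsto (fun n => uN (φ n) t i k) atTop (𝓝 (f t (some i, k))) := fun t ht i k =>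
    hf t ht (some i, k)
  have hσ : ∀ t ∈ Set.Icc 0 T, ∀ k,
      Tendsto (fun n => σN (φ n) t k) atTop (𝓝 (f t (none, k))) := fun t ht k => hf t ht (none, k)
  set u : ℝ → Fin d → Freq d → ℂ := fun t i k => f t (some i, k) with hudef
  set σ : ℝ → Freq d → ℂ := fun t k => f t (none, k) with hσdef
  have hbox : ∀ k : Freq d, ∀ᶠ n in atTop, k ∈ freqBox d (φ n) := fun k =>
    hφ.tendsto_atTop.eventually (eventually_mem_freqBox k)
  have hub : ∀ t ∈ Set.Icc 0 T, ∀ i, SobBound s (u t i) (Y t) := fun t ht i =>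
    SobBound.of_tendsto (Eventually.of_forall fun n => (hN (φ n) t ht).2.2.1 i) (hu t ht i)
  have hσb : ∀ t ∈ Set.Icc 0 T, SobBound s (σ t) (Y t) := fun t ht =>
    SobBound.of_tendsto (Eventually.of_forall fun n => (hN (φ n) t ht).2.2.2.1) (hσ t ht)
  -- continuity in time of the solutions and of the vector fields
  have hcont : ∀ {F : ℝ → ℂ} {C : ℝ}, (∀ t ∈ Set.Icc 0 T, ∀ t' ∈ Set.Icc 0 T,
      ‖F t - F t'‖ ≤ C * |t - t'|) → ContinuousOn F (Set.Icc 0 T) := by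
    intro F C hF
    refine (LipschitzOnWith.of_dist_le_mul (K := ⟨max C 0, le_max_right _ _⟩)
      fun t ht t' ht' => ?_).continuousOn
    rw [dist_eq_norm, Real.dist_eq]
    refine (hF t ht t' ht').trans ?_
    exact mul_le_mul_of_nonneg_right (le_max_left _ _) (abs_nonneg _)
  have huc : ∀ i k, ContinuousOn (fun t => u t i k) (Set.Icc 0 T) := by
    intro i k
    refine hcont (C := Cv) fun t ht t' ht' => ?_
    refine le_of_tendsto ((hu t ht i k).sub (hu t' ht' i k)).norm ?_
    filter_upwards [hbox k] with n hk
    exact hlip (F := fun t => uN (φ n) t i k) (fun t ht => ((hN (φ n) t ht).2.2.2.2 k hk).1 i)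
      (fun t ht => hvb (φ n) t ht i k) t ht t' ht'
  have hσc : ∀ k, ContinuousOn (fun t => σ t k) (Set.Icc 0 T) := by
    intro k
    refine hcont (C := Cf) fun t ht t' ht' => ?_
    refine le_of_tendsto ((hσ t ht k).sub (hσ t' ht' k)).norm ?_
    filter_upwards [hbox k] with n hk
    exact hlip (F := fun t => σN (φ n) t k) (fun t ht => ((hN (φ n) t ht).2.2.2.2 k hk).2)
      (fun t ht => hfb (φ n) t ht k) t ht t' ht'
  -- Stated for arbitrary `u` and `σ`, since it serves both the Galerkin solutions and their limit.
  have hvc : ∀ (u : ℝ → Fin d → Freq d → ℂ) (σ : ℝ → Freq d → ℂ),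
      (∀ i k, ContinuousOn (fun t => u t i k) (Set.Icc 0 T)) →
      (∀ k, ContinuousOn (fun t => σ t k) (Set.Icc 0 T)) →
      (∀ t ∈ Set.Icc 0 T, ∀ i, SobBound s (u t i) (Y T)) → ∀ i k,
      ContinuousOn (fun t => velField ε (a t) (u t) (σ t) i k) (Set.Icc 0 T) := by
    intro u σ hu hσ hub i k t ht
    exact tendsto_velField hd hs (eventually_mem_nhdsWithin.mono ha')
      (eventually_mem_nhdsWithin.mono hub) (fun i k => hac i k t ht) (fun i k => hu i k t ht)
      (fun k => hσ k t ht) i k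
  have hfc : ∀ (u : ℝ → Fin d → Freq d → ℂ) (σ : ℝ → Freq d → ℂ),
      (∀ i k, ContinuousOn (fun t => u t i k) (Set.Icc 0 T)) →
      (∀ k, ContinuousOn (fun t => σ t k) (Set.Icc 0 T)) →
      (∀ t ∈ Set.Icc 0 T, ∀ i, SobBound s (u t i) (Y T)) →
      (∀ t ∈ Set.Icc 0 T, SobBound s (σ t) (Y T)) → ∀ k,
      ContinuousOn (fun t => fieldField ε (a t) (q t) (h t) (u t) (σ t) k) (Set.Icc 0 T) := by
    intro u σ hu hσ hub hσb k t ht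
    exact tendsto_fieldField hd hs (eventually_mem_nhdsWithin.mono ha')
      (eventually_mem_nhdsWithin.mono hq')
      (eventually_mem_nhdsWithin.mono hub) (eventually_mem_nhdsWithin.mono hσb)
      (fun i k => hac i k t ht) (fun k => hqc k t ht) (fun k => hhc k t ht)
      (fun i k => hu i k t ht) (fun k => hσ k t ht) k
  have huNc : ∀ N i k, ContinuousOn (fun t => uN N t i k) (Set.Icc 0 T) := by
    intro N i k
    by_cases hk : k ∈ freqBox d N
    · exact fun t ht => (((hN N t ht).2.2.2.2 k hk).1 i).continuousWithinAt
    · simp only [huS N _ i k hk]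
      exact continuousOn_const
  have hσNc : ∀ N k, ContinuousOn (fun t => σN N t k) (Set.Icc 0 T) := by
    intro N k
    by_cases hk : k ∈ freqBox d N
    · exact fun t ht => (((hN N t ht).2.2.2.2 k hk).2).continuousWithinAt
    · simp only [hσS N _ k hk]
      exact continuousOn_const
  have hubT : ∀ t ∈ Set.Icc 0 T, ∀ i, SobBound s (u t i) (Y T) := fun t ht i =>
    (hub t ht i).mono (hYT t ht)
  have hσbT : ∀ t ∈ Set.Icc 0 T, SobBound s (σ t) (Y T) := fun t ht =>
    (hσb t ht).mono (hYT t ht)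
  refine ⟨u, σ, ?_, ?_, fun t ht => ⟨fun i => ?_, ?_, hub t ht, hσb t ht,
    fun k => ⟨fun i => ?_, ?_⟩⟩⟩
  · funext i k
    exact tendsto_nhds_unique_of_eventuallyEq (hu 0 h0T i k) tendsto_const_nhds
      ((hbox k).mono fun n hk => hu0 (φ n) i k hk)
  · funext k
    exact tendsto_nhds_unique_of_eventuallyEq (hσ 0 h0T k) tendsto_const_nhds
      ((hbox k).mono fun n hk => hσ0 (φ n) k hk)
  · exact IsRealSeq.of_tendsto (Eventually.of_forall fun n => (hN (φ n) t ht).1 i) (hu t ht i)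
  · exact IsRealSeq.of_tendsto (Eventually.of_forall fun n => (hN (φ n) t ht).2.1) (hσ t ht)
  · refine hasDerivWithinAt_of_tendsto (F := fun n t => uN (φ n) t i k)
      (G := fun n t => velField ε (a t) (uN (φ n) t) (σN (φ n) t) i k)
      (g := fun t => velField ε (a t) (u t) (σ t) i k)
      ((hbox k).mono fun n hk t ht => ((hN (φ n) t ht).2.2.2.2 k hk).1 i)
      (Eventually.of_forall fun n => hvc _ _ (huNc (φ n)) (hσNc (φ n)) (huN (φ n)) i k)
      (fun n t ht => hvb (φ n) t ht i k) (hvc u σ huc hσc hubT i k)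
      (fun t ht => hu t ht i k) (fun t ht => ?_) ht
    exact tendsto_velField hd hs (Eventually.of_forall fun _ => ha' t ht)
      (Eventually.of_forall fun n => huN (φ n) t ht) (fun i k => tendsto_const_nhds) (hu t ht)
      (hσ t ht) i k
  · refine hasDerivWithinAt_of_tendsto (F := fun n t => σN (φ n) t k)
      (G := fun n t => fieldField ε (a t) (q t) (h t) (uN (φ n) t) (σN (φ n) t) k)
      (g := fun t => fieldField ε (a t) (q t) (h t) (u t) (σ t) k)
      ((hbox k).mono fun n hk t ht => ((hN (φ n) t ht).2.2.2.2 k hk).2)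
      (Eventually.of_forall fun n => hfc _ _ (huNc (φ n)) (hσNc (φ n)) (huN (φ n)) (hσN (φ n)) k)
      (fun n t ht => hfb (φ n) t ht k) (hfc u σ huc hσc hubT hσbT k)
      (fun t ht => hσ t ht k) (fun t ht => ?_) ht
    exact tendsto_fieldField hd hs (Eventually.of_forall fun _ => ha' t ht)
      (Eventually.of_forall fun _ => hq' t ht)
      (Eventually.of_forall fun n => huN (φ n) t ht) (Eventually.of_forall fun n => hσN (φ n) t ht)
      (fun i k => tendsto_const_nhds) (fun k => tendsto_const_nhds) (fun k => tendsto_const_nhds)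
      (hu t ht) (hσ t ht) k

/-! ### Fourier series as functions on the torus -/

/-- The character `exp (2πi k·x)` of the torus. -/
abbrev chr (k : Freq d) (x : Torus d) : ℂ := UnitAddTorus.mFourier k x

/-- The sum of the Fourier series with coefficients `c`. -/
def synth (c : Freq d → ℂ) (x : Torus d) : ℂ := ∑' k, c k * chr k x

/-- The Fourier coefficients of a real function on the torus. -/
def coef (f : Torus d → ℝ) : Freq d → ℂ := UnitAddTorus.mFourierCoeff fun x => (f x : ℂ)

instance : IsProbabilityMeasure (torusMeasure d) :=
  inferInstanceAs (IsProbabilityMeasure (Measure.pi fun _ => AddCircle.haarAddCircle))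

instance : (torusMeasure d).IsAddLeftInvariant :=
  inferInstanceAs (Measure.IsAddLeftInvariant (Measure.pi fun _ => AddCircle.haarAddCircle))

lemma coef_eq (f : Torus d → ℝ) (k : Freq d) :
    coef f k = ∫ x, chr (-k) x * (f x : ℂ) ∂torusMeasure d := rfl

lemma norm_chr (k : Freq d) (x : Torus d) : ‖chr k x‖ = 1 := by
  simp only [chr, UnitAddTorus.mFourier, fourier_apply, ContinuousMap.coe_mk, norm_prod,
    Circle.norm_coe, Finset.prod_const_one]

lemma continuous_chr (k : Freq d) : Continuous (chr k) := (UnitAddTorus.mFourier k).continuous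

lemma chr_zero (x : Torus d) : chr 0 x = 1 := by simp [chr, UnitAddTorus.mFourier_zero]

lemma chr_neg (k : Freq d) (x : Torus d) : chr (-k) x = conj (chr k x) := UnitAddTorus.mFourier_neg

lemma chr_add (k l : Freq d) (x : Torus d) : chr (k + l) x = chr k x * chr l x :=
  UnitAddTorus.mFourier_add

lemma chr_translate (k : Freq d) (x : Torus d) (j : Fin d) (h : ℝ) :
    chr k (x + Pi.single j (h : UnitAddCircle)) =
      chr k x * Complex.exp (2 * Real.pi * Complex.I * k j * h) := by
  have e : ∀ i, fourier (k i) ((x + Pi.single j (h : UnitAddCircle) : Torus d) i) =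
      fourier (k i) (x i) * fourier (k i) ((Pi.single j (h : UnitAddCircle) : Torus d) i) := by
    intro i
    simp only [fourier_apply, Pi.add_apply, smul_add, AddCircle.toCircle_add, Circle.coe_mul]
  simp only [chr, UnitAddTorus.mFourier, ContinuousMap.coe_mk]
  rw [Finset.prod_congr rfl fun i _ => e i, Finset.prod_mul_distrib]
  congr 1
  rw [Finset.prod_eq_single j]
  · rw [Pi.single_eq_same, fourier_coe_apply]
    congr 1
    push_cast
    ring
  · intro i _ hi
    rw [Pi.single_eq_of_ne hi]
    simp
  · simp

lemma hasDerivAt_chr (k : Freq d) (x : Torus d) (j : Fin d) (h : ℝ) :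
    HasDerivAt (fun h : ℝ => chr k (x + Pi.single j (h : UnitAddCircle)))
      (2 * Real.pi * Complex.I * k j * chr k (x + Pi.single j (h : UnitAddCircle))) h := by
  simp only [chr_translate]
  have h1 : HasDerivAt (fun h : ℝ => (2 * Real.pi * Complex.I * k j * h : ℂ))
      (2 * Real.pi * Complex.I * k j) h := by
    simpa using (Complex.ofRealCLM.hasDerivAt (x := h)).const_mul (2 * Real.pi * Complex.I * k j : ℂ)
  refine ((h1.cexp).const_mul (chr k x)).congr_deriv ?_
  ring

lemma summable_synth {c : Freq d → ℂ} (hc : Summable fun k => ‖c k‖) (x : Torus d) :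
    Summable fun k => c k * chr k x := by
  refine Summable.of_norm ?_
  simpa only [norm_mul, norm_chr, mul_one] using hc

lemma norm_synth_le {c : Freq d → ℂ} (hc : Summable fun k => ‖c k‖) (x : Torus d) :
    ‖synth c x‖ ≤ ∑' k, ‖c k‖ := by
  refine tsum_of_norm_bounded hc.hasSum fun k => ?_
  rw [norm_mul, norm_chr, mul_one]

lemma SobBound.norm_synth_le (hd : d ≤ 3) {c : Freq d → ℂ} {R : ℝ} (hc : SobBound 2 c R)
    (x : Torus d) : ‖synth c x‖ ≤ embConst d * R :=
  (EulerPoisson.norm_synth_le (hc.summable_norm hd le_rfl) x).trans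
    ((hc.summable_norm hd le_rfl).tsum_le_of_sum_le fun S => hc.sum_norm_le hd le_rfl S)

lemma continuous_synth {c : Freq d → ℂ} (hc : Summable fun k => ‖c k‖) : Continuous (synth c) := by
  refine continuous_tsum (fun k => (continuous_chr k).const_mul (c k)) hc fun k x => ?_
  rw [norm_mul, norm_chr, mul_one]

lemma synth_add {c c' : Freq d → ℂ} (hc : Summable fun k => ‖c k‖)
    (hc' : Summable fun k => ‖c' k‖) (x : Torus d) :
    synth (fun k => c k + c' k) x = synth c x + synth c' x := by
  simp only [synth, add_mul]
  exact (summable_synth hc x).tsum_add (summable_synth hc' x)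

lemma synth_smul (c : Freq d → ℂ) (z : ℂ) (x : Torus d) :
    synth (fun k => z * c k) x = z * synth c x := by
  simp only [synth, mul_assoc, tsum_mul_left]

lemma synth_neg (c : Freq d → ℂ) (x : Torus d) : synth (fun k => -c k) x = -synth c x := by
  simp only [synth, neg_mul, tsum_neg]

lemma synth_sum {ι : Type*} (S : Finset ι) {c : ι → Freq d → ℂ}
    (hc : ∀ i, Summable fun k => ‖c i k‖) (x : Torus d) :
    synth (fun k => ∑ i ∈ S, c i k) x = ∑ i ∈ S, synth (c i) x := by
  simp only [synth, Finset.sum_mul]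
  exact Summable.tsum_finsetSum fun i _ => summable_synth (hc i) x

lemma conj_synth {c : Freq d → ℂ} (hc : IsRealSeq c) (x : Torus d) :
    conj (synth c x) = synth c x := by
  rw [synth, Complex.conj_tsum, ← (Equiv.neg (Freq d)).tsum_eq]
  refine tsum_congr fun k => ?_
  simp only [Equiv.neg_apply, map_mul]
  rw [hc k, Complex.conj_conj, chr_neg, Complex.conj_conj]

lemma ofReal_re_synth {c : Freq d → ℂ} (hc : IsRealSeq c) (x : Torus d) :
    (((synth c x).re : ℝ) : ℂ) = synth c x :=
  Complex.conj_eq_iff_re.mp (conj_synth hc x)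

lemma hasDerivAt_synth {c : Freq d → ℂ} (hc : Summable fun k => jb k * ‖c k‖) (x : Torus d)
    (j : Fin d) (h : ℝ) :
    HasDerivAt (fun h : ℝ => synth c (x + Pi.single j (h : UnitAddCircle)))
      (synth (dseq j c) (x + Pi.single j (h : UnitAddCircle))) h := by
  have hc0 : Summable fun k => ‖c k‖ := Summable.of_nonneg_of_le (fun k => norm_nonneg _)
    (fun k => le_mul_of_one_le_left (norm_nonneg _) (one_le_jb k)) hc
  let g : Freq d → ℝ → ℂ := fun k h => c k * chr k (x + Pi.single j (h : UnitAddCircle))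
  let g' : Freq d → ℝ → ℂ := fun k h => dseq j c k * chr k (x + Pi.single j (h : UnitAddCircle))
  have hg : ∀ k y, HasDerivAt (g k) (g' k y) y := fun k y => by
    refine ((hasDerivAt_chr k x j y).const_mul (c k)).congr_deriv ?_
    simp only [g', dseq]
    ring
  have hg' : ∀ k y, ‖g' k y‖ ≤ 2 * Real.pi * (jb k * ‖c k‖) := fun k y => by
    simp only [g', norm_mul, norm_chr, mul_one]
    exact (norm_dseq_le j c k).trans (le_of_eq (by ring))
  exact hasDerivAt_tsum (hc.mul_left (2 * Real.pi)) hg hg' (y₀ := 0) (summable_synth hc0 _) h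

lemma pd_eq_of_hasDerivAt {f : Torus d → ℝ} {j : Fin d} {x : Torus d} {z : ℝ}
    (h : HasDerivAt (fun h : ℝ => f (x + Pi.single j (h : UnitAddCircle))) z 0) : pd j f x = z :=
  h.deriv

lemma hasDerivAt_re_synth {c : Freq d → ℂ} (hc : Summable fun k => jb k * ‖c k‖) (x : Torus d)
    (j : Fin d) :
    HasDerivAt (fun h : ℝ => (synth c (x + Pi.single j (h : UnitAddCircle))).re)
      (synth (dseq j c) x).re 0 := by
  have h1 := hasDerivAt_synth hc x j 0
  have h2 : HasDerivAt (fun h : ℝ => (synth c (x + Pi.single j (h : UnitAddCircle))).re) _ 0 :=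
    Complex.reCLM.hasFDerivAt.comp_hasDerivAt (0 : ℝ) h1
  refine h2.congr_deriv ?_
  simp

lemma pd_re_synth {c : Freq d → ℂ} (hc : Summable fun k => jb k * ‖c k‖) (j : Fin d) :
    pd j (fun x => (synth c x).re) = fun x => (synth (dseq j c) x).re :=
  funext fun x => pd_eq_of_hasDerivAt (hasDerivAt_re_synth hc x j)

lemma synth_mul {f g : Freq d → ℂ} (hf : Summable fun k => ‖f k‖) (hg : Summable fun k => ‖g k‖)
    (x : Torus d) : synth f x * synth g x = synth (conv f g) x := by
  have hf' : Summable fun k => ‖f k * chr k x‖ := by simpa only [norm_mul, norm_chr, mul_one] using hf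
  have hg' : Summable fun k => ‖g k * chr k x‖ := by simpa only [norm_mul, norm_chr, mul_one] using hg
  have hs := summable_mul_of_summable_norm hf' hg'
  rw [synth, synth, tsum_mul_tsum_of_summable_norm hf' hg']
  -- This shear puts the total frequency in the first variable, so that the inner sums are
  -- convolutions.
  let e : Freq d × Freq d ≃ Freq d × Freq d :=
    { toFun := fun p => (p.1 - p.2, p.2)
      invFun := fun p => (p.1 + p.2, p.2)
      left_inv := fun p => by simp
      right_inv := fun p => by simp }
  rw [← e.tsum_eq]
  have hs' : Summable fun p : Freq d × Freq d =>
      f (e p).1 * chr (e p).1 x * (g (e p).2 * chr (e p).2 x) := e.summable_iff.mpr hs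
  rw [hs'.tsum_prod]
  refine tsum_congr fun k => ?_
  rw [conv, ← tsum_mul_right]
  refine tsum_congr fun l => ?_
  have h1 := chr_add (k - l) l x
  rw [sub_add_cancel] at h1
  simp only [e, Equiv.coe_fn_mk, h1]
  ring

lemma integral_chr (k : Freq d) :
    ∫ x, chr k x ∂torusMeasure d = if k = 0 then 1 else 0 := by
  have h := (orthonormal_iff_ite.mp (UnitAddTorus.orthonormal_mFourier (d := Fin d))) 0 k
  simp only [ContinuousMap.inner_toLp, UnitAddTorus.mFourier_zero] at h
  rw [show (∫ x, chr k x ∂torusMeasure d) = if (0 : Freq d) = k then 1 else 0 from ?_]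
  · simp only [eq_comm]
  · rw [← h]
    refine integral_congr_ae (ae_of_all _ fun x => ?_)
    simp

lemma _root_.Continuous.integrable_torus {E : Type*} [NormedAddCommGroup E] {f : Torus d → E}
    (hf : Continuous f) : Integrable f (torusMeasure d) :=
  hf.integrable_of_hasCompactSupport (HasCompactSupport.of_compactSpace f)

lemma hasSum_integral_synth_mul {c : Freq d → ℂ} (hc : Summable fun k => ‖c k‖) {g : Torus d → ℂ}
    (hg : Integrable g (torusMeasure d)) :
    HasSum (fun k => c k * ∫ x, chr k x * g x ∂torusMeasure d)
      (∫ x, synth c x * g x ∂torusMeasure d) := by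
  have h := hasSum_integral_of_dominated_convergence (μ := torusMeasure d)
    (F := fun k x => c k * (chr k x * g x)) (f := fun x => synth c x * g x)
    (fun k x => ‖c k‖ * ‖g x‖) (fun k => ?_) (fun k => ae_of_all _ fun x => ?_)
    (ae_of_all _ fun x => hc.mul_right _) ?_ (ae_of_all _ fun x => ?_)
  · simpa only [integral_const_mul] using h
  · exact ((continuous_chr k).aestronglyMeasurable.mul hg.aestronglyMeasurable).const_mul _
  · rw [norm_mul, norm_mul, norm_chr, one_mul]
  · simp only [tsum_mul_right]
    exact hg.norm.const_mul _
  · have := ((summable_synth hc x).hasSum).mul_right (g x)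
    simpa only [mul_assoc, synth] using this

lemma integral_synth {c : Freq d → ℂ} (hc : Summable fun k => ‖c k‖) (k : Freq d) :
    ∫ x, chr (-k) x * synth c x ∂torusMeasure d = c k := by
  have h := hasSum_integral_synth_mul hc (continuous_chr (-k)).integrable_torus
  have e : ∀ l, ∫ x, chr l x * chr (-k) x ∂torusMeasure d = if l = k then 1 else 0 := by
    intro l
    simp only [← chr_add, integral_chr, ← sub_eq_add_neg, sub_eq_zero]
  simp only [e, mul_ite, mul_one, mul_zero] at h
  have h2 : HasSum (fun l => if l = k then c k else 0) (∫ x, synth c x * chr (-k) x ∂torusMeasure d) :=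
    h.congr_fun fun l => by split_ifs with h <;> simp [h]
  simp_rw [mul_comm (chr _ _)]
  exact h2.unique (hasSum_ite_eq k (c k))

lemma coef_re_synth {c : Freq d → ℂ} (hc : Summable fun k => ‖c k‖) (hr : IsRealSeq c) :
    coef (fun x => (synth c x).re) = c := by
  ext k
  simp only [coef_eq, ofReal_re_synth hr, integral_synth hc]

lemma isRealSeq_coef (f : Torus d → ℝ) : IsRealSeq (coef f) := by
  intro k
  rw [coef_eq, coef_eq, ← integral_conj]
  refine integral_congr_ae (ae_of_all _ fun x => ?_)
  simp only [map_mul, Complex.conj_ofReal, chr_neg]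

lemma tendsto_freqBox : Tendsto (freqBox d) atTop atTop := by
  refine tendsto_atTop_finset_of_monotone (fun m n h k hk => ?_)
    fun k => (eventually_mem_freqBox k).exists
  rw [mem_freqBox] at hk ⊢
  intro i
  have := hk i
  omega

lemma norm_synth_sub_sum_le {c : Freq d → ℂ} (hc : Summable fun k => ‖c k‖) {S₀ : Finset (Freq d)}
    {δ : ℝ} (h : ∀ S : Finset (Freq d), Disjoint S S₀ → ∑ k ∈ S, ‖c k‖ ≤ δ) (x : Torus d) :
    ‖synth c x - ∑ k ∈ S₀, c k * chr k x‖ ≤ δ := by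
  classical
  have h1 : Tendsto (fun S => ∑ k ∈ S, c k * chr k x) atTop (𝓝 (synth c x)) :=
    (summable_synth hc x).hasSum
  refine le_of_tendsto (h1.sub_const _).norm ?_
  filter_upwards [eventually_ge_atTop S₀] with S hS
  rw [← Finset.sum_sdiff hS, add_sub_cancel_right]
  refine (norm_sum_le _ _).trans (le_trans (le_of_eq ?_) (h (S \ S₀) Finset.sdiff_disjoint))
  simp only [norm_mul, norm_chr, mul_one]

/-- Partial sums are jointly continuous and converge uniformly, since tails are uniformly small on
bounded sets of `H²`. Hence continuity in time of each coefficient is enough. -/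
lemma continuousOn_synth (hd : d ≤ 3) {I : Set ℝ} {c : ℝ → Freq d → ℂ} {R : ℝ}
    (hc : ∀ k, ContinuousOn (fun t => c t k) I) (hR : ∀ t ∈ I, SobBound 2 (c t) R) :
    ContinuousOn (fun q : ℝ × Torus d => synth (c q.1) q.2) (I ×ˢ Set.univ) := by
  refine continuousOn_of_uniform_approx_of_continuousOn fun V hV => ?_
  obtain ⟨δ, hδ, hδV⟩ := Metric.mem_uniformity_dist.mp hV
  obtain ⟨S₀, hS₀⟩ := exists_tail_le (d := d) hd (δ := δ / (2 * (|R| + 1))) (by positivity)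
  refine ⟨fun q => ∑ k ∈ S₀, c q.1 k * chr k q.2, ?_, fun q hq => hδV ?_⟩
  · refine continuousOn_finsetSum _ fun k _ => ContinuousOn.mul ?_ ?_
    · exact (hc k).comp continuousOn_fst fun q hq => hq.1
    · exact ((continuous_chr k).comp continuous_snd).continuousOn
  · rw [dist_eq_norm]
    refine lt_of_le_of_lt (norm_synth_sub_sum_le ((hR q.1 hq.1).summable_norm hd le_rfl)
      (hS₀ _ _ (hR q.1 hq.1)) q.2) ?_
    rw [div_mul_eq_mul_div, div_lt_iff₀ (by positivity)]
    have := le_abs_self R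
    have := abs_nonneg R
    nlinarith

lemma continuousOn_re_synth (hd : d ≤ 3) {I : Set ℝ} {c : ℝ → Freq d → ℂ} {R : ℝ}
    (hc : ∀ k, ContinuousOn (fun t => c t k) I) (hR : ∀ t ∈ I, SobBound 2 (c t) R) :
    ContinuousOn (fun q : ℝ × Torus d => (synth (c q.1) q.2).re) (I ×ˢ Set.univ) :=
  Complex.continuous_re.comp_continuousOn (continuousOn_synth hd hc hR)

/-- Termwise differentiation through the integrated equations of the partial sums over boxes. It
needs a uniform bound on absolute partial sums and a continuous limit, but no summable majorant
independent of time. -/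
lemma hasDerivWithinAt_tsum_freq {c c' : ℝ → Freq d → ℂ} {f g : ℝ → ℂ} {w : Freq d → ℂ} {T C : ℝ}
    (hc : ∀ k, ∀ t ∈ Set.Icc 0 T, HasDerivWithinAt (fun τ => c τ k) (c' t k) (Set.Icc 0 T) t)
    (hc' : ∀ k, ContinuousOn (fun t => c' t k) (Set.Icc 0 T))
    (hC : ∀ t ∈ Set.Icc 0 T, ∀ S : Finset (Freq d), ∑ k ∈ S, ‖c' t k * w k‖ ≤ C)
    (hf : ∀ t ∈ Set.Icc 0 T, HasSum (fun k => c t k * w k) (f t))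
    (hg : ∀ t ∈ Set.Icc 0 T, HasSum (fun k => c' t k * w k) (g t))
    (hgc : ContinuousOn g (Set.Icc 0 T)) {t : ℝ} (ht : t ∈ Set.Icc 0 T) :
    HasDerivWithinAt f (g t) (Set.Icc 0 T) t := by
  refine hasDerivWithinAt_of_tendsto (F := fun n t => ∑ k ∈ freqBox d n, c t k * w k)
    (G := fun n t => ∑ k ∈ freqBox d n, c' t k * w k) (C := C) ?_ ?_ (fun n t ht => ?_) hgc
    (fun t ht => (hf t ht).comp tendsto_freqBox) (fun t ht => (hg t ht).comp tendsto_freqBox) ht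
  · refine Eventually.of_forall fun n t ht => HasDerivWithinAt.fun_sum fun k _ => ?_
    exact (hc k t ht).mul_const _
  · exact Eventually.of_forall fun n => continuousOn_finsetSum _ fun k _ => (hc' k).mul_const _
  · exact (norm_sum_le _ _).trans (hC t ht _)

lemma hasDerivWithinAt_synth (hd : d ≤ 3) {c c' : ℝ → Freq d → ℂ} {T R : ℝ}
    (hs : ∀ t ∈ Set.Icc 0 T, Summable fun k => ‖c t k‖)
    (hc : ∀ k, ∀ t ∈ Set.Icc 0 T, HasDerivWithinAt (fun τ => c τ k) (c' t k) (Set.Icc 0 T) t)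
    (hc' : ∀ k, ContinuousOn (fun t => c' t k) (Set.Icc 0 T))
    (hR : ∀ t ∈ Set.Icc 0 T, SobBound 2 (c' t) R) (x : Torus d) {t : ℝ} (ht : t ∈ Set.Icc 0 T) :
    HasDerivWithinAt (fun τ => synth (c τ) x) (synth (c' t) x) (Set.Icc 0 T) t := by
  refine hasDerivWithinAt_tsum_freq (w := fun k => chr k x) hc hc' (C := embConst d * R)
    (fun t ht S => ?_) (fun t ht => (summable_synth (hs t ht) x).hasSum)
    (fun t ht => (summable_synth ((hR t ht).summable_norm hd le_rfl) x).hasSum) ?_ ht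
  · simp only [norm_mul, norm_chr, mul_one]
    exact (hR t ht).sum_norm_le hd le_rfl S
  · exact (continuousOn_synth hd hc' hR).comp (f := fun t => (t, x)) (by fun_prop)
      fun t ht => ⟨ht, trivial⟩

lemma hasDerivWithinAt_re_synth (hd : d ≤ 3) {c c' : ℝ → Freq d → ℂ} {T R : ℝ}
    (hs : ∀ t ∈ Set.Icc 0 T, Summable fun k => ‖c t k‖)
    (hc : ∀ k, ∀ t ∈ Set.Icc 0 T, HasDerivWithinAt (fun τ => c τ k) (c' t k) (Set.Icc 0 T) t)
    (hc' : ∀ k, ContinuousOn (fun t => c' t k) (Set.Icc 0 T))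
    (hR : ∀ t ∈ Set.Icc 0 T, SobBound 2 (c' t) R) (x : Torus d) {t : ℝ} (ht : t ∈ Set.Icc 0 T) :
    HasDerivWithinAt (fun τ => (synth (c τ) x).re) (synth (c' t) x).re (Set.Icc 0 T) t := by
  have h := Complex.reCLM.hasFDerivAt.comp_hasDerivWithinAt t
    (hasDerivWithinAt_synth hd hs hc hc' hR x ht)
  exact h

/-! ### Periodic functions on `ℝ^d` -/

/-- The projection of `ℝ^d` onto the torus. -/
def proj (y : Fin d → ℝ) : Torus d := fun i => (y i : UnitAddCircle)

lemma isOpenQuotientMap_proj : IsOpenQuotientMap (proj : (Fin d → ℝ) → Torus d) :=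
  IsOpenQuotientMap.piMap fun _ => QuotientAddGroup.isOpenQuotientMap_mk

lemma proj_add_single (y : Fin d → ℝ) (j : Fin d) (h : ℝ) :
    proj (y + Pi.single j h) = proj y + Pi.single j (h : UnitAddCircle) := by
  funext i
  rcases eq_or_ne i j with rfl | hi
  · simp [proj]
  · simp [proj, hi]

lemma continuous_of_continuous_lift {f : Torus d → ℝ} (hf : Continuous (lift f)) : Continuous f :=
  isOpenQuotientMap_proj.isQuotientMap.continuous_iff.mpr hf

lemma IsCn.continuous {n : ℕ∞} {f : Torus d → ℝ} (hf : IsCn n f) : Continuous f :=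
  continuous_of_continuous_lift (ContDiff.continuous hf)

lemma IsCn.hasDerivAt_lift {f : Torus d → ℝ} (hf : IsCn 1 f) (j : Fin d) (y : Fin d → ℝ) :
    HasDerivAt (fun h : ℝ => f (proj y + Pi.single j (h : UnitAddCircle)))
      (fderiv ℝ (lift f) y (Pi.single j 1)) 0 := by
  have h1 : HasFDerivAt (lift f) (fderiv ℝ (lift f) y) (y + Pi.single j (0 : ℝ)) := by
    rw [Pi.single_zero, add_zero]
    exact ((ContDiff.differentiable hf one_ne_zero) y).hasFDerivAt
  have h2 : HasDerivAt (fun h : ℝ => y + Pi.single j h) (Pi.single j (1 : ℝ)) 0 := by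
    have := ((ContinuousLinearMap.single ℝ (fun _ : Fin d => ℝ) j).hasDerivAt (x := 0)).const_add y
    simpa using this
  have h3 := h1.comp_hasDerivAt (0 : ℝ) h2
  refine h3.congr_of_eventuallyEq (Eventually.of_forall fun h => ?_)
  simp only [Function.comp_apply, ← proj_add_single]
  rfl

lemma IsCn.hasDerivAt {f : Torus d → ℝ} (hf : IsCn 1 f) (j : Fin d) (x : Torus d) :
    HasDerivAt (fun h : ℝ => f (x + Pi.single j (h : UnitAddCircle))) (pd j f x) 0 := by
  obtain ⟨y, rfl⟩ := isOpenQuotientMap_proj.surjective x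
  exact (hf.hasDerivAt_lift j y).differentiableAt.hasDerivAt

lemma IsCn.lift_pd {f : Torus d → ℝ} (hf : IsCn 1 f) (j : Fin d) :
    lift (pd j f) = fun y => fderiv ℝ (lift f) y (Pi.single j 1) :=
  funext fun y => (hf.hasDerivAt_lift j y).deriv

lemma IsCn.continuous_pd {f : Torus d → ℝ} (hf : IsCn 1 f) (j : Fin d) : Continuous (pd j f) := by
  refine continuous_of_continuous_lift ?_
  rw [hf.lift_pd j]
  exact (ContDiff.continuous_fderiv hf one_ne_zero).clm_apply continuous_const

lemma IsCn.pd_top {f : Torus d → ℝ} (hf : IsCn ⊤ f) (j : Fin d) : IsCn ⊤ (pd j f) := by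
  have h1 : IsCn 1 f := ContDiff.of_le hf (by exact_mod_cast le_top)
  unfold IsCn
  rw [h1.lift_pd j]
  exact (ContDiff.fderiv_right hf (by simp)).clm_apply contDiff_const

lemma IsCn.of_top {f : Torus d → ℝ} (hf : IsCn ⊤ f) (n : ℕ∞) : IsCn n f :=
  ContDiff.of_le hf (by exact_mod_cast le_top)

lemma norm_iteratedFDeriv_cexp (z : ℂ) (m : ℕ) (x : ℝ) :
    ‖iteratedFDeriv ℝ m (fun x : ℝ => z * Complex.exp (Complex.I * x)) x‖ = ‖z‖ := by
  have h : ∀ m : ℕ, iteratedDeriv m (fun x : ℝ => z * Complex.exp (Complex.I * x)) =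
      fun x : ℝ => Complex.I ^ m * z * Complex.exp (Complex.I * x) := by
    intro m
    induction m with
    | zero => simp
    | succ m ih =>
      rw [iteratedDeriv_succ, ih]
      funext x
      have h1 : HasDerivAt (fun x : ℝ => Complex.I * (x : ℂ)) Complex.I x := by
        simpa using (Complex.ofRealCLM.hasDerivAt (x := x)).const_mul Complex.I
      have h2 := (h1.cexp).const_mul (Complex.I ^ m * z)
      rw [h2.deriv]
      ring
  rw [norm_iteratedFDeriv_eq_norm_iteratedDeriv, h]
  have : Complex.exp (Complex.I * x) = Complex.exp (x * Complex.I) := by rw [mul_comm]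
  simp [this, Complex.norm_exp_ofReal_mul_I]

/-- The linear form `y ↦ 2π k·y`. -/
def phase (k : Freq d) : (Fin d → ℝ) →L[ℝ] ℝ :=
  ∑ i, (2 * Real.pi * k i) • ContinuousLinearMap.proj i

lemma norm_phase_le (k : Freq d) : ‖phase k‖ ≤ 2 * Real.pi * d * jb k := by
  refine ContinuousLinearMap.opNorm_le_bound _ (by have := jb_pos k; positivity) fun y => ?_
  simp only [phase, _root_.sum_apply, _root_.smul_apply,
    ContinuousLinearMap.proj_apply, smul_eq_mul]
  refine (norm_sum_le _ _).trans ?_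
  have h : ∀ i ∈ Finset.univ, ‖2 * Real.pi * k i * y i‖ ≤ 2 * Real.pi * jb k * ‖y‖ := by
    intro i _
    rw [norm_mul, norm_mul, Real.norm_of_nonneg Real.two_pi_pos.le, Real.norm_eq_abs]
    have h1 := abs_coord_le_jb k i
    have h2 := norm_le_pi_norm y i
    have h3 := Real.two_pi_pos
    have h4 := jb_pos k
    gcongr
  refine (Finset.sum_le_card_nsmul _ _ _ h).trans (le_of_eq ?_)
  simp only [Finset.card_univ, Fintype.card_fin, nsmul_eq_mul]
  ring

lemma chr_proj (k : Freq d) (y : Fin d → ℝ) :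
    chr k (proj y) = Complex.exp (Complex.I * (phase k y : ℝ)) := by
  simp only [chr, UnitAddTorus.mFourier, ContinuousMap.coe_mk, proj, fourier_coe_apply, phase,
    _root_.sum_apply, _root_.smul_apply,
    ContinuousLinearMap.proj_apply, smul_eq_mul]
  rw [← Complex.exp_sum]
  congr 1
  push_cast
  rw [Finset.mul_sum]
  refine Finset.sum_congr rfl fun i _ => ?_
  ring

/-- On `ℝ^d` a character is an exponential of a linear form of norm at most a multiple of the
weight, so the derivatives up to order `n` have summable bounds. -/
lemma isCn_re_synth {n : ℕ} {c : Freq d → ℂ} (hc : Summable fun k => jb k ^ n * ‖c k‖) :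
    IsCn n (fun x => (synth c x).re) := by
  have hsm : ∀ k, ContDiff ℝ ∞ fun x : ℝ => c k * Complex.exp (Complex.I * x) := fun k =>
    contDiff_const.mul (Complex.contDiff_exp.comp (contDiff_const.mul Complex.ofRealCLM.contDiff))
  have h : ContDiff ℝ ((n : ℕ∞) : WithTop ℕ∞) fun y : Fin d → ℝ =>
      ∑' k, ((fun x : ℝ => c k * Complex.exp (Complex.I * x)) ∘ phase k) y := by
    refine contDiff_tsum (v := fun m k => (2 * Real.pi * d) ^ m * (jb k ^ m * ‖c k‖)) ?_ ?_ ?_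
    · exact fun k => ((hsm k).of_le (by exact_mod_cast le_top)).comp (phase k).contDiff
    · intro m hm
      have hm' : m ≤ n := by exact_mod_cast hm
      refine Summable.mul_left _ (Summable.of_nonneg_of_le (fun k => ?_) (fun k => ?_) hc)
      · have := jb_pos k; positivity
      · gcongr
        exact one_le_jb k
    · intro m k y hm
      rw [(phase k).iteratedFDeriv_comp_right (hsm k) y (by exact_mod_cast le_top)]
      refine (ContinuousMultilinearMap.norm_compContinuousLinearMap_le _ _).trans ?_
      rw [norm_iteratedFDeriv_cexp]
      simp only [Finset.prod_const, Finset.card_univ, Fintype.card_fin]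
      calc ‖c k‖ * ‖phase k‖ ^ m ≤ ‖c k‖ * (2 * Real.pi * d * jb k) ^ m := by
            gcongr; exact norm_phase_le k
        _ = _ := by rw [mul_pow]; ring
  have e : lift (fun x => (synth c x).re) = fun y => Complex.reCLM
      (∑' k, ((fun x : ℝ => c k * Complex.exp (Complex.I * x)) ∘ phase k) y) := by
    funext y
    simp only [Function.comp_apply, ← chr_proj]
    rfl
  unfold IsCn
  rw [e]
  exact Complex.reCLM.contDiff.comp h

/-! ### Sobolev norms of functions and of their coefficients -/

lemma hsTerm_eq (m : ℕ) (f : Torus d → ℝ) (k : Freq d) :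
    hsTerm m f k = jb k ^ (2 * m) * ‖coef f k‖ ^ 2 := by
  rw [pow_mul, jb_sq', modulus_sq]
  rfl

lemma MemHs.sobBound {m : ℕ} {f : Torus d → ℝ} (hf : MemHs m f) {C : ℝ} (hC : hsNorm m f ≤ C) :
    SobBound m (coef f) C := by
  have h0 : 0 ≤ hsNorm m f := Real.sqrt_nonneg _
  have hnn : ∀ k, 0 ≤ hsTerm m f k := fun k => by
    rw [hsTerm_eq]; have := jb_pos k; positivity
  refine ⟨h0.trans hC, fun S => ?_⟩
  simp only [← hsTerm_eq]
  refine (hf.2.sum_le_tsum S fun k _ => hnn k).trans ?_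
  rw [← Real.sq_sqrt (tsum_nonneg hnn)]
  exact pow_le_pow_left₀ h0 hC 2

lemma memHs_of_sobBound {m : ℕ} {f : Torus d → ℝ} (hf : MemLp f 2 (torusMeasure d)) {R : ℝ}
    (hR : SobBound m (coef f) R) : MemHs m f ∧ hsNorm m f ≤ R := by
  have hnn : ∀ k, 0 ≤ hsTerm m f k := fun k => by
    rw [hsTerm_eq]; have := jb_pos k; positivity
  have hb : ∀ S : Finset (Freq d), ∑ k ∈ S, hsTerm m f k ≤ R ^ 2 := fun S => by
    simp only [hsTerm_eq]; exact hR.2 S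
  have hsum := summable_of_sum_le hnn hb
  refine ⟨⟨hf, hsum⟩, ?_⟩
  rw [hsNorm, ← Real.sqrt_sq hR.1]
  exact Real.sqrt_le_sqrt (hsum.tsum_le_of_sum_le hb)

lemma Continuous.memLp_torus {f : Torus d → ℝ} (hf : Continuous f) :
    MemLp f 2 (torusMeasure d) :=
  hf.memLp_of_hasCompactSupport (HasCompactSupport.of_compactSpace f)

lemma memHs_re_synth {m : ℕ} {c : Freq d → ℂ} (hc : Summable fun k => ‖c k‖) (hr : IsRealSeq c)
    {R : ℝ} (hR : SobBound m c R) :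
    MemHs m (fun x => (synth c x).re) ∧ hsNorm m (fun x => (synth c x).re) ≤ R :=
  memHs_of_sobBound (Continuous.memLp_torus (Complex.continuous_re.comp (continuous_synth hc)))
    (by rwa [← coef_re_synth hc hr] at hR)

lemma hsNormVec_le {m : ℕ} {v : Torus d → Fin d → ℝ} {R : ℝ} (hR : 0 ≤ R)
    (h : ∀ i, hsNorm m (fun x => v x i) ≤ R) : hsNormVec m v ≤ d * R := by
  rw [hsNormVec]
  refine Real.sqrt_le_iff.mpr ⟨by positivity, ?_⟩
  have h1 : ∀ i ∈ Finset.univ, hsNorm m (fun x => v x i) ^ 2 ≤ R ^ 2 := fun i _ =>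
    pow_le_pow_left₀ (Real.sqrt_nonneg _) (h i) 2
  refine (Finset.sum_le_card_nsmul _ _ _ h1).trans ?_
  simp only [Finset.card_univ, Fintype.card_fin, nsmul_eq_mul]
  rw [mul_pow]
  have : (d : ℝ) ≤ (d : ℝ) ^ 2 := by
    rcases Nat.eq_zero_or_pos d with h | h
    · simp [h]
    · have : (1 : ℝ) ≤ d := by exact_mod_cast h
      nlinarith
  gcongr

lemma hsNorm_le_hsNormVec {m : ℕ} (v : Torus d → Fin d → ℝ) (i : Fin d) :
    hsNorm m (fun x => v x i) ≤ hsNormVec m v := by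
  rw [hsNormVec]
  refine Real.le_sqrt_of_sq_le ?_
  exact Finset.single_le_sum (f := fun i => hsNorm m (fun x => v x i) ^ 2)
    (fun i _ => sq_nonneg _) (Finset.mem_univ i)

/-! ### Fourier inversion -/

/-- Completeness of the characters in `L²`. -/
lemma ae_eq_of_coef_eq {f g : Torus d → ℝ} (hf : MemLp f 2 (torusMeasure d))
    (hg : MemLp g 2 (torusMeasure d)) (h : coef f = coef g) : f =ᵐ[torusMeasure d] g := by
  have hf' : MemLp (fun x => (f x : ℂ)) 2 (torusMeasure d) := hf.ofReal
  have hg' : MemLp (fun x => (g x : ℂ)) 2 (torusMeasure d) := hg.ofReal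
  have e : hf'.toLp _ = hg'.toLp _ := by
    refine (UnitAddTorus.mFourierBasis (d := Fin d)).repr.injective ?_
    ext k
    refine (UnitAddTorus.mFourierBasis_repr (d := Fin d) (hf'.toLp _) k).trans
      (Eq.trans ?_ (UnitAddTorus.mFourierBasis_repr (d := Fin d) (hg'.toLp _) k).symm)
    have h1 : UnitAddTorus.mFourierCoeff (hf'.toLp _ : Torus d → ℂ) k = coef f k := by
      refine integral_congr_ae ?_
      filter_upwards [hf'.coeFn_toLp] with x hx
      rw [hx]
    have h2 : UnitAddTorus.mFourierCoeff (hg'.toLp _ : Torus d → ℂ) k = coef g k := by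
      refine integral_congr_ae ?_
      filter_upwards [hg'.coeFn_toLp] with x hx
      rw [hx]
    exact h1.trans ((congrFun h k).trans h2.symm)
  filter_upwards [hf'.coeFn_toLp, hg'.coeFn_toLp] with x h1 h2
  rw [e] at h1
  exact_mod_cast h1.symm.trans h2

lemma ae_eq_re_synth_coef {f : Torus d → ℝ} (hf : MemLp f 2 (torusMeasure d))
    (hs : Summable fun k => ‖coef f k‖) : f =ᵐ[torusMeasure d] fun x => (synth (coef f) x).re :=
  ae_eq_of_coef_eq hf
    (Continuous.memLp_torus (Complex.continuous_re.comp (continuous_synth hs)))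
    (coef_re_synth hs (isRealSeq_coef f)).symm

lemma eq_re_synth_coef {f : Torus d → ℝ} (hf : Continuous f)
    (hs : Summable fun k => ‖coef f k‖) (x : Torus d) : f x = (synth (coef f) x).re := by
  have hs' : Summable (UnitAddTorus.mFourierCoeff fun x => (f x : ℂ)) := Summable.of_norm hs
  have h := UnitAddTorus.hasSum_mFourier_series_apply_of_summable
    (f := ⟨fun x => (f x : ℂ), by fun_prop⟩) hs' x
  have h2 : synth (coef f) x = (f x : ℂ) := h.tsum_eq
  rw [h2, Complex.ofReal_re]

/-! ### Integration by parts -/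

/-- By translation invariance the integral of a translate of `g` is constant; differentiate it in
the translation parameter. -/
lemma integral_deriv_eq_zero {g g' : Torus d → ℂ} (hg : Continuous g) (hg' : Continuous g')
    (j : Fin d)
    (h : ∀ x, HasDerivAt (fun h : ℝ => g (x + Pi.single j (h : UnitAddCircle))) (g' x) 0) :
    ∫ x, g' x ∂torusMeasure d = 0 := by
  obtain ⟨B, hB⟩ := (isCompact_range hg'.norm).bddAbove
  have hder : ∀ (x : Torus d) (y : ℝ), HasDerivAt (fun h : ℝ => g (x + Pi.single j (h : UnitAddCircle)))
      (g' (x + Pi.single j (y : UnitAddCircle))) y := by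
    intro x y
    have h1 : HasDerivAt (fun h : ℝ => g ((x + Pi.single j (y : UnitAddCircle) : Torus d) +
        Pi.single j (h : UnitAddCircle))) (g' (x + Pi.single j (y : UnitAddCircle))) (y - y) := by
      rw [sub_self]; exact h _
    refine (h1.comp_sub_const y y).congr_of_eventuallyEq (Eventually.of_forall fun z => ?_)
    simp only [add_assoc, ← Pi.single_add, ← AddCircle.coe_add, add_sub_cancel]
  have hc : ∀ y : ℝ, Continuous fun x : Torus d => x + Pi.single j (y : UnitAddCircle) :=
    fun y => continuous_id.add continuous_const
  let F : ℝ → Torus d → ℂ := fun y x => g (x + Pi.single j (y : UnitAddCircle))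
  let F' : ℝ → Torus d → ℂ := fun y x => g' (x + Pi.single j (y : UnitAddCircle))
  have h1 := (hasDerivAt_integral_of_dominated_loc_of_deriv_le (μ := torusMeasure d) (𝕜 := ℝ)
    (F := F) (F' := F') (x₀ := 0) (s := Set.univ) (bound := fun _ => B) univ_mem
    (Eventually.of_forall fun y => (hg.comp (hc y)).aestronglyMeasurable)
    (hg.comp (hc 0)).integrable_torus (hg'.comp (hc 0)).aestronglyMeasurable
    (ae_of_all _ fun x y _ => hB ⟨_, rfl⟩) (integrable_const B)
    (ae_of_all _ fun x y _ => hder x y)).2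
  have h2 : (fun y : ℝ => ∫ x, F y x ∂torusMeasure d) =
      fun _ => ∫ x, g x ∂torusMeasure d := funext fun y => integral_add_right_eq_self g _
  rw [h2] at h1
  have h3 := h1.unique (hasDerivAt_const (0 : ℝ) _)
  simpa [F'] using h3

lemma coef_pd {f : Torus d → ℝ} (hf : IsCn 1 f) (j : Fin d) :
    coef (pd j f) = dseq j (coef f) := by
  ext k
  have hfc := hf.continuous
  have hfc' := hf.continuous_pd j
  have hi1 : Integrable (fun x => chr (-k) x * (pd j f x : ℂ)) (torusMeasure d) :=
    ((continuous_chr (-k)).mul (Complex.continuous_ofReal.comp hfc')).integrable_torus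
  have hi2 : Integrable (fun x => chr (-k) x * (f x : ℂ)) (torusMeasure d) :=
    ((continuous_chr (-k)).mul (Complex.continuous_ofReal.comp hfc)).integrable_torus
  have h := integral_deriv_eq_zero (g := fun x => chr (-k) x * (f x : ℂ))
    (g' := fun x => chr (-k) x * (pd j f x : ℂ) -
      2 * Real.pi * Complex.I * k j * (chr (-k) x * (f x : ℂ)))
    ((continuous_chr (-k)).mul (Complex.continuous_ofReal.comp hfc))
    (((continuous_chr (-k)).mul (Complex.continuous_ofReal.comp hfc')).sub
      (((continuous_chr (-k)).mul (Complex.continuous_ofReal.comp hfc)).const_mul _)) j fun x => by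
    refine ((hasDerivAt_chr (-k) x j 0).mul ((hf.hasDerivAt j x).ofReal_comp)).congr_deriv ?_
    simp only [AddCircle.coe_zero, Pi.single_zero, add_zero, Pi.neg_apply, Int.cast_neg]
    ring
  rw [integral_sub hi1 (hi2.const_mul _), integral_const_mul, sub_eq_zero] at h
  rw [coef_eq, h, dseq, coef_eq]

lemma norm_coef_le {f : Torus d → ℝ} {B : ℝ} (hB : ∀ x, |f x| ≤ B) (k : Freq d) :
    ‖coef f k‖ ≤ B := by
  rw [coef_eq]
  refine (norm_integral_le_of_norm_le_const (C := B) (ae_of_all _ fun x => ?_)).trans (by simp)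
  rw [norm_mul, norm_chr, one_mul, Complex.norm_real]
  exact hB x

/-- Each step multiplies by `1 + ∑ kⱼ²`, and a factor `kⱼ²` is absorbed by two derivatives in
direction `j`, since `(2π)² ≥ 1`. -/
lemma exists_norm_coef_le_of_smooth (m : ℕ) : ∀ {f : Torus d → ℝ}, IsCn ⊤ f →
    ∃ C : ℝ, ∀ k, jb k ^ (2 * m) * ‖coef f k‖ ≤ C := by
  induction m with
  | zero =>
    intro f hf
    obtain ⟨B, hB⟩ := (isCompact_range hf.continuous.norm).bddAbove
    exact ⟨B, fun k => by simpa using norm_coef_le (fun x => hB ⟨x, rfl⟩) k⟩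
  | succ m ih =>
    intro f hf
    obtain ⟨C, hC⟩ := ih hf
    choose C' hC' using fun j => ih ((hf.pd_top j).pd_top j)
    refine ⟨C + ∑ j, C' j, fun k => ?_⟩
    have h0 := jb_pos k
    rw [mul_add, mul_one, pow_add, mul_right_comm, mul_comm, jb_sq', add_mul, one_mul,
      modulus_sq, Finset.sum_mul]
    refine add_le_add (hC k) (Finset.sum_le_sum fun j _ => le_trans ?_ (hC' j k))
    rw [coef_pd ((hf.pd_top j).of_top 1), coef_pd (hf.of_top 1), norm_dseq, norm_dseq]
    have h1 : (1 : ℝ) ≤ (2 * Real.pi) ^ 2 := by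
      have := Real.pi_gt_three
      nlinarith
    calc (k j : ℝ) ^ 2 * (jb k ^ (2 * m) * ‖coef f k‖)
        = 1 * (|(k j : ℝ)| ^ 2 * (jb k ^ (2 * m) * ‖coef f k‖)) := by rw [sq_abs, one_mul]
      _ ≤ (2 * Real.pi) ^ 2 * (|(k j : ℝ)| ^ 2 * (jb k ^ (2 * m) * ‖coef f k‖)) := by gcongr
      _ = _ := by ring

lemma exists_sobBound_coef_of_smooth (hd : d ≤ 3) (m : ℕ) {f : Torus d → ℝ} (hf : IsCn ⊤ f) :
    ∃ R, SobBound m (coef f) R := by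
  obtain ⟨C, hC⟩ := exists_norm_coef_le_of_smooth (m + 2) hf
  have hC0 : 0 ≤ C := le_trans (by have := jb_pos (0 : Freq d); positivity) (hC 0)
  have hs := summable_inv_jb_pow hd
  have hpos : 0 ≤ ∑' k : Freq d, (jb k ^ 4)⁻¹ := tsum_nonneg fun k => by
    have := jb_pos k; positivity
  refine ⟨Real.sqrt (C ^ 2 * ∑' k : Freq d, (jb k ^ 4)⁻¹), Real.sqrt_nonneg _, fun S => ?_⟩
  rw [Real.sq_sqrt (by positivity)]
  refine le_trans ?_ (mul_le_mul_of_nonneg_left (hs.sum_le_tsum S fun k _ => ?_) (sq_nonneg C))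
  · rw [Finset.mul_sum]
    refine Finset.sum_le_sum fun k _ => ?_
    have h0 := one_le_jb k
    have h1 := jb_pos k
    rw [← div_eq_mul_inv, le_div_iff₀ (by positivity)]
    calc jb k ^ (2 * m) * ‖coef f k‖ ^ 2 * jb k ^ 4
        = (jb k ^ (m + 2) * ‖coef f k‖) ^ 2 := by ring
      _ ≤ (jb k ^ (2 * (m + 2)) * ‖coef f k‖) ^ 2 := by
          gcongr
          omega
      _ ≤ C ^ 2 := by gcongr; exact hC k
  · have := jb_pos k; positivity

/-! ### Parseval -/

lemma hasSum_integral_synth_mul_synth {f g : Freq d → ℂ} (hf : Summable fun k => ‖f k‖)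
    (hg : Summable fun k => ‖g k‖) :
    HasSum (fun k => f k * g (-k)) (∫ x, synth f x * synth g x ∂torusMeasure d) := by
  refine (hasSum_integral_synth_mul hf (continuous_synth hg).integrable_torus).congr_fun fun k => ?_
  rw [← integral_synth hg (-k), neg_neg]

lemma hasSum_integral_norm_sq {c : Freq d → ℂ} (hc : Summable fun k => ‖c k‖) (hr : IsRealSeq c) :
    HasSum (fun k => ‖c k‖ ^ 2) (∫ x, (synth c x).re ^ 2 ∂torusMeasure d) := by
  have h := hasSum_integral_synth_mul_synth hc hc
  have e1 : ∀ k, c k * c (-k) = ((‖c k‖ ^ 2 : ℝ) : ℂ) := fun k => by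
    rw [hr k, Complex.mul_conj, Complex.normSq_eq_norm_sq]
  have e2 : ∫ x, synth c x * synth c x ∂torusMeasure d =
      ((∫ x, (synth c x).re ^ 2 ∂torusMeasure d : ℝ) : ℂ) := by
    refine Eq.trans ?_ integral_ofReal
    refine integral_congr_ae (ae_of_all _ fun x => ?_)
    change synth c x * synth c x = (((synth c x).re ^ 2 : ℝ) : ℂ)
    rw [Complex.ofReal_pow, ofReal_re_synth hr, sq]
  simp only [e1, e2] at h
  exact_mod_cast h

/-! ### Convolutions of sequences that depend on time -/

lemma continuousOn_conv (hd : d ≤ 3) {I : Set ℝ} {f g : ℝ → Freq d → ℂ} {R R' : ℝ}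
    (hf : ∀ k, ContinuousOn (fun t => f t k) I) (hg : ∀ k, ContinuousOn (fun t => g t k) I)
    (hfR : ∀ t ∈ I, SobBound 2 (f t) R) (hgR : ∀ t ∈ I, SobBound 2 (g t) R') (k : Freq d) :
    ContinuousOn (fun t => conv (f t) (g t) k) I := fun t ht =>
  tendsto_conv hd (eventually_nhdsWithin_of_forall hfR) (eventually_nhdsWithin_of_forall hgR)
    (fun k => hf k t ht) (fun k => hg k t ht) k

lemma continuousOn_dseq {I : Set ℝ} {f : ℝ → Freq d → ℂ} {k : Freq d}
    (hf : ContinuousOn (fun t => f t k) I) (j : Fin d) :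
    ContinuousOn (fun t => dseq j (f t) k) I := hf.const_mul _

lemma SobBound.sum_norm_mul_le {m n : ℕ} {f g : Freq d → ℂ} {R R' : ℝ} (hf : SobBound m f R)
    (hg : SobBound n g R') (k : Freq d) (S : Finset (Freq d)) :
    ∑ l ∈ S, ‖f (k - l) * g l‖ ≤ R * R' := by
  simp only [norm_mul]
  refine sum_mul_le_of_sq_le S _ _ hf.1 hg.1 ?_ ?_
  · refine sum_sub_left_le (y := fun k => ‖f k‖ ^ 2) (fun S => ?_) S k
    simpa using (hf.of_le (Nat.zero_le m)).2 S
  · simpa using (hg.of_le (Nat.zero_le n)).2 S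

lemma hasDerivWithinAt_conv (hd : d ≤ 3) {T : ℝ} {f g f' g' : ℝ → Freq d → ℂ} {R R' R₁ R₁' : ℝ}
    (hf : ∀ k, ∀ t ∈ Set.Icc 0 T, HasDerivWithinAt (fun τ => f τ k) (f' t k) (Set.Icc 0 T) t)
    (hg : ∀ k, ∀ t ∈ Set.Icc 0 T, HasDerivWithinAt (fun τ => g τ k) (g' t k) (Set.Icc 0 T) t)
    (hf' : ∀ k, ContinuousOn (fun t => f' t k) (Set.Icc 0 T))
    (hg' : ∀ k, ContinuousOn (fun t => g' t k) (Set.Icc 0 T))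
    (hfR : ∀ t ∈ Set.Icc 0 T, SobBound 2 (f t) R) (hgR : ∀ t ∈ Set.Icc 0 T, SobBound 2 (g t) R')
    (hfR' : ∀ t ∈ Set.Icc 0 T, SobBound 2 (f' t) R₁)
    (hgR' : ∀ t ∈ Set.Icc 0 T, SobBound 2 (g' t) R₁') (k : Freq d) {t : ℝ}
    (ht : t ∈ Set.Icc 0 T) :
    HasDerivWithinAt (fun τ => conv (f τ) (g τ) k) (conv (f' t) (g t) k + conv (f t) (g' t) k)
      (Set.Icc 0 T) t := by
  have hfc : ∀ k, ContinuousOn (fun t => f t k) (Set.Icc 0 T) :=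
    fun k t ht => (hf k t ht).continuousWithinAt
  have hgc : ∀ k, ContinuousOn (fun t => g t k) (Set.Icc 0 T) :=
    fun k t ht => (hg k t ht).continuousWithinAt
  refine hasDerivWithinAt_tsum_freq (w := fun _ => 1) (c := fun τ l => f τ (k - l) * g τ l)
    (c' := fun τ l => f' τ (k - l) * g τ l + f τ (k - l) * g' τ l)
    (g := fun t => conv (f' t) (g t) k + conv (f t) (g' t) k)
    (C := R₁ * R' + R * R₁')
    (fun l t ht => (hf _ t ht).mul (hg l t ht)) (fun l => ?_) (fun t ht S => ?_) (fun t ht => ?_)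
    (fun t ht => ?_) ?_ ht
  · exact ((hf' _).mul (hgc l)).add ((hfc _).mul (hg' l))
  · simp only [mul_one]
    refine (Finset.sum_le_sum fun l _ => norm_add_le _ _).trans ?_
    rw [Finset.sum_add_distrib]
    exact add_le_add ((hfR' t ht).sum_norm_mul_le (hgR t ht) k S)
      ((hfR t ht).sum_norm_mul_le (hgR' t ht) k S)
  · simp only [mul_one]
    exact ((hfR t ht).summable_mul (hgR t ht) k).of_norm.hasSum
  · simp only [mul_one]
    exact (((hfR' t ht).summable_mul (hgR t ht) k).of_norm.hasSum).add
      (((hfR t ht).summable_mul (hgR' t ht) k).of_norm.hasSum)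
  · exact (continuousOn_conv hd hf' hgc hfR' hgR k).add (continuousOn_conv hd hfc hg' hfR hgR' k)

/-! ### The sources produced by an incompressible flow -/

/-- The coefficients of `∂ᵢaⱼ ∂ⱼaᵢ`, the Laplacian of the pressure. -/
def pressureSource (a : Fin d → Freq d → ℂ) (k : Freq d) : ℂ :=
  ∑ i, ∑ j, conv (dseq i (a j)) (dseq j (a i)) k

/-- The coefficients of the time derivative of an incompressible flow. -/
def eulerField (a : Fin d → Freq d → ℂ) (i : Fin d) (k : Freq d) : ℂ :=
  -∑ j, conv (a j) (dseq j (a i)) k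
    - Complex.I * dir k i * (pressureSource a k / (2 * Real.pi * modulus k))

/-- The time derivative of `pressureSource` along an incompressible flow. -/
def pressureSourceDot (a : Fin d → Freq d → ℂ) (k : Freq d) : ℂ :=
  ∑ i, ∑ j, (conv (dseq i (eulerField a j)) (dseq j (a i)) k
    + conv (dseq i (a j)) (dseq j (eulerField a i)) k)

/-- The source term in the equation for the electric field. -/
def fieldSource (a : Fin d → Freq d → ℂ) (k : Freq d) : ℂ :=
  pressureSourceDot a k / (2 * Real.pi * modulus k)
    + ∑ j, Complex.I * dir k j * conv (a j) (pressureSource a) k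

lemma one_le_modulus {k : Freq d} (hk : k ≠ 0) : 1 ≤ modulus k := by
  obtain ⟨i, hi⟩ := Function.ne_iff.mp hk
  refine le_trans ?_ (abs_coord_le_modulus k i)
  have := Int.one_le_abs hi
  exact_mod_cast this

lemma jb_le_two_mul_modulus {k : Freq d} (hk : k ≠ 0) : jb k ≤ 2 * modulus k := by
  have h1 := one_le_modulus hk
  have h2 := jb_sq' k
  have h3 := jb_pos k
  nlinarith

/-- Inverting `|D|` gains one derivative. At the zero frequency the quotient is `0` by convention,
so that mode is simply discarded. -/
lemma norm_div_two_pi_modulus_le (z : ℂ) (k : Freq d) :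
    jb k * ‖z / (2 * Real.pi * modulus k)‖ ≤ ‖z‖ := by
  rcases eq_or_ne k 0 with rfl | hk
  · simp [modulus_zero]
  have h1 := one_le_modulus hk
  have h2 := jb_le_two_mul_modulus hk
  have h3 := Real.pi_gt_three
  have h4 : 0 < 2 * Real.pi * modulus k := by positivity
  have e : ‖(2 * Real.pi * modulus k : ℂ)‖ = 2 * Real.pi * modulus k := by
    rw [norm_mul, norm_mul, Complex.norm_real, Complex.norm_real, Complex.norm_ofNat,
      Real.norm_of_nonneg Real.pi_pos.le, Real.norm_of_nonneg (modulus_nonneg k)]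
  rw [norm_div, e, ← mul_div_assoc, div_le_iff₀ h4, mul_comm]
  gcongr
  nlinarith

lemma norm_I_dir_mul_le (z : ℂ) (k : Freq d) (j : Fin d) : ‖Complex.I * dir k j * z‖ ≤ ‖z‖ := by
  rw [norm_mul, norm_mul, Complex.norm_I, one_mul, Complex.norm_real, Real.norm_eq_abs]
  exact mul_le_of_le_one_left (norm_nonneg _) (abs_dir_le k j)

lemma SobBound.div_modulus {m : ℕ} {f : Freq d → ℂ} {R : ℝ} (h : SobBound m f R) :
    SobBound (m + 1) (fun k => f k / (2 * Real.pi * modulus k)) R := by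
  have := h.dominated zero_le_one (n := m + 1) (g := fun k => f k / (2 * Real.pi * modulus k))
    fun k => by
      have h0 := jb_pos k
      rw [one_mul, pow_succ, mul_assoc]
      gcongr
      exact norm_div_two_pi_modulus_le _ k
  simpa using this

lemma SobBound.I_dir {m : ℕ} {f : Freq d → ℂ} {R : ℝ} (h : SobBound m f R) (j : Fin d) :
    SobBound m (fun k => Complex.I * dir k j * f k) R :=
  h.of_norm_le fun k => norm_I_dir_mul_le _ k j

/-- The bound is chosen before the flow, so one constant serves all times in an interval. -/
lemma exists_sobBound_pressureSource (hd : d ≤ 3) {m : ℕ} (hm : 2 ≤ m) (A : ℝ) :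
    ∃ B, ∀ a : Fin d → Freq d → ℂ, (∀ i, SobBound (m + 1) (a i) A) →
      SobBound m (pressureSource a) B :=
  ⟨_, fun _ ha => SobBound.sum _ fun i _ => SobBound.sum _ fun j _ =>
    SobBound.conv hd hm ((ha j).dseq i) ((ha i).dseq j)⟩

lemma exists_sobBound_eulerField (hd : d ≤ 3) {m : ℕ} (hm : 2 ≤ m) (A : ℝ) :
    ∃ B, ∀ a : Fin d → Freq d → ℂ, (∀ i, SobBound (m + 1) (a i) A) →
      ∀ i, SobBound m (eulerField a i) B := by
  obtain ⟨B, hB⟩ := exists_sobBound_pressureSource hd hm A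
  exact ⟨_, fun a ha i => ((SobBound.sum Finset.univ fun j _ => SobBound.conv hd hm
    ((ha j).of_le (Nat.le_succ m)) ((ha i).dseq j)).neg).sub
      ((((hB a ha).div_modulus).of_le (Nat.le_succ m)).I_dir i)⟩

lemma exists_sobBound_pressureSourceDot (hd : d ≤ 3) {m : ℕ} (hm : 2 ≤ m) (A : ℝ) :
    ∃ B, ∀ a : Fin d → Freq d → ℂ, (∀ i, SobBound (m + 2) (a i) A) →
      SobBound m (pressureSourceDot a) B := by
  obtain ⟨B, hB⟩ := exists_sobBound_eulerField hd (m := m + 1) (by omega) A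
  exact ⟨_, fun a ha => SobBound.sum _ fun i _ => SobBound.sum _ fun j _ =>
    (SobBound.conv hd hm ((hB a ha j).dseq i)
      (((ha i).of_le (Nat.le_succ (m + 1))).dseq j)).add
    (SobBound.conv hd hm (((ha j).of_le (Nat.le_succ (m + 1))).dseq i) ((hB a ha i).dseq j))⟩

/-- The time derivative of the pressure source costs two derivatives, and division by `|D|` returns
one. With `s = m + 1`, this is why a flow bounded in `H^(s+1)` suffices. -/
lemma exists_sobBound_fieldSource (hd : d ≤ 3) {m : ℕ} (hm : 2 ≤ m) (A : ℝ) :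
    ∃ B, ∀ a : Fin d → Freq d → ℂ, (∀ i, SobBound (m + 2) (a i) A) →
      SobBound (m + 1) (fieldSource a) B := by
  obtain ⟨B, hB⟩ := exists_sobBound_pressureSourceDot hd hm A
  obtain ⟨B', hB'⟩ := exists_sobBound_pressureSource hd (m := m + 1) (by omega) A
  exact ⟨_, fun a ha => (hB a ha).div_modulus.add (SobBound.sum _ fun j _ =>
    (SobBound.conv hd (by omega) ((ha j).of_le (Nat.le_succ (m + 1))) (hB' a ha)).I_dir j)⟩

lemma IsRealSeq.neg {f : Freq d → ℂ} (hf : IsRealSeq f) : IsRealSeq fun k => -f k := fun k => by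
  simp [hf k]

lemma IsRealSeq.sub {f g : Freq d → ℂ} (hf : IsRealSeq f) (hg : IsRealSeq g) :
    IsRealSeq fun k => f k - g k := fun k => by simp [hf k, hg k]

lemma IsRealSeq.I_dir {f : Freq d → ℂ} (hf : IsRealSeq f) (j : Fin d) :
    IsRealSeq fun k => Complex.I * dir k j * f k := fun k => by
  simp [hf k, dir_neg]

lemma IsRealSeq.div_modulus {f : Freq d → ℂ} (hf : IsRealSeq f) :
    IsRealSeq fun k => f k / (2 * Real.pi * modulus k) := fun k => by
  simp only [hf k, modulus_neg, map_div₀, map_mul, Complex.conj_ofReal, map_ofNat]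

lemma isRealSeq_pressureSource {a : Fin d → Freq d → ℂ} (ha : ∀ i, IsRealSeq (a i)) :
    IsRealSeq (pressureSource a) :=
  IsRealSeq.sum _ fun i _ => IsRealSeq.sum _ fun j _ => ((ha j).dseq i).conv ((ha i).dseq j)

lemma isRealSeq_eulerField {a : Fin d → Freq d → ℂ} (ha : ∀ i, IsRealSeq (a i)) (i : Fin d) :
    IsRealSeq (eulerField a i) :=
  (IsRealSeq.sum _ fun j _ => (ha j).conv ((ha i).dseq j)).neg.sub
    (((isRealSeq_pressureSource ha).div_modulus).I_dir i)

lemma isRealSeq_fieldSource {a : Fin d → Freq d → ℂ} (ha : ∀ i, IsRealSeq (a i)) :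
    IsRealSeq (fieldSource a) := by
  have h := isRealSeq_eulerField ha
  refine IsRealSeq.add (IsRealSeq.div_modulus ?_) (IsRealSeq.sum _ fun j _ => IsRealSeq.I_dir
    ((ha j).conv (isRealSeq_pressureSource ha)) j)
  exact IsRealSeq.sum _ fun i _ => IsRealSeq.sum _ fun j _ =>
    (((h j).dseq i).conv ((ha i).dseq j)).add (((ha j).dseq i).conv ((h i).dseq j))

/-! ### The Euler flow in Fourier variables -/

/-- The Fourier coefficients of an incompressible flow on `[0, T]`, bounded in `H^m`. -/
structure IsEulerFlow (m : ℕ) (T A : ℝ) (a : ℝ → Fin d → Freq d → ℂ) : Prop where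
  sobBound : ∀ t ∈ Set.Icc 0 T, ∀ i, SobBound m (a t i) A
  real : ∀ t ∈ Set.Icc 0 T, ∀ i, IsRealSeq (a t i)
  div_free : ∀ t ∈ Set.Icc 0 T, ∀ k, ∑ j, (k j : ℂ) * a t j k = 0
  hasDeriv : ∀ i k, ∀ t ∈ Set.Icc 0 T,
    HasDerivWithinAt (fun τ => a τ i k) (eulerField (a t) i k) (Set.Icc 0 T) t

section Flow

variable {m : ℕ} {T A : ℝ} {a : ℝ → Fin d → Freq d → ℂ}

lemma IsEulerFlow.continuousOn (h : IsEulerFlow m T A a) (i : Fin d) (k : Freq d) :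
    ContinuousOn (fun t => a t i k) (Set.Icc 0 T) :=
  fun t ht => (h.hasDeriv i k t ht).continuousWithinAt

lemma IsEulerFlow.continuousOn_pressureSource (hd : d ≤ 3) (hm : 3 ≤ m) (h : IsEulerFlow m T A a)
    (k : Freq d) : ContinuousOn (fun t => pressureSource (a t) k) (Set.Icc 0 T) :=
  continuousOn_finsetSum _ fun i _ => continuousOn_finsetSum _ fun j _ =>
    continuousOn_conv hd (fun k => continuousOn_dseq (h.continuousOn j k) i)
      (fun k => continuousOn_dseq (h.continuousOn i k) j)
      (fun t ht => ((h.sobBound t ht j).of_le hm).dseq i)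
      (fun t ht => ((h.sobBound t ht i).of_le hm).dseq j) k

lemma IsEulerFlow.continuousOn_eulerField (hd : d ≤ 3) (hm : 3 ≤ m) (h : IsEulerFlow m T A a)
    (i : Fin d) (k : Freq d) : ContinuousOn (fun t => eulerField (a t) i k) (Set.Icc 0 T) := by
  refine ContinuousOn.sub (ContinuousOn.neg (continuousOn_finsetSum _ fun j _ =>
    continuousOn_conv hd (h.continuousOn j) (fun k => continuousOn_dseq (h.continuousOn i k) j)
      (fun t ht => ((h.sobBound t ht j).of_le (by omega)))
      (fun t ht => ((h.sobBound t ht i).of_le hm).dseq j) k))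
    (ContinuousOn.const_mul ((h.continuousOn_pressureSource hd hm k).div_const _) _)

/-- The product rule. The order `4` leaves the gradient of the acceleration in `H²`, where
convolutions are controlled. -/
lemma IsEulerFlow.hasDerivWithinAt_pressureSource (hd : d ≤ 3) (hm : 4 ≤ m)
    (h : IsEulerFlow m T A a) (k : Freq d) {t : ℝ} (ht : t ∈ Set.Icc 0 T) :
    HasDerivWithinAt (fun τ => pressureSource (a τ) k) (pressureSourceDot (a t) k)
      (Set.Icc 0 T) t := by
  obtain ⟨B, hB⟩ := exists_sobBound_eulerField hd (m := 3) (by norm_num) A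
  have hB' : ∀ t ∈ Set.Icc 0 T, ∀ i, SobBound 3 (eulerField (a t) i) B := fun t ht i =>
    hB (a t) (fun i => (h.sobBound t ht i).of_le hm) i
  have h3 : ∀ t ∈ Set.Icc 0 T, ∀ i, SobBound 3 (a t i) A := fun t ht i =>
    (h.sobBound t ht i).of_le (by omega)
  refine HasDerivWithinAt.fun_sum fun i _ => HasDerivWithinAt.fun_sum fun j _ => ?_
  exact hasDerivWithinAt_conv hd
    (f' := fun t => dseq i (eulerField (a t) j)) (g' := fun t => dseq j (eulerField (a t) i))
    (fun k t ht => (h.hasDeriv j k t ht).const_mul _)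
    (fun k t ht => (h.hasDeriv i k t ht).const_mul _)
    (fun k => continuousOn_dseq (h.continuousOn_eulerField hd (by omega) j k) i)
    (fun k => continuousOn_dseq (h.continuousOn_eulerField hd (by omega) i k) j)
    (fun t ht => (h3 t ht j).dseq i) (fun t ht => (h3 t ht i).dseq j)
    (fun t ht => (hB' t ht j).dseq i) (fun t ht => (hB' t ht i).dseq j) k ht

lemma IsEulerFlow.continuousOn_fieldSource (hd : d ≤ 3) (hm : 4 ≤ m)
    (h : IsEulerFlow m T A a) (k : Freq d) :
    ContinuousOn (fun t => fieldSource (a t) k) (Set.Icc 0 T) := by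
  obtain ⟨B, hB⟩ := exists_sobBound_eulerField hd (m := 3) (by norm_num) A
  have hB' : ∀ t ∈ Set.Icc 0 T, ∀ i, SobBound 3 (eulerField (a t) i) B := fun t ht i =>
    hB (a t) (fun i => (h.sobBound t ht i).of_le hm) i
  obtain ⟨B₁, hB₁⟩ := exists_sobBound_pressureSource hd (m := 3) (by norm_num) A
  have h3 : ∀ t ∈ Set.Icc 0 T, ∀ i, SobBound 3 (a t i) A := fun t ht i =>
    (h.sobBound t ht i).of_le (by omega)
  refine ContinuousOn.add (ContinuousOn.div_const (continuousOn_finsetSum _ fun i _ =>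
    continuousOn_finsetSum _ fun j _ => ContinuousOn.add ?_ ?_) _)
    (continuousOn_finsetSum _ fun j _ => ContinuousOn.const_mul ?_ _)
  · exact continuousOn_conv hd
      (fun k => continuousOn_dseq (h.continuousOn_eulerField hd (by omega) j k) i)
      (fun k => continuousOn_dseq (h.continuousOn i k) j)
      (fun t ht => (hB' t ht j).dseq i) (fun t ht => (h3 t ht i).dseq j) k
  · exact continuousOn_conv hd (fun k => continuousOn_dseq (h.continuousOn j k) i)
      (fun k => continuousOn_dseq (h.continuousOn_eulerField hd (by omega) i k) j)
      (fun t ht => (h3 t ht j).dseq i) (fun t ht => (hB' t ht i).dseq j) k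
  · exact continuousOn_conv hd (h.continuousOn j) (h.continuousOn_pressureSource hd (by omega))
      (fun t ht => (h3 t ht j).of_le (by norm_num))
      (fun t ht => (hB₁ (a t) fun i => (h.sobBound t ht i).of_le hm).of_le (by norm_num)) k

end Flow

/-- The divergence of the transport term of a divergence-free field. -/
lemma pressureSource_eq {a : Fin d → Freq d → ℂ} {A : ℝ} (ha : ∀ i, SobBound 2 (a i) A)
    (hdiv : ∀ k, ∑ j, (k j : ℂ) * a j k = 0) (k : Freq d) :
    pressureSource a k = ∑ i, 2 * Real.pi * Complex.I * k i * ∑ j, conv (a j) (dseq j (a i)) k := by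
  have hs : ∀ i j, Summable fun l => dseq i (a j) (k - l) * dseq j (a i) l := fun i j =>
    ((((ha j).of_le (show 0 + 1 ≤ 2 by norm_num)).dseq i).summable_mul
      (((ha i).of_le (show 0 + 1 ≤ 2 by norm_num)).dseq j) k).of_norm
  have hs' : ∀ i j, Summable fun l => a j (k - l) * dseq j (a i) l := fun i j =>
    ((ha j).summable_mul (((ha i).of_le (show 0 + 1 ≤ 2 by norm_num)).dseq j) k).of_norm
  simp only [pressureSource, conv, Finset.mul_sum]
  have e1 : ∀ i j, 2 * Real.pi * Complex.I * k i * ∑' l, a j (k - l) * dseq j (a i) l =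
      ∑' l, 2 * Real.pi * Complex.I * k i * (a j (k - l) * dseq j (a i) l) := fun i j =>
    tsum_mul_left.symm
  simp only [e1]
  refine Finset.sum_comm.trans (Eq.trans ?_ Finset.sum_comm)
  refine Finset.sum_congr rfl fun j _ => ?_
  rw [← Summable.tsum_finsetSum fun i _ => hs i j,
    ← Summable.tsum_finsetSum fun i _ => (hs' i j).mul_left _]
  refine tsum_congr fun l => ?_
  rw [← sub_eq_zero, ← Finset.sum_sub_distrib]
  -- The symbols `k - l` and `k` differ by `l`; summed over `i`, this factor meets `a i l` and gives
  -- the divergence of `a`.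
  have e2 : ∀ i, dseq i (a j) (k - l) * dseq j (a i) l -
      2 * Real.pi * Complex.I * k i * (a j (k - l) * dseq j (a i) l) =
      -((2 * Real.pi * Complex.I) ^ 2 * a j (k - l) * l j * (l i * a i l)) := by
    intro i
    simp only [dseq, Pi.sub_apply, Int.cast_sub]
    ring
  simp only [e2, Finset.sum_neg_distrib, ← Finset.mul_sum, hdiv l, mul_zero, neg_zero]

/-- Differentiation under the integral sign, up to the end points of the time interval. -/
lemma hasDerivWithinAt_integral {F F' : ℝ → Torus d → ℂ} {T B : ℝ}
    (hF : ∀ t ∈ Set.Icc 0 T, Continuous (F t))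
    (hF' : ∀ t ∈ Set.Icc 0 T, ∀ x, HasDerivWithinAt (fun τ => F τ x) (F' t x) (Set.Icc 0 T) t)
    (hB : ∀ t ∈ Set.Icc 0 T, ∀ x, ‖F' t x‖ ≤ B) {t : ℝ} (ht : t ∈ Set.Icc 0 T) :
    HasDerivWithinAt (fun τ => ∫ x, F τ x ∂torusMeasure d) (∫ x, F' t x ∂torusMeasure d)
      (Set.Icc 0 T) t := by
  rw [hasDerivWithinAt_iff_tendsto_slope]
  have hmem : ∀ᶠ τ in 𝓝[Set.Icc 0 T \ {t}] t, τ ∈ Set.Icc 0 T ∧ τ ≠ t :=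
    eventually_nhdsWithin_of_forall fun τ hτ => hτ
  have h : Tendsto (fun τ => ∫ x, slope (fun τ => F τ x) t τ ∂torusMeasure d)
      (𝓝[Set.Icc 0 T \ {t}] t) (𝓝 (∫ x, F' t x ∂torusMeasure d)) := by
    refine tendsto_integral_filter_of_dominated_convergence (fun _ => B) ?_ ?_
      (integrable_const B) ?_
    · filter_upwards [hmem] with τ hτ
      simp only [slope_def_module]
      exact (((hF τ hτ.1).sub (hF t ht)).const_smul _).aestronglyMeasurable
    · filter_upwards [hmem] with τ hτ
      refine ae_of_all _ fun x => ?_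
      have h1 := (convex_Icc 0 T).norm_image_sub_le_of_norm_hasDerivWithin_le
        (fun y hy => hF' y hy x) (fun y hy => hB y hy x) ht hτ.1
      rw [slope_def_module, norm_smul, norm_inv]
      have h2 : 0 < ‖τ - t‖ := norm_pos_iff.mpr (sub_ne_zero.mpr hτ.2)
      rw [inv_mul_le_iff₀ h2, mul_comm]
      exact h1
    · exact ae_of_all _ fun x => hasDerivWithinAt_iff_tendsto_slope.mp (hF' t ht x)
  refine h.congr' ?_
  filter_upwards [hmem] with τ hτ
  simp only [slope_def_module]
  rw [integral_smul, integral_sub (hF τ hτ.1).integrable_torus (hF t ht).integrable_torus]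

lemma coef_neg_add {f g : Torus d → ℝ} (hf : Continuous f) (hg : Continuous g) (k : Freq d) :
    coef (fun x => -f x + g x) k = -coef f k + coef g k := by
  have hi : ∀ {f : Torus d → ℝ}, Continuous f →
      Integrable (fun x => chr (-k) x * (f x : ℂ)) (torusMeasure d) := fun hf =>
    ((continuous_chr (-k)).mul (Complex.continuous_ofReal.comp hf)).integrable_torus
  rw [coef_eq, coef_eq, coef_eq, ← integral_neg,
    ← integral_add (f := fun x => -(chr (-k) x * (f x : ℂ))) (hi hf).neg (hi hg)]
  refine integral_congr_ae (ae_of_all _ fun x => ?_)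
  push_cast
  ring

lemma re_synth_mul {f g : Freq d → ℂ} (hf : Summable fun k => ‖f k‖)
    (hg : Summable fun k => ‖g k‖) (hfr : IsRealSeq f) (hgr : IsRealSeq g) (x : Torus d) :
    (synth f x).re * (synth g x).re = (synth (conv f g) x).re := by
  rw [← synth_mul hf hg, ← ofReal_re_synth hfr, ← ofReal_re_synth hgr, ← Complex.ofReal_mul,
    Complex.ofReal_re, Complex.ofReal_re, Complex.ofReal_re]

lemma re_synth_sum {ι : Type*} (S : Finset ι) {c : ι → Freq d → ℂ}
    (hc : ∀ i, Summable fun k => ‖c i k‖) (x : Torus d) :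
    (synth (fun k => ∑ i ∈ S, c i k) x).re = ∑ i ∈ S, (synth (c i) x).re := by
  rw [synth_sum S hc, Complex.re_sum]

/-- The convection term of a field given by its Fourier coefficients. -/
lemma convection_re_synth (hd : d ≤ 3) {b : Fin d → Freq d → ℂ} {R : ℝ}
    (hb : ∀ i, SobBound 3 (b i) R) (hr : ∀ i, IsRealSeq (b i)) (i : Fin d) (x : Torus d) :
    convection (fun x i => (synth (b i) x).re) i x =
      (synth (fun k => ∑ j, conv (b j) (dseq j (b i)) k) x).re := by
  have h1 : ∀ i, Summable fun k => jb k * ‖b i k‖ := fun i => by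
    simpa using (hb i).summable_weighted_norm hd (n := 1) le_rfl
  have h2 : ∀ i, Summable fun k => ‖b i k‖ := fun i => (hb i).summable_norm hd (by norm_num)
  have h3 : ∀ i j, Summable fun k => ‖dseq j (b i) k‖ := fun i j =>
    ((hb i).dseq j).summable_norm hd le_rfl
  have h4 : ∀ j, Summable fun k => ‖conv (b j) (dseq j (b i)) k‖ := fun j =>
    (SobBound.conv hd le_rfl ((hb j).of_le (by norm_num)) ((hb i).dseq j)).summable_norm hd le_rfl
  rw [re_synth_sum _ h4, convection]
  refine Finset.sum_congr rfl fun j _ => ?_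
  rw [pd_re_synth (h1 i) j, re_synth_mul (h2 j) (h3 i j) (hr j) ((hr i).dseq j)]

/-- The coefficients of the momentum equation still contain the pressure. The divergence constraint
determines all nonzero pressure modes, and the zero mode has no gradient. -/
lemma IsEulerSolution.isEulerFlow (hd : d ≤ 3) {T : EReal} {v₀ : Torus d → Fin d → ℝ}
    {v : ℝ → Torus d → Fin d → ℝ} {p : ℝ → Torus d → ℝ} (hE : IsEulerSolution T v₀ v p)
    {m : ℕ} (hm : 3 ≤ m) {T₁ A : ℝ} (hT₁ : 0 < T₁) (hT : (T₁ : EReal) ≤ T)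
    (hA : ∀ t ∈ Set.Icc 0 T₁, ∀ i, SobBound m (coef fun x => v t x i) A) :
    IsEulerFlow m T₁ A fun t i => coef fun x => v t x i := by
  have hsub : Set.Icc 0 T₁ ⊆ timeInterval T := fun t ht =>
    ⟨ht.1, (EReal.coe_le_coe_iff.mpr ht.2).trans hT⟩
  set c : ℝ → Fin d → Freq d → ℂ := fun t i => coef fun x => v t x i with hc
  have hA3 : ∀ t ∈ Set.Icc 0 T₁, ∀ i, SobBound 3 (c t i) A := fun t ht i => (hA t ht i).of_le hm
  have hreal : ∀ t i, IsRealSeq (c t i) := fun t i => isRealSeq_coef _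
  have hC1 : ∀ t ∈ Set.Icc 0 T₁, ∀ i, IsCn 1 fun x => v t x i := fun t ht i =>
    (hE.velocity_regular i).2.1 t (hsub ht)
  have hrep : ∀ t ∈ Set.Icc 0 T₁, v t = fun x i => (synth (c t i) x).re := fun t ht => by
    funext x i
    exact eq_re_synth_coef (hC1 t ht i).continuous
      ((hA3 t ht i).summable_norm hd (by norm_num)) x
  have hconvcont : ∀ i, ContinuousOn (fun q : ℝ × Torus d => convection (v q.1) i q.2)
      (Set.Icc 0 T₁ ×ˢ Set.univ) := fun i =>
    (continuousOn_finsetSum _ fun j _ => (hE.velocity_regular j).1.mul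
      ((hE.velocity_regular i).2.2 j)).mono (Set.prod_mono hsub subset_rfl)
  have hslice : ∀ t ∈ Set.Icc 0 T₁, ∀ {f : ℝ × Torus d → ℝ},
      ContinuousOn f (Set.Icc 0 T₁ ×ˢ Set.univ) → Continuous fun x => f (t, x) :=
    fun t ht f hf => by
      rw [← continuousOn_univ]
      exact hf.comp (f := fun x => (t, x)) (by fun_prop) fun x _ => ⟨ht, trivial⟩
  have hpcont : ∀ i, ContinuousOn (fun q : ℝ × Torus d => pd i (p q.1) q.2)
      (Set.Icc 0 T₁ ×ˢ Set.univ) := fun i =>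
    (hE.pressure_gradient i).mono (Set.prod_mono hsub subset_rfl)
  have hN : ∀ t ∈ Set.Icc 0 T₁, ∀ i, coef (convection (v t) i) =
      fun k => ∑ j, conv (c t j) (dseq j (c t i)) k := by
    intro t ht i
    have e : convection (v t) i = fun x =>
        (synth (fun k => ∑ j, conv (c t j) (dseq j (c t i)) k) x).re := by
      funext x
      rw [hrep t ht]
      exact convection_re_synth hd (hA3 t ht) (hreal t) i x
    rw [e]
    refine coef_re_synth ?_ (IsRealSeq.sum _ fun j _ => (hreal t j).conv ((hreal t i).dseq j))
    exact (SobBound.sum _ fun j _ => SobBound.conv hd le_rfl ((hA3 t ht j).of_le (by norm_num))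
      ((hA3 t ht i).dseq j)).summable_norm hd le_rfl
  have hder : ∀ i k, ∀ t ∈ Set.Icc 0 T₁, HasDerivWithinAt (fun τ => c τ i k)
      (-∑ j, conv (c t j) (dseq j (c t i)) k + dseq i (coef (p t)) k) (Set.Icc 0 T₁) t := by
    intro i k t ht
    obtain ⟨B, hB⟩ := (isCompact_Icc.prod isCompact_univ).exists_bound_of_continuousOn
      ((hconvcont i).neg.add (hpcont i))
    have h := hasDerivWithinAt_integral (T := T₁) (B := B)
      (F := fun t x => chr (-k) x * (v t x i : ℂ))
      (F' := fun t x => chr (-k) x * ((-convection (v t) i x + pd i (p t) x : ℝ) : ℂ))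
      (fun t ht => (continuous_chr _).mul
        (Complex.continuous_ofReal.comp (hC1 t ht i).continuous))
      (fun t ht x => (((hE.momentum t (hsub ht) x i).mono hsub).ofReal_comp).const_mul _)
      (fun t ht x => by
        rw [norm_mul, norm_chr, one_mul, Complex.norm_real]
        exact hB (t, x) ⟨ht, trivial⟩) ht
    refine h.congr_deriv ?_
    have h2 := coef_neg_add (hslice t ht (hconvcont i)) (hslice t ht (hpcont i)) k
    rw [coef_eq] at h2
    rw [h2, hN t ht i, coef_pd (hE.pressure_regular t (hsub ht))]
  have hdiv : ∀ t ∈ Set.Icc 0 T₁, ∀ k, ∑ j, (k j : ℂ) * c t j k = 0 := by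
    intro t ht k
    have h1 : ∀ j, coef (pd j fun x => v t x j) k = dseq j (c t j) k := fun j => by
      rw [coef_pd (hC1 t ht j)]
    have h2 : ∑ j, coef (pd j fun x => v t x j) k = 0 := by
      have hInt : ∀ j, Integrable (fun x => chr (-k) x * (pd j (fun x => v t x j) x : ℂ))
          (torusMeasure d) := fun j => ((continuous_chr (-k)).mul
        (Complex.continuous_ofReal.comp ((hC1 t ht j).continuous_pd j))).integrable_torus
      simp only [coef_eq]
      rw [← integral_finsetSum _ fun j _ => hInt j]
      simp only [← Finset.mul_sum, ← Complex.ofReal_sum]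
      have h3 : ∀ x, ∑ j, pd j (fun x => v t x j) x = 0 := hE.incompressible t (hsub ht)
      simp [h3]
    simp only [h1, dseq, mul_assoc, ← Finset.mul_sum] at h2
    have h4 : (2 * (Real.pi * Complex.I) : ℂ) ≠ 0 := by
      simp [Real.pi_ne_zero]
    have h5 : (2 * (Real.pi * Complex.I) : ℂ) * ∑ j, (k j : ℂ) * c t j k = 0 := by
      rw [← h2]; ring
    exact (mul_eq_zero.mp h5).resolve_left h4
  refine ⟨hA, fun t _ i => hreal t i, hdiv, fun i k t ht => (hder i k t ht).congr_deriv ?_⟩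
  -- The constraint is differentiated in time. Uniqueness of one-sided derivatives needs an interval
  -- of positive length, hence `0 < T₁`.
  have hproj : ∑ i, (k i : ℂ) *
      (-∑ j, conv (c t j) (dseq j (c t i)) k + dseq i (coef (p t)) k) = 0 := by
    have h1 : HasDerivWithinAt (fun τ => ∑ i, (k i : ℂ) * c τ i k) (∑ i, (k i : ℂ) *
        (-∑ j, conv (c t j) (dseq j (c t i)) k + dseq i (coef (p t)) k)) (Set.Icc 0 T₁) t :=
      HasDerivWithinAt.fun_sum fun i _ => (hder i k t ht).const_mul _
    have h2 : HasDerivWithinAt (fun τ => ∑ i, (k i : ℂ) * c τ i k) 0 (Set.Icc 0 T₁) t :=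
      (hasDerivWithinAt_const t _ (0 : ℂ)).congr (fun τ hτ => hdiv τ hτ k) (hdiv t ht k)
    exact ((uniqueDiffOn_Icc hT₁) t ht).eq_deriv _ h1 h2
  have hq := pressureSource_eq (fun i => (hA3 t ht i).of_le (by norm_num)) (hdiv t ht) k
  have hsq : ((modulus k : ℝ) : ℂ) ^ 2 = ∑ i, (k i : ℂ) ^ 2 := by
    rw [← Complex.ofReal_pow, modulus_sq]
    push_cast
    rfl
  have hq2 : pressureSource (c t) k =
      (2 * Real.pi * Complex.I) ^ 2 * (modulus k : ℂ) ^ 2 * coef (p t) k := by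
    rw [hq, hsq, Finset.mul_sum, Finset.sum_mul, ← sub_eq_zero, ← Finset.sum_sub_distrib,
      ← neg_eq_zero, ← mul_zero (2 * Real.pi * Complex.I : ℂ), ← hproj, Finset.mul_sum,
      ← Finset.sum_neg_distrib]
    refine Finset.sum_congr rfl fun i _ => ?_
    simp only [dseq]
    ring
  rw [eulerField, sub_eq_add_neg]
  congr 1
  rw [hq2, dseq]
  rcases eq_or_ne k 0 with rfl | hk
  · simp [dir]
  have hk' : ((modulus k : ℝ) : ℂ) ≠ 0 := by exact_mod_cast (modulus_pos hk).ne'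
  have hπ : ((Real.pi : ℝ) : ℂ) ≠ 0 := by exact_mod_cast Real.pi_ne_zero
  rw [dir]
  push_cast
  field_simp
  linear_combination (k i : ℂ) * coef (p t) k * Complex.I_sq

/-! ### The Euler–Poisson system in Fourier variables -/

/-- The coefficients of the time derivative of the velocity in the Euler–Poisson system. -/
def epVelocity (ε : ℝ) (b : Fin d → Freq d → ℂ) (g : Freq d → ℂ) (i : Fin d) (k : Freq d) : ℂ :=
  -∑ j, conv (b j) (dseq j (b i)) k
    - Complex.I * dir k i * ((((ε ^ 2)⁻¹ : ℝ) : ℂ) * (g k / (2 * Real.pi * modulus k)))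

/-- The coefficients of the time derivative of the density in the Euler–Poisson system. -/
def epDensity (b : Fin d → Freq d → ℂ) (g : Freq d → ℂ) (k : Freq d) : ℂ :=
  -∑ j, dseq j (conv (b j) g) k

/-- The coefficients of the electric potential. -/
def epPotential (ε : ℝ) (g : Freq d → ℂ) (k : Freq d) : ℂ :=
  ((-ε⁻¹ : ℝ) : ℂ) * (g k / (2 * Real.pi * modulus k) / (2 * Real.pi * modulus k))

/-- The Fourier coefficients `(b, g)` of a solution `(v, ρ)` of the Euler–Poisson system. -/
structure IsEPFlow (ε T R : ℝ) (b : ℝ → Fin d → Freq d → ℂ) (g : ℝ → Freq d → ℂ) : Prop where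
  sobBound_velocity : ∀ t ∈ Set.Icc 0 T, ∀ i, SobBound 3 (b t i) R
  sobBound_density : ∀ t ∈ Set.Icc 0 T, SobBound 2 (g t) R
  real_velocity : ∀ t ∈ Set.Icc 0 T, ∀ i, IsRealSeq (b t i)
  real_density : ∀ t ∈ Set.Icc 0 T, IsRealSeq (g t)
  mass : ∀ t ∈ Set.Icc 0 T, g t 0 = 1
  hasDeriv_velocity : ∀ i k, ∀ t ∈ Set.Icc 0 T,
    HasDerivWithinAt (fun τ => b τ i k) (epVelocity ε (b t) (g t) i k) (Set.Icc 0 T) t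
  hasDeriv_density : ∀ k, ∀ t ∈ Set.Icc 0 T,
    HasDerivWithinAt (fun τ => g τ k) (epDensity (b t) (g t) k) (Set.Icc 0 T) t

namespace IsEPFlow

variable {ε T R : ℝ} {b : ℝ → Fin d → Freq d → ℂ} {g : ℝ → Freq d → ℂ}

lemma continuousOn_velocity (h : IsEPFlow ε T R b g) (i : Fin d) (k : Freq d) :
    ContinuousOn (fun t => b t i k) (Set.Icc 0 T) :=
  fun t ht => (h.hasDeriv_velocity i k t ht).continuousWithinAt

lemma continuousOn_density (h : IsEPFlow ε T R b g) (k : Freq d) :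
    ContinuousOn (fun t => g t k) (Set.Icc 0 T) :=
  fun t ht => (h.hasDeriv_density k t ht).continuousWithinAt

lemma summable_velocity (h : IsEPFlow ε T R b g) (hd : d ≤ 3) {t : ℝ} (ht : t ∈ Set.Icc 0 T)
    (i : Fin d) : Summable fun k => ‖b t i k‖ :=
  (h.sobBound_velocity t ht i).summable_norm hd (by norm_num)

lemma summable_velocity_jb (h : IsEPFlow ε T R b g) (hd : d ≤ 3) {t : ℝ} (ht : t ∈ Set.Icc 0 T)
    (i : Fin d) : Summable fun k => jb k * ‖b t i k‖ := by
  simpa using (h.sobBound_velocity t ht i).summable_weighted_norm hd (n := 1) le_rfl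

lemma summable_density (h : IsEPFlow ε T R b g) (hd : d ≤ 3) {t : ℝ} (ht : t ∈ Set.Icc 0 T) :
    Summable fun k => ‖g t k‖ :=
  (h.sobBound_density t ht).summable_norm hd le_rfl

lemma contC1_velocity (h : IsEPFlow ε T R b g) (hd : d ≤ 3) (i : Fin d) :
    ContC1 (Set.Icc 0 T) fun t x => (synth (b t i) x).re := by
  refine ⟨continuousOn_re_synth hd (h.continuousOn_velocity i)
    (fun t ht => (h.sobBound_velocity t ht i).of_le (by norm_num)), fun t ht => ?_, fun j => ?_⟩
  · exact isCn_re_synth (n := 1) (by simpa using h.summable_velocity_jb hd ht i)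
  · refine (continuousOn_re_synth hd (c := fun t => dseq j (b t i))
      (fun k => continuousOn_dseq (h.continuousOn_velocity i k) j)
      (fun t ht => (h.sobBound_velocity t ht i).dseq j)).congr fun q hq => ?_
    rw [pd_re_synth (h.summable_velocity_jb hd hq.1 i) j]

lemma density_mass (h : IsEPFlow ε T R b g) (hd : d ≤ 3) {t : ℝ} (ht : t ∈ Set.Icc 0 T) :
    ∫ x, (synth (g t) x).re ∂torusMeasure d = 1 := by
  have h1 := integral_synth (h.summable_density hd ht) 0
  rw [h.mass t ht] at h1
  simp only [neg_zero, chr_zero, one_mul] at h1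
  have h2 := integral_re (𝕜 := ℂ) (continuous_synth (h.summable_density hd ht)).integrable_torus
  rw [h1] at h2
  simpa using h2

lemma sobBound_flux (h : IsEPFlow ε T R b g) (hd : d ≤ 3) {t : ℝ} (ht : t ∈ Set.Icc 0 T)
    (j : Fin d) : SobBound 2 (conv (b t j) (g t)) (2 ^ (2 + 1) * embConst d * (R * R)) :=
  SobBound.conv hd le_rfl ((h.sobBound_velocity t ht j).of_le (by norm_num))
    (h.sobBound_density t ht)

lemma continuousOn_flux (h : IsEPFlow ε T R b g) (hd : d ≤ 3) (j : Fin d) (k : Freq d) :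
    ContinuousOn (fun t => conv (b t j) (g t) k) (Set.Icc 0 T) :=
  continuousOn_conv hd (h.continuousOn_velocity j) h.continuousOn_density
    (fun t ht => (h.sobBound_velocity t ht j).of_le (by norm_num)) h.sobBound_density k

/-- The flux is controlled in `H²` only, so its divergence need not be continuous; conservation of
mass is therefore tested against smooth functions. -/
lemma sobBound_epDensity (h : IsEPFlow ε T R b g) (hd : d ≤ 3) {t : ℝ} (ht : t ∈ Set.Icc 0 T) :
    SobBound 1 (epDensity (b t) (g t))
      (∑ _j : Fin d, 2 * Real.pi * (2 ^ (2 + 1) * embConst d * (R * R))) :=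
  (SobBound.sum _ fun j _ => (h.sobBound_flux hd ht j).dseq j).neg

lemma continuousOn_epDensity (h : IsEPFlow ε T R b g) (hd : d ≤ 3) (k : Freq d) :
    ContinuousOn (fun t => epDensity (b t) (g t) k) (Set.Icc 0 T) :=
  (continuousOn_finsetSum _ fun j _ => continuousOn_dseq (h.continuousOn_flux hd j k) j).neg

/-- The conservation of mass in the sense of distributions. -/
lemma mass_conservation (h : IsEPFlow ε T R b g) (hd : d ≤ 3) {ψ : Torus d → ℝ} (hψ : IsCn ⊤ ψ)
    {t : ℝ} (ht : t ∈ Set.Icc 0 T) :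
    HasDerivWithinAt (fun τ => ∫ x, (synth (g τ) x).re * ψ x ∂torusMeasure d)
      (∫ x, (synth (g t) x).re * ∑ i, (synth (b t i) x).re * pd i ψ x ∂torusMeasure d)
      (Set.Icc 0 T) t := by
  obtain ⟨B, hB⟩ := exists_sobBound_coef_of_smooth hd 3 hψ
  have hψs : Summable fun k => ‖coef ψ k‖ := hB.summable_norm hd (by norm_num)
  have hψs' : Summable fun k => jb k * ‖coef ψ k‖ := by
    simpa using hB.summable_weighted_norm hd (n := 1) le_rfl
  have hψr := isRealSeq_coef ψ
  have hψe : ψ = fun x => (synth (coef ψ) x).re :=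
    funext fun x => eq_re_synth_coef hψ.continuous hψs x
  have hpd : ∀ j, pd j ψ = fun x => (synth (dseq j (coef ψ)) x).re := fun j => by
    rw [← pd_re_synth hψs' j, ← hψe]
  have e1 : ∀ t ∈ Set.Icc 0 T, ((∫ x, (synth (g t) x).re * ψ x ∂torusMeasure d : ℝ) : ℂ) =
      ∫ x, synth (g t) x * synth (coef ψ) x ∂torusMeasure d := by
    intro t ht
    refine Eq.trans integral_ofReal.symm (integral_congr_ae (ae_of_all _ fun x => ?_))
    change (((synth (g t) x).re * ψ x : ℝ) : ℂ) = _
    have hx : (ψ x : ℂ) = synth (coef ψ) x :=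
      (congrArg Complex.ofReal (congrFun hψe x)).trans (ofReal_re_synth hψr x)
    rw [Complex.ofReal_mul, hx, ofReal_re_synth (h.real_density t ht)]
  have e2 : ∀ t ∈ Set.Icc 0 T,
      ((∫ x, (synth (g t) x).re * ∑ i, (synth (b t i) x).re * pd i ψ x ∂torusMeasure d : ℝ) : ℂ) =
      ∑ i, ∫ x, synth (conv (b t i) (g t)) x * synth (dseq i (coef ψ)) x ∂torusMeasure d := by
    intro t ht
    rw [← integral_finsetSum _ fun i _ => ((continuous_synth
      ((h.sobBound_flux hd ht i).summable_norm hd le_rfl)).fun_mul (continuous_synth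
      ((hB.dseq i).summable_norm hd le_rfl))).integrable_torus]
    refine Eq.trans integral_ofReal.symm (integral_congr_ae (ae_of_all _ fun x => ?_))
    change (((synth (g t) x).re * ∑ i, (synth (b t i) x).re * pd i ψ x : ℝ) : ℂ) = _
    simp only [hpd]
    push_cast
    rw [Finset.mul_sum]
    refine Finset.sum_congr rfl fun i _ => ?_
    rw [← synth_mul (h.summable_velocity hd ht i) (h.summable_density hd ht),
      ofReal_re_synth (h.real_density t ht), ofReal_re_synth (h.real_velocity t ht i),
      ofReal_re_synth (hψr.dseq i)]
    ring
  have hsum : ∀ t ∈ Set.Icc 0 T, HasSum (fun k => epDensity (b t) (g t) k * coef ψ (-k))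
      ((∫ x, (synth (g t) x).re * ∑ i, (synth (b t i) x).re * pd i ψ x
        ∂torusMeasure d : ℝ) : ℂ) := by
    intro t ht
    rw [e2 t ht]
    refine (hasSum_sum fun i _ => hasSum_integral_synth_mul_synth
      ((h.sobBound_flux hd ht i).summable_norm hd le_rfl)
      ((hB.dseq i).summable_norm hd le_rfl)).congr_fun fun k => ?_
    rw [epDensity, neg_mul, Finset.sum_mul, ← Finset.sum_neg_distrib]
    refine Finset.sum_congr rfl fun i _ => ?_
    simp only [dseq, Pi.neg_apply, Int.cast_neg]
    ring
  have hneg : Summable fun k => ‖coef ψ (-k)‖ := hψs.comp_injective neg_injective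
  have hD : HasDerivWithinAt
      (fun τ => ((∫ x, (synth (g τ) x).re * ψ x ∂torusMeasure d : ℝ) : ℂ))
      ((∫ x, (synth (g t) x).re * ∑ i, (synth (b t i) x).re * pd i ψ x ∂torusMeasure d : ℝ) : ℂ)
      (Set.Icc 0 T) t := by
    -- Parseval turns the pairing with `ψ` into a sum over frequencies, weighted by the absolutely
    -- summable coefficients of `ψ` at opposite frequencies.
    refine hasDerivWithinAt_tsum_freq (c := g) (c' := fun t => epDensity (b t) (g t))
      (C := B * (∑ _j : Fin d, 2 * Real.pi * (2 ^ (2 + 1) * embConst d * (R * R))))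
      (w := fun k => coef ψ (-k)) (g := fun t =>
      ((∫ x, (synth (g t) x).re * ∑ i, (synth (b t i) x).re * pd i ψ x ∂torusMeasure d : ℝ) : ℂ))
      h.hasDeriv_density (h.continuousOn_epDensity hd)
      (fun t ht S => ?_) (fun t ht => ?_) hsum ?_ ht
    · refine le_trans (le_of_eq ?_) (hB.sum_norm_mul_le (h.sobBound_epDensity hd ht) 0 S)
      simp only [zero_sub, mul_comm]
    · rw [e1 t ht]
      exact hasSum_integral_synth_mul_synth (h.summable_density hd ht) hψs
    · have hc := continuousOn_tsum (s := Set.Icc 0 T)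
        (f := fun k t => epDensity (b t) (g t) k * coef ψ (-k))
        (fun k => (h.continuousOn_epDensity hd k).mul_const _)
        (hneg.mul_left (∑ _j : Fin d, 2 * Real.pi * (2 ^ (2 + 1) * embConst d * (R * R))))
        (fun k t ht => by
          rw [norm_mul]
          gcongr
          exact (h.sobBound_epDensity hd ht).norm_le k)
      exact hc.congr fun t ht => (hsum t ht).tsum_eq.symm
  have := Complex.reCLM.hasFDerivAt.comp_hasDerivWithinAt t hD
  exact this

lemma sobBound_potential {g : Freq d → ℂ} {R : ℝ} (hg : SobBound 2 g R) :
    SobBound 4 (epPotential ε g) (‖((-ε⁻¹ : ℝ) : ℂ)‖ * R) :=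
  (hg.div_modulus.div_modulus).smul _

lemma exists_sobBound_epVelocity (h : IsEPFlow ε T R b g) (hd : d ≤ 3) (i : Fin d) :
    ∃ B, ∀ t ∈ Set.Icc 0 T, SobBound 2 (epVelocity ε (b t) (g t) i) B :=
  ⟨_, fun t ht => ((SobBound.sum Finset.univ fun j _ => SobBound.conv hd le_rfl
    ((h.sobBound_velocity t ht j).of_le (by norm_num))
      ((h.sobBound_velocity t ht i).dseq j)).neg).sub
    ((((h.sobBound_density t ht).div_modulus.of_le (Nat.le_succ 2)).smul _).I_dir i)⟩

lemma continuousOn_epVelocity (h : IsEPFlow ε T R b g) (hd : d ≤ 3) (i : Fin d) (k : Freq d) :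
    ContinuousOn (fun t => epVelocity ε (b t) (g t) i k) (Set.Icc 0 T) := by
  refine ContinuousOn.sub (ContinuousOn.neg (continuousOn_finsetSum _ fun j _ =>
    continuousOn_conv hd (h.continuousOn_velocity j)
      (fun k => continuousOn_dseq (h.continuousOn_velocity i k) j)
      (fun t ht => ((h.sobBound_velocity t ht j).of_le (by norm_num)))
      (fun t ht => (h.sobBound_velocity t ht i).dseq j) k)) ?_
  exact (((h.continuousOn_density k).div_const _).const_mul _).const_mul _

lemma dseq_epPotential (hε : ε ≠ 0) (g : Freq d → ℂ) (i : Fin d) (k : Freq d) :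
    dseq i (epPotential ε g) k = -(ε : ℂ) *
      (Complex.I * dir k i * ((((ε ^ 2)⁻¹ : ℝ) : ℂ) * (g k / (2 * Real.pi * modulus k)))) := by
  rcases eq_or_ne k 0 with rfl | hk
  · simp [dseq, dir]
  have hk' : ((modulus k : ℝ) : ℂ) ≠ 0 := by exact_mod_cast (modulus_pos hk).ne'
  have hπ : ((Real.pi : ℝ) : ℂ) ≠ 0 := by exact_mod_cast Real.pi_ne_zero
  have hε' : (ε : ℂ) ≠ 0 := by exact_mod_cast hε
  simp only [dseq, epPotential, dir]
  push_cast
  field_simp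

/-- The momentum and Poisson equations. -/
lemma momentum_poisson (h : IsEPFlow ε T R b g) (hd : d ≤ 3) (hε : ε ≠ 0) :
    ∃ φ : ℝ → Torus d → ℝ, (∀ t ∈ Set.Icc 0 T, IsCn 2 (φ t)) ∧
      (∀ i, ContinuousOn (fun q : ℝ × Torus d => pd i (φ q.1) q.2) (Set.Icc 0 T ×ˢ Set.univ)) ∧
      (∀ t ∈ Set.Icc 0 T, ∀ x i, HasDerivWithinAt (fun τ => (synth (b τ i) x).re)
        (-convection (fun x i => (synth (b t i) x).re) i x + pd i (φ t) x / ε) (Set.Icc 0 T) t) ∧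
      ∀ t ∈ Set.Icc 0 T, ∀ x, ε * laplacian (φ t) x = (synth (g t) x).re - 1 := by
  have hP : ∀ t ∈ Set.Icc 0 T, SobBound 4 (epPotential ε (g t)) (‖((-ε⁻¹ : ℝ) : ℂ)‖ * R) :=
    fun t ht => sobBound_potential (h.sobBound_density t ht)
  have hP1 : ∀ t ∈ Set.Icc 0 T, Summable fun k => jb k * ‖epPotential ε (g t) k‖ :=
    fun t ht => by simpa using (hP t ht).summable_weighted_norm hd (n := 1) (by norm_num)
  have hPd : ∀ t ∈ Set.Icc 0 T, ∀ i, SobBound 3 (dseq i (epPotential ε (g t)))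
      (2 * Real.pi * (‖((-ε⁻¹ : ℝ) : ℂ)‖ * R)) := fun t ht i => (hP t ht).dseq i
  have hPdd : ∀ t ∈ Set.Icc 0 T, ∀ i, SobBound 2 (dseq i (dseq i (epPotential ε (g t))))
      (2 * Real.pi * (2 * Real.pi * (‖((-ε⁻¹ : ℝ) : ℂ)‖ * R))) := fun t ht i => (hPd t ht i).dseq i
  have hpd : ∀ t ∈ Set.Icc 0 T, ∀ i, pd i (fun x => (synth (epPotential ε (g t)) x).re) =
      fun x => (synth (dseq i (epPotential ε (g t))) x).re := fun t ht i =>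
    pd_re_synth (hP1 t ht) i
  refine ⟨fun t x => (synth (epPotential ε (g t)) x).re, fun t ht => ?_, fun i => ?_,
    fun t ht x i => ?_, fun t ht x => ?_⟩
  · exact isCn_re_synth (n := 2) ((hP t ht).summable_weighted_norm hd (by norm_num))
  · refine (continuousOn_re_synth hd (c := fun t => dseq i (epPotential ε (g t)))
      (fun k => continuousOn_dseq (((h.continuousOn_density k).div_const _).div_const _
        |>.const_mul _) i) (fun t ht => (hPd t ht i).of_le (by norm_num))).congr fun q hq => ?_
    rw [hpd q.1 hq.1 i]
  · obtain ⟨B, hB⟩ := h.exists_sobBound_epVelocity hd i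
    refine (hasDerivWithinAt_re_synth hd (fun t ht => h.summable_velocity hd ht i)
      (h.hasDeriv_velocity i) (h.continuousOn_epVelocity hd i) hB x ht).congr_deriv ?_
    have e : epVelocity ε (b t) (g t) i = fun k =>
        -(fun k => ∑ j, conv (b t j) (dseq j (b t i)) k) k
          + ((ε⁻¹ : ℝ) : ℂ) * dseq i (epPotential ε (g t)) k := by
      funext k
      have hε' : (ε : ℂ) ≠ 0 := by exact_mod_cast hε
      rw [dseq_epPotential hε, epVelocity, sub_eq_add_neg]
      congr 1
      push_cast
      field_simp
    have hs1 : SobBound 2 (fun k => ∑ j, conv (b t j) (dseq j (b t i)) k) _ :=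
      SobBound.sum _ fun j _ => SobBound.conv hd le_rfl
        ((h.sobBound_velocity t ht j).of_le (by norm_num)) ((h.sobBound_velocity t ht i).dseq j)
    rw [e, synth_add (hs1.neg.summable_norm hd le_rfl)
      (((hPd t ht i).smul _).summable_norm hd (by norm_num)), synth_neg, synth_smul,
      Complex.add_re, Complex.neg_re, Complex.re_ofReal_mul,
      convection_re_synth hd (h.sobBound_velocity t ht) (h.real_velocity t ht), hpd t ht i,
      div_eq_inv_mul]
  · have hpd2 : ∀ i, pd i (pd i (fun x => (synth (epPotential ε (g t)) x).re)) x =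
        (synth (dseq i (dseq i (epPotential ε (g t)))) x).re := fun i => by
      rw [hpd t ht i, pd_re_synth]
      simpa using (hPd t ht i).summable_weighted_norm hd (n := 1) le_rfl
    -- The Laplacian reproduces every nonzero mode of the density. The remaining zero mode equals
    -- `1` by conservation of mass.
    have e : g t = fun k => (fun k => if k = 0 then 1 else 0) k +
        (ε : ℂ) * (fun k => ∑ i, dseq i (dseq i (epPotential ε (g t))) k) k := by
      funext k
      have hsq : ∑ i, (k i : ℂ) ^ 2 = (modulus k : ℂ) ^ 2 := by
        rw [← Complex.ofReal_pow, modulus_sq]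
        push_cast
        rfl
      have h1 : ∑ i, dseq i (dseq i (epPotential ε (g t))) k =
          (2 * Real.pi * Complex.I) ^ 2 * (modulus k : ℂ) ^ 2 * epPotential ε (g t) k := by
        rw [← hsq, Finset.mul_sum, Finset.sum_mul]
        refine Finset.sum_congr rfl fun i _ => ?_
        simp only [dseq]
        ring
      simp only [h1]
      rcases eq_or_ne k 0 with rfl | hk
      · simp [h.mass t ht, modulus_zero]
      have hk' : ((modulus k : ℝ) : ℂ) ≠ 0 := by exact_mod_cast (modulus_pos hk).ne'
      have hπ : ((Real.pi : ℝ) : ℂ) ≠ 0 := by exact_mod_cast Real.pi_ne_zero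
      have hε' : (ε : ℂ) ≠ 0 := by exact_mod_cast hε
      rw [if_neg hk, epPotential]
      push_cast
      field_simp
      rw [Complex.I_sq]
      ring
    have hone : ∀ x : Torus d, synth (fun k => if k = 0 then 1 else 0) x = 1 := fun x => by
      rw [synth, tsum_eq_single 0 fun k hk => by simp [hk]]
      rw [if_pos rfl, one_mul, chr_zero]
    have hones : Summable fun k : Freq d => ‖(if k = 0 then 1 else 0 : ℂ)‖ :=
      summable_of_ne_finset_zero (s := {0}) fun k hk => by
        simp [show k ≠ 0 by simpa using hk]
    have hs2 := SobBound.sum Finset.univ fun i _ => hPdd t ht i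
    conv_rhs => rw [e]
    rw [synth_add hones ((hs2.smul _).summable_norm hd le_rfl), synth_smul, hone, Complex.add_re,
      Complex.re_ofReal_mul, Complex.one_re, add_sub_cancel_left,
      re_synth_sum _ fun i => (hPdd t ht i).summable_norm hd le_rfl, laplacian]
    simp only [hpd2]

end IsEPFlow

instance : (torusMeasure d).IsOpenPosMeasure :=
  inferInstanceAs (Measure.IsOpenPosMeasure (Measure.pi fun _ => AddCircle.haarAddCircle))

/-! ### Truncation of a Fourier series -/

/-- The restriction of a sequence to the frequencies with coordinates at most `N`. -/
def trunc (N : ℕ) (f : Freq d → ℂ) (k : Freq d) : ℂ := if k ∈ freqBox d N then f k else 0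

lemma IsRealSeq.trunc {f : Freq d → ℂ} (hf : IsRealSeq f) (N : ℕ) : IsRealSeq (trunc N f) := by
  intro k
  have h : -k ∈ freqBox d N ↔ k ∈ freqBox d N :=
    ⟨fun h => by simpa using neg_mem_freqBox _ h, fun h => neg_mem_freqBox _ h⟩
  simp only [EulerPoisson.trunc, h]
  split_ifs
  · exact hf k
  · simp

lemma SobBound.trunc {m : ℕ} {f : Freq d → ℂ} {R : ℝ} (h : SobBound m f R) (N : ℕ) :
    SobBound m (trunc N f) R :=
  h.of_norm_le fun k => by
    unfold EulerPoisson.trunc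
    split_ifs
    · rfl
    · simp

/-- A bound for the weight on the frequencies with coordinates at most `N`. -/
def boxWeight (d N : ℕ) : ℝ := ∑ k ∈ freqBox d N, jb k

lemma boxWeight_nonneg (d N : ℕ) : 0 ≤ boxWeight d N := Finset.sum_nonneg fun k _ => (jb_pos k).le

/-- Qualitative smoothness only, since the constant depends on `N`; it justifies pointwise calculus
on truncations. -/
lemma SobBound.trunc_succ {m : ℕ} {f : Freq d → ℂ} {R : ℝ} (h : SobBound m f R) (N : ℕ) :
    SobBound (m + 1) (EulerPoisson.trunc N f) (boxWeight d N * R) := by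
  refine h.dominated (boxWeight_nonneg d N) fun k => ?_
  unfold EulerPoisson.trunc
  have h0 := jb_pos k
  split_ifs with hk
  · have h1 : jb k ≤ boxWeight d N :=
      Finset.single_le_sum (f := fun k => jb k) (fun k _ => (jb_pos k).le) hk
    rw [pow_succ', mul_assoc]
    gcongr
  · have := boxWeight_nonneg d N
    rw [norm_zero, mul_zero]
    positivity

/-- Outside the box the weight is at least `N + 1`, so one derivative is exchanged for decay in `N`.
-/
lemma SobBound.sub_trunc {m : ℕ} {f : Freq d → ℂ} {R : ℝ} (h : SobBound (m + 1) f R) (N : ℕ) :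
    SobBound m (fun k => f k - EulerPoisson.trunc N f k) (((N : ℝ) + 1)⁻¹ * R) := by
  refine h.dominated (by positivity) fun k => ?_
  have h0 := jb_pos k
  unfold EulerPoisson.trunc
  split_ifs with hk
  · rw [sub_self, norm_zero, mul_zero]
    positivity
  · rw [sub_zero]
    have h1 : (N : ℝ) + 1 ≤ jb k := by
      rw [mem_freqBox] at hk
      push Not at hk
      obtain ⟨i, hi⟩ := hk
      refine le_trans ?_ (abs_coord_le_jb k i)
      have : (N : ℤ) + 1 ≤ |k i| := by
        by_cases h : -(N : ℤ) ≤ k i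
        · exact le_trans (hi h) (le_abs_self _)
        · exact le_trans (by omega) (neg_le_abs _)
      exact_mod_cast this
    rw [pow_succ, mul_assoc, mul_left_comm, ← mul_assoc _ (jb k)]
    refine mul_le_mul_of_nonneg_left ?_ (by positivity)
    refine le_mul_of_one_le_left (norm_nonneg _) ?_
    rw [inv_mul_eq_div, one_le_div (by positivity)]
    exact h1

lemma synth_trunc (N : ℕ) (f : Freq d → ℂ) (x : Torus d) :
    synth (trunc N f) x = ∑ k ∈ freqBox d N, f k * chr k x := by
  rw [synth, tsum_eq_sum (s := freqBox d N) fun k hk => by simp [trunc, hk]]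
  exact Finset.sum_congr rfl fun k hk => by simp [trunc, hk]

lemma eventually_norm_synth_sub_trunc_le (hd : d ≤ 3) {δ : ℝ} (hδ : 0 < δ) :
    ∀ᶠ N in atTop, ∀ (f : Freq d → ℂ) (R : ℝ), SobBound 2 f R →
      ∀ x, ‖synth f x - synth (trunc N f) x‖ ≤ δ * R := by
  obtain ⟨S₀, hS₀⟩ := exists_tail_le (d := d) hd hδ
  filter_upwards [tendsto_freqBox.eventually (eventually_ge_atTop S₀)] with N hN f R hf x
  rw [synth_trunc]
  exact norm_synth_sub_sum_le (hf.summable_norm hd le_rfl)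
    (fun S hS => hS₀ f R hf S (hS.mono_right hN)) x

/-! ### A smooth approximation of the absolute value -/

/-- The function `√(r² + δ²)`. -/
def smoothAbs (δ r : ℝ) : ℝ := Real.sqrt (r ^ 2 + δ ^ 2)

section SmoothAbs

variable {δ : ℝ}

lemma smoothAbs_pos (hδ : 0 < δ) (r : ℝ) : 0 < smoothAbs δ r := Real.sqrt_pos.mpr (by positivity)

lemma smoothAbs_sq (δ r : ℝ) : smoothAbs δ r ^ 2 = r ^ 2 + δ ^ 2 := Real.sq_sqrt (by positivity)

lemma hasDerivAt_smoothAbs (hδ : 0 < δ) (r : ℝ) :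
    HasDerivAt (smoothAbs δ) (r / smoothAbs δ r) r := by
  have h1 : HasDerivAt (fun r : ℝ => r ^ 2 + δ ^ 2) (2 * r) r := by
    simpa using (hasDerivAt_pow 2 r).add_const (δ ^ 2)
  refine (h1.sqrt (by positivity)).congr_deriv ?_
  rw [smoothAbs]
  field_simp

lemma abs_le_smoothAbs (δ r : ℝ) : |r| ≤ smoothAbs δ r :=
  Real.le_sqrt_of_sq_le (by rw [sq_abs]; nlinarith [sq_nonneg δ])

lemma le_smoothAbs (δ r : ℝ) : δ ≤ smoothAbs δ r :=
  Real.le_sqrt_of_sq_le (by nlinarith [sq_nonneg r])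

lemma smoothAbs_le (hδ : 0 < δ) (r : ℝ) : smoothAbs δ r ≤ |r| + δ := by
  refine Real.sqrt_le_iff.mpr ⟨by positivity, ?_⟩
  nlinarith [abs_nonneg r, sq_abs r]

lemma abs_div_smoothAbs_le (hδ : 0 < δ) (r : ℝ) : |r / smoothAbs δ r| ≤ 1 := by
  rw [abs_div, abs_of_pos (smoothAbs_pos hδ r)]
  exact div_le_one_of_le₀ (abs_le_smoothAbs δ r) (smoothAbs_pos hδ r).le

/-- The defect from homogeneity is `δ²` divided by the smoothed absolute value, which is at least
`δ`. It accounts for the compressible part of the transport. -/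
lemma abs_smoothAbs_sub_le (hδ : 0 < δ) (r : ℝ) :
    |smoothAbs δ r - r / smoothAbs δ r * r| ≤ δ := by
  have h1 := smoothAbs_pos hδ r
  have e : smoothAbs δ r - r / smoothAbs δ r * r = δ ^ 2 / smoothAbs δ r := by
    field_simp
    rw [smoothAbs_sq]
    ring
  rw [e, abs_of_pos (by positivity), div_le_iff₀ h1, sq]
  exact mul_le_mul_of_nonneg_left (le_smoothAbs δ r) hδ.le

lemma continuous_smoothAbs (δ : ℝ) : Continuous (smoothAbs δ) := by
  unfold smoothAbs
  fun_prop

lemma continuous_div_smoothAbs (hδ : 0 < δ) : Continuous fun r => r / smoothAbs δ r :=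
  continuous_id.div (continuous_smoothAbs δ) fun r => (smoothAbs_pos hδ r).ne'

end SmoothAbs

lemma integral_deriv_eq_zero_real {g g' : Torus d → ℝ} (hg : Continuous g) (hg' : Continuous g')
    (j : Fin d)
    (h : ∀ x, HasDerivAt (fun h : ℝ => g (x + Pi.single j (h : UnitAddCircle))) (g' x) 0) :
    ∫ x, g' x ∂torusMeasure d = 0 := by
  have h1 := integral_deriv_eq_zero (g := fun x => (g x : ℂ)) (g' := fun x => (g' x : ℂ))
    (by fun_prop) (by fun_prop) j fun x => (h x).ofReal_comp
  have h2 : ((∫ x, g' x ∂torusMeasure d : ℝ) : ℂ) = 0 := integral_ofReal.symm.trans h1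
  exact_mod_cast h2

/-- The integral of `smoothAbs` of a density that is transported up to an error `E`. -/
lemma abs_integral_transport_le {P Pt E : Torus d → ℝ} {Q V W : Fin d → Torus d → ℝ}
    (hP : Continuous P) (hE : Continuous E)
    (hQ : ∀ j, Continuous (Q j)) (hV : ∀ j, Continuous (V j)) (hW : ∀ j, Continuous (W j))
    (hPQ : ∀ j x, HasDerivAt (fun h : ℝ => P (x + Pi.single j (h : UnitAddCircle))) (Q j x) 0)
    (hVW : ∀ j x, HasDerivAt (fun h : ℝ => V j (x + Pi.single j (h : UnitAddCircle))) (W j x) 0)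
    (he : ∀ x, Pt x = E x - ∑ j, (V j x * Q j x + P x * W j x)) {η D δ : ℝ} (hδ : 0 < δ)
    (hη : ∫ x, |E x| ∂torusMeasure d ≤ η) (hD : ∀ x, |∑ j, W j x| ≤ D) :
    |∫ x, P x / smoothAbs δ (P x) * Pt x ∂torusMeasure d| ≤ η + δ * D := by
  have hc1 : Continuous fun x => P x / smoothAbs δ (P x) := (continuous_div_smoothAbs hδ).comp hP
  have hc2 : Continuous fun x => smoothAbs δ (P x) := (continuous_smoothAbs δ).comp hP
  -- The integrand is the derivative of `smoothAbs δ P * V j` in direction `j`. Subtracting these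
  -- total derivatives leaves the error `E` and the homogeneity defect times the divergence.
  have hz : ∀ j, ∫ x, (P x / smoothAbs δ (P x) * Q j x * V j x + smoothAbs δ (P x) * W j x)
      ∂torusMeasure d = 0 := by
    intro j
    refine integral_deriv_eq_zero_real (g := fun x => smoothAbs δ (P x) * V j x)
      (hc2.mul (hV j)) (((hc1.mul (hQ j)).mul (hV j)).add (hc2.mul (hW j))) j fun x => ?_
    have h1 : HasDerivAt (fun h : ℝ => smoothAbs δ (P (x + Pi.single j (h : UnitAddCircle))))
        (P x / smoothAbs δ (P x) * Q j x) 0 := by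
      refine HasDerivAt.comp (0 : ℝ) (h₂ := smoothAbs δ) ?_ (hPQ j x)
      simpa using hasDerivAt_smoothAbs hδ (P x)
    refine (h1.mul (hVW j x)).congr_deriv ?_
    simp
  have e : (fun x => P x / smoothAbs δ (P x) * Pt x) = fun x =>
      (P x / smoothAbs δ (P x) * E x +
        (smoothAbs δ (P x) - P x / smoothAbs δ (P x) * P x) * ∑ j, W j x) -
      ∑ j, (P x / smoothAbs δ (P x) * Q j x * V j x + smoothAbs δ (P x) * W j x) := by
    funext x
    rw [he x, Finset.sum_add_distrib, Finset.sum_add_distrib, ← Finset.mul_sum, ← Finset.mul_sum]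
    simp only [mul_assoc, ← Finset.mul_sum]
    simp only [mul_comm (V _ x)]
    ring
  have hi1 : ∀ j, Integrable (fun x => P x / smoothAbs δ (P x) * Q j x * V j x +
      smoothAbs δ (P x) * W j x) (torusMeasure d) := fun j =>
    (((hc1.mul (hQ j)).mul (hV j)).add (hc2.mul (hW j))).integrable_torus
  have hcW : Continuous fun x => ∑ j, W j x := continuous_finsetSum _ fun j _ => hW j
  have hi2 : Integrable (fun x => P x / smoothAbs δ (P x) * E x +
      (smoothAbs δ (P x) - P x / smoothAbs δ (P x) * P x) * ∑ j, W j x) (torusMeasure d) :=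
    ((hc1.mul hE).add ((hc2.sub (hc1.mul hP)).mul hcW)).integrable_torus
  rw [e, integral_sub hi2 (integrable_finsetSum _ fun j _ => hi1 j),
    integral_finsetSum _ fun j _ => hi1 j, Finset.sum_eq_zero fun j _ => hz j, sub_zero]
  refine (abs_integral_le_integral_abs).trans ?_
  have hi3 : Integrable (fun x => |E x|) (torusMeasure d) := hE.abs.integrable_torus
  refine (integral_mono (g := fun x => |E x| + δ * D) hi2.abs (hi3.add (integrable_const (δ * D)))
    fun x => ?_).trans ?_
  · refine (abs_add_le _ _).trans ?_
    rw [abs_mul, abs_mul]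
    exact add_le_add (mul_le_of_le_one_left (abs_nonneg _) (abs_div_smoothAbs_le hδ _))
      (mul_le_mul (abs_smoothAbs_sub_le hδ _) (hD x) (abs_nonneg _) hδ.le)
  · rw [integral_add hi3 (integrable_const _)]
    simpa using hη

/-- On a probability space the `L¹` norm is at most the `L²` norm, here through the
arithmetic–geometric mean inequality and Parseval. The extra `η` avoids division by zero when `R =
0`. -/
lemma integral_abs_re_synth_le {c : Freq d → ℂ} (hc : Summable fun k => ‖c k‖) (hr : IsRealSeq c)
    {R : ℝ} (hR : SobBound 0 c R) : ∫ x, |(synth c x).re| ∂torusMeasure d ≤ R := by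
  have hcont : Continuous fun x => (synth c x).re :=
    Complex.continuous_re.comp (continuous_synth hc)
  have h2 : ∫ x, (synth c x).re ^ 2 ∂torusMeasure d ≤ R ^ 2 := by
    refine (hasSum_le_of_sum_le (hasSum_integral_norm_sq hc hr)) fun S => ?_
    simpa using hR.2 S
  refine le_of_forall_pos_le_add fun η hη => ?_
  have hη' : 0 < R + η := by have := hR.1; linarith
  have h3 : ∫ x, |(synth c x).re| ∂torusMeasure d ≤
      ∫ x, ((2 * (R + η))⁻¹ * (synth c x).re ^ 2 + (R + η) / 2) ∂torusMeasure d := by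
    refine integral_mono hcont.abs.integrable_torus
      (((hcont.pow 2).const_mul _).add continuous_const).integrable_torus fun x => ?_
    have h4 : 0 ≤ (|(synth c x).re| - (R + η)) ^ 2 := sq_nonneg _
    have h5 : (2 * (R + η))⁻¹ * (synth c x).re ^ 2 + (R + η) / 2 - |(synth c x).re| =
        (2 * (R + η))⁻¹ * (|(synth c x).re| - (R + η)) ^ 2 := by
      rw [← sq_abs]
      field_simp
      ring
    have h6 : 0 ≤ (2 * (R + η))⁻¹ * (|(synth c x).re| - (R + η)) ^ 2 := by positivity
    simp only
    linarith
  have h7 : ∫ x, ((2 * (R + η))⁻¹ * (synth c x).re ^ 2 + (R + η) / 2) ∂torusMeasure d =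
      (2 * (R + η))⁻¹ * ∫ x, (synth c x).re ^ 2 ∂torusMeasure d + (R + η) / 2 := by
    have hi : Integrable (fun x => (2 * (R + η))⁻¹ * (synth c x).re ^ 2) (torusMeasure d) :=
      ((hcont.pow 2).const_mul _).integrable_torus
    rw [integral_add hi (integrable_const _), integral_const_mul]
    simp
  rw [h7] at h3
  have h8 : (2 * (R + η))⁻¹ * ∫ x, (synth c x).re ^ 2 ∂torusMeasure d ≤ (R + η) / 2 := by
    rw [inv_mul_le_iff₀ (by positivity)]
    refine h2.trans ?_
    have := hR.1
    nlinarith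
  linarith

/-! ### Preservation of the sign of the density -/

/-- The error in the continuity equation for the truncated density. -/
def truncError (N : ℕ) (b : Fin d → Freq d → ℂ) (g : Freq d → ℂ) (k : Freq d) : ℂ :=
  trunc N (epDensity b g) k + ∑ j, dseq j (conv (b j) (trunc N g)) k

namespace IsEPFlow

variable {ε T R : ℝ} {b : ℝ → Fin d → Freq d → ℂ} {g : ℝ → Freq d → ℂ}

/-- The error consists of the tail of the time derivative, which is in `H¹`, and the flux divergence
of the tail of the density, which is in `H²`. Each has one derivative to spare over `L²`, giving
decay like `1 / (N + 1)` uniformly in time. -/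
lemma exists_sobBound_truncError (h : IsEPFlow ε T R b g) (hd : d ≤ 3) :
    ∃ K, ∀ N : ℕ, ∀ t ∈ Set.Icc 0 T, SobBound 0 (truncError N (b t) (g t)) (((N : ℝ) + 1)⁻¹ * K) := by
  refine ⟨(∑ _j : Fin d, 2 * Real.pi * (2 ^ (2 + 1) * embConst d * (R * R))) +
    ∑ _j : Fin d, 2 * Real.pi * (2 * (embConst d * R) * R), fun N t ht => ?_⟩
  have hb := h.sobBound_velocity t ht
  have hg := h.sobBound_density t ht
  have e : truncError N (b t) (g t) = fun k =>
      -(epDensity (b t) (g t) k - trunc N (epDensity (b t) (g t)) k) -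
        ∑ j, dseq j (conv (b t j) fun k => g t k - trunc N (g t) k) k := by
    funext k
    have h1 : ∀ j, conv (b t j) (g t) k = conv (b t j) (trunc N (g t)) k +
        conv (b t j) (fun k => g t k - trunc N (g t) k) k := fun j => by
      rw [← conv_add_right (hb j) (hg.trunc N) (hg.sub (hg.trunc N))]
      simp
    simp only [truncError]
    conv_rhs => rw [epDensity]
    simp only [dseq, h1, mul_add, Finset.sum_add_distrib]
    ring
  rw [e]
  refine (((h.sobBound_epDensity hd ht).sub_trunc N).neg.sub (SobBound.sum _ fun j _ =>
    (SobBound.conv_one hd (hb j) (SobBound.sub_trunc (m := 1) hg N)).dseq j)).mono (le_of_eq ?_)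
  rw [mul_add, Finset.mul_sum (f := fun _ : Fin d => 2 * Real.pi * (2 * (embConst d * R) * R))]
  congr 1
  exact Finset.sum_congr rfl fun _ _ => by ring

/-- Used only to know that the error is a continuous function for each `N`; no uniformity is
required. -/
lemma exists_sobBound_truncError_two (h : IsEPFlow ε T R b g) (hd : d ≤ 3) (N : ℕ) {t : ℝ}
    (ht : t ∈ Set.Icc 0 T) : ∃ K, SobBound 2 (truncError N (b t) (g t)) K :=
  ⟨_, ((h.sobBound_epDensity hd ht).trunc_succ N).add (SobBound.sum _ fun j _ =>
    (SobBound.conv hd (by norm_num) (h.sobBound_velocity t ht j)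
      ((h.sobBound_density t ht).trunc_succ N)).dseq j)⟩

lemma isRealSeq_epDensity (h : IsEPFlow ε T R b g) {t : ℝ} (ht : t ∈ Set.Icc 0 T) :
    IsRealSeq (epDensity (b t) (g t)) :=
  (IsRealSeq.sum _ fun j _ => ((h.real_velocity t ht j).conv (h.real_density t ht)).dseq j).neg

lemma isRealSeq_truncError (h : IsEPFlow ε T R b g) (N : ℕ) {t : ℝ} (ht : t ∈ Set.Icc 0 T) :
    IsRealSeq (truncError N (b t) (g t)) :=
  ((h.isRealSeq_epDensity ht).trunc N).add (IsRealSeq.sum _ fun j _ =>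
    ((h.real_velocity t ht j).conv ((h.real_density t ht).trunc N)).dseq j)

lemma summable_trunc (h : IsEPFlow ε T R b g) (hd : d ≤ 3) (N : ℕ) {t : ℝ}
    (ht : t ∈ Set.Icc 0 T) : Summable fun k => jb k * ‖trunc N (g t) k‖ := by
  simpa using ((h.sobBound_density t ht).trunc_succ N).summable_weighted_norm hd (n := 1) le_rfl

/-- The continuity equation for the truncated density. -/
lemma re_synth_truncError (h : IsEPFlow ε T R b g) (hd : d ≤ 3) (N : ℕ) {t : ℝ}
    (ht : t ∈ Set.Icc 0 T) (x : Torus d) :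
    (synth (trunc N (epDensity (b t) (g t))) x).re = (synth (truncError N (b t) (g t)) x).re -
      ∑ j, ((synth (b t j) x).re * (synth (dseq j (trunc N (g t))) x).re +
        (synth (trunc N (g t)) x).re * (synth (dseq j (b t j)) x).re) := by
  have hb := h.sobBound_velocity t ht
  have hg := h.sobBound_density t ht
  have hc : ∀ j, SobBound 3 (conv (b t j) (trunc N (g t))) _ := fun j =>
    SobBound.conv hd (by norm_num) (hb j) (hg.trunc_succ N)
  have hj : ∀ j, (synth (dseq j (conv (b t j) (trunc N (g t)))) x).re =
      (synth (b t j) x).re * (synth (dseq j (trunc N (g t))) x).re +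
        (synth (trunc N (g t)) x).re * (synth (dseq j (b t j)) x).re := by
    intro j
    have h1 := hasDerivAt_re_synth (c := conv (b t j) (trunc N (g t)))
      (by simpa using (hc j).summable_weighted_norm hd (n := 1) le_rfl) x j
    have h2 := (hasDerivAt_re_synth (h.summable_velocity_jb hd ht j) x j).mul
      (hasDerivAt_re_synth (h.summable_trunc hd N ht) x j)
    have h3 : (fun h : ℝ => (synth (conv (b t j) (trunc N (g t)))
        (x + Pi.single j (h : UnitAddCircle))).re) =
        (fun h : ℝ => (synth (b t j) (x + Pi.single j (h : UnitAddCircle))).re) *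
          fun h : ℝ => (synth (trunc N (g t)) (x + Pi.single j (h : UnitAddCircle))).re := by
      funext z
      rw [Pi.mul_apply, re_synth_mul (h.summable_velocity hd ht j)
        ((hg.trunc N).summable_norm hd le_rfl) (h.real_velocity t ht j)
        ((h.real_density t ht).trunc N)]
    rw [h3] at h1
    rw [h1.unique h2]
    simp only [AddCircle.coe_zero, Pi.single_zero, add_zero]
    ring
  have e : (synth (truncError N (b t) (g t)) x).re =
      (synth (trunc N (epDensity (b t) (g t))) x).re +
        ∑ j, (synth (dseq j (conv (b t j) (trunc N (g t)))) x).re := by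
    have hs : ∀ j, Summable fun k => ‖dseq j (conv (b t j) (trunc N (g t))) k‖ := fun j =>
      ((hc j).dseq j).summable_norm hd le_rfl
    rw [← re_synth_sum _ hs, ← Complex.add_re, ← synth_add
      (((h.sobBound_epDensity hd ht).trunc_succ N).summable_norm hd le_rfl)
      ((SobBound.sum _ fun j _ => (hc j).dseq j).summable_norm hd le_rfl)]
    rfl
  rw [e]
  simp only [hj]
  ring

/-- The evolution of the integral of `smoothAbs` of the truncated density. -/
lemma abs_integral_smoothAbs_sub_le (h : IsEPFlow ε T R b g) (hd : d ≤ 3) {K : ℝ}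
    (hK : ∀ N : ℕ, ∀ t ∈ Set.Icc 0 T, SobBound 0 (truncError N (b t) (g t)) (((N : ℝ) + 1)⁻¹ * K))
    (N : ℕ) {δ : ℝ} (hδ : 0 < δ) {t : ℝ} (ht : t ∈ Set.Icc 0 T) :
    |∫ x, smoothAbs δ (synth (trunc N (g t)) x).re ∂torusMeasure d -
      ∫ x, smoothAbs δ (synth (trunc N (g 0)) x).re ∂torusMeasure d| ≤
      (((N : ℝ) + 1)⁻¹ * K + δ * (d * (embConst d * (2 * Real.pi * R)))) * t := by
  have hgc : ∀ t ∈ Set.Icc 0 T, Continuous fun x => (synth (trunc N (g t)) x).re := fun t ht =>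
    Complex.continuous_re.comp
      (continuous_synth (((h.sobBound_density t ht).trunc N).summable_norm hd le_rfl))
  have htr : ∀ t ∈ Set.Icc 0 T, SobBound 2 (trunc N (epDensity (b t) (g t))) _ := fun t ht =>
    (h.sobBound_epDensity hd ht).trunc_succ N
  have hdt : ∀ x, ∀ t ∈ Set.Icc 0 T, HasDerivWithinAt (fun τ => (synth (trunc N (g τ)) x).re)
      (synth (trunc N (epDensity (b t) (g t))) x).re (Set.Icc 0 T) t := by
    intro x t ht
    refine hasDerivWithinAt_re_synth hd
      (fun t ht => ((h.sobBound_density t ht).trunc N).summable_norm hd le_rfl)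
      (c' := fun t => trunc N (epDensity (b t) (g t))) (fun k t ht => ?_) (fun k => ?_) htr x ht
    · simp only [trunc]
      split_ifs
      · exact h.hasDeriv_density k t ht
      · exact hasDerivWithinAt_const _ _ _
    · simp only [trunc]
      split_ifs
      · exact h.continuousOn_epDensity hd k
      · exact continuousOn_const
  let F : ℝ → Torus d → ℂ := fun t x => (smoothAbs δ (synth (trunc N (g t)) x).re : ℂ)
  let F' : ℝ → Torus d → ℂ := fun t x => (((synth (trunc N (g t)) x).re /
    smoothAbs δ (synth (trunc N (g t)) x).re *
      (synth (trunc N (epDensity (b t) (g t))) x).re : ℝ) : ℂ)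
  have hF : ∀ t ∈ Set.Icc 0 T, HasDerivWithinAt (fun τ => ∫ x, F τ x ∂torusMeasure d)
      (∫ x, F' t x ∂torusMeasure d) (Set.Icc 0 T) t := fun t ht => by
    refine hasDerivWithinAt_integral (B := embConst d * (boxWeight d N *
      ∑ _j : Fin d, 2 * Real.pi * (2 ^ (2 + 1) * embConst d * (R * R)))) (fun t ht => ?_)
      (fun t ht x => ?_) (fun t ht x => ?_) ht
    · exact Complex.continuous_ofReal.comp ((continuous_smoothAbs δ).comp (hgc t ht))
    · exact ((hasDerivAt_smoothAbs hδ _).comp_hasDerivWithinAt t (hdt x t ht)).ofReal_comp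
    · simp only [F']
      rw [Complex.norm_real, Real.norm_eq_abs, abs_mul]
      refine (mul_le_of_le_one_left (abs_nonneg _) (abs_div_smoothAbs_le hδ _)).trans ?_
      exact (Complex.abs_re_le_norm _).trans (SobBound.norm_synth_le hd (htr t ht) x)
  have hF' : ∀ t ∈ Set.Icc 0 T, ‖∫ x, F' t x ∂torusMeasure d‖ ≤
      ((N : ℝ) + 1)⁻¹ * K + δ * (d * (embConst d * (2 * Real.pi * R))) := by
    intro t ht
    have e : ∫ x, F' t x ∂torusMeasure d = ((∫ x, (synth (trunc N (g t)) x).re /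
        smoothAbs δ (synth (trunc N (g t)) x).re *
          (synth (trunc N (epDensity (b t) (g t))) x).re ∂torusMeasure d : ℝ) : ℂ) :=
      integral_ofReal
    rw [e, Complex.norm_real, Real.norm_eq_abs]
    obtain ⟨K₂, hK₂⟩ := h.exists_sobBound_truncError_two hd N ht
    have hre : ∀ {c : Freq d → ℂ}, (Summable fun k => ‖c k‖) → Continuous fun x => (synth c x).re :=
      fun hc => Complex.continuous_re.comp (continuous_synth hc)
    have hdb : ∀ j, SobBound 2 (dseq j (b t j)) (2 * Real.pi * R) := fun j =>
      (h.sobBound_velocity t ht j).dseq j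
    refine abs_integral_transport_le (E := fun x => (synth (truncError N (b t) (g t)) x).re)
      (Q := fun j x => (synth (dseq j (trunc N (g t))) x).re)
      (V := fun j x => (synth (b t j) x).re) (W := fun j x => (synth (dseq j (b t j)) x).re)
      (hgc t ht) (hre (hK₂.summable_norm hd le_rfl))
      (fun j => hre ((((h.sobBound_density t ht).trunc_succ N).dseq j).summable_norm hd le_rfl))
      (fun j => hre (h.summable_velocity hd ht j)) (fun j => hre ((hdb j).summable_norm hd le_rfl))
      (fun j x => hasDerivAt_re_synth (h.summable_trunc hd N ht) x j)
      (fun j x => hasDerivAt_re_synth (h.summable_velocity_jb hd ht j) x j)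
      (h.re_synth_truncError hd N ht) hδ ?_ fun x => ?_
    · exact integral_abs_re_synth_le (hK₂.summable_norm hd le_rfl) (h.isRealSeq_truncError N ht)
        (hK N t ht)
    · refine (Finset.abs_sum_le_sum_abs _ _).trans ?_
      refine (Finset.sum_le_card_nsmul _ _ _ fun j _ => (Complex.abs_re_le_norm _).trans
        ((hdb j).norm_synth_le hd x)).trans (le_of_eq ?_)
      simp
  have h0 : (0 : ℝ) ∈ Set.Icc 0 T := ⟨le_rfl, ht.1.trans ht.2⟩
  have hm := (convex_Icc 0 T).norm_image_sub_le_of_norm_hasDerivWithin_le hF hF' h0 ht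
  have e : ∀ t, ∫ x, F t x ∂torusMeasure d =
      ((∫ x, smoothAbs δ (synth (trunc N (g t)) x).re ∂torusMeasure d : ℝ) : ℂ) := fun t =>
    integral_ofReal
  rw [e, e, ← Complex.ofReal_sub, Complex.norm_real, sub_zero, Real.norm_eq_abs, Real.norm_eq_abs,
    abs_of_nonneg ht.1] at hm
  exact hm

/-- The estimate for the smoothed truncations, in the limit of large `N` and small `δ`; truncations
converge uniformly because the density is bounded in `H²`. -/
lemma integral_abs_density_le (h : IsEPFlow ε T R b g) (hd : d ≤ 3) {t : ℝ}
    (ht : t ∈ Set.Icc 0 T) :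
    ∫ x, |(synth (g t) x).re| ∂torusMeasure d ≤ ∫ x, |(synth (g 0) x).re| ∂torusMeasure d := by
  obtain ⟨K, hK⟩ := h.exists_sobBound_truncError hd
  have h0 : (0 : ℝ) ∈ Set.Icc 0 T := ⟨le_rfl, ht.1.trans ht.2⟩
  have hR : 0 ≤ R := (h.sobBound_density t ht).1
  -- One small parameter `κ` serves as smoothing parameter, as tolerance for the truncation and as
  -- bound for its error.
  have hbound : ∀ κ : ℝ, 0 < κ → ∫ x, |(synth (g t) x).re| ∂torusMeasure d ≤
      ∫ x, |(synth (g 0) x).re| ∂torusMeasure d + κ * (2 * R + 1 +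
        (1 + d * (embConst d * (2 * Real.pi * R))) * t) := by
    intro κ hκ
    have hlim : Tendsto (fun N : ℕ => ((N : ℝ) + 1)⁻¹ * K) atTop (𝓝 0) := by
      have h1 : Tendsto (fun N : ℕ => ((N : ℝ) + 1)⁻¹) atTop (𝓝 0) := by
        simpa using tendsto_one_div_add_atTop_nhds_zero_nat (𝕜 := ℝ)
      simpa using h1.mul_const K
    obtain ⟨N, hN1, hN2⟩ := ((eventually_norm_synth_sub_trunc_le (d := d) hd hκ).and
      (hlim.eventually (gt_mem_nhds hκ))).exists
    have hdiff : ∀ τ ∈ Set.Icc 0 T, ∀ x,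
        |(synth (g τ) x).re - (synth (trunc N (g τ)) x).re| ≤ κ * R := fun τ hτ x => by
      rw [← Complex.sub_re]
      exact (Complex.abs_re_le_norm _).trans (hN1 _ _ (h.sobBound_density τ hτ) x)
    have hc1 : ∀ τ ∈ Set.Icc 0 T, Continuous fun x => (synth (g τ) x).re := fun τ hτ =>
      Complex.continuous_re.comp (continuous_synth (h.summable_density hd hτ))
    have hc2 : ∀ τ ∈ Set.Icc 0 T, Continuous fun x =>
        smoothAbs κ (synth (trunc N (g τ)) x).re := fun τ hτ =>
      (continuous_smoothAbs κ).comp (Complex.continuous_re.comp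
        (continuous_synth (((h.sobBound_density τ hτ).trunc N).summable_norm hd le_rfl)))
    have hadd : ∀ {f : Torus d → ℝ} (z : ℝ), Continuous f →
        ∫ x, (f x + z) ∂torusMeasure d = ∫ x, f x ∂torusMeasure d + z := fun z hf => by
      rw [integral_add hf.integrable_torus (integrable_const z)]
      simp
    have h1 : ∫ x, |(synth (g t) x).re| ∂torusMeasure d ≤
        ∫ x, smoothAbs κ (synth (trunc N (g t)) x).re ∂torusMeasure d + κ * R := by
      rw [← hadd _ (hc2 t ht)]
      refine integral_mono (hc1 t ht).abs.integrable_torus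
        ((hc2 t ht).add continuous_const).integrable_torus fun x => ?_
      have h2 := abs_le_smoothAbs κ (synth (trunc N (g t)) x).re
      have h3 := hdiff t ht x
      have h4 := abs_sub_abs_le_abs_sub (synth (g t) x).re (synth (trunc N (g t)) x).re
      simp only
      linarith
    have h2 : ∫ x, smoothAbs κ (synth (trunc N (g 0)) x).re ∂torusMeasure d ≤
        ∫ x, |(synth (g 0) x).re| ∂torusMeasure d + (κ * R + κ) := by
      rw [← hadd _ (hc1 0 h0).abs]
      refine integral_mono (hc2 0 h0).integrable_torus
        ((hc1 0 h0).abs.add continuous_const).integrable_torus fun x => ?_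
      have h2 := smoothAbs_le hκ (synth (trunc N (g 0)) x).re
      have h3 := hdiff 0 h0 x
      have h4 := abs_sub_abs_le_abs_sub (synth (trunc N (g 0)) x).re (synth (g 0) x).re
      rw [abs_sub_comm] at h4
      simp only
      linarith
    have h3 := (abs_le.mp (h.abs_integral_smoothAbs_sub_le hd hK N hκ ht)).2
    have h4 : (((N : ℝ) + 1)⁻¹ * K + κ * (d * (embConst d * (2 * Real.pi * R)))) * t ≤
        (κ + κ * (d * (embConst d * (2 * Real.pi * R)))) * t := by
      have := ht.1
      gcongr
    linarith
  have hpos : 0 ≤ 2 * R + 1 + (1 + d * (embConst d * (2 * Real.pi * R))) * t := by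
    have h1 := ht.1
    have h2 := embConst_nonneg (d := d)
    positivity
  refine le_of_forall_pos_le_add fun κ hκ => ?_
  refine (hbound (κ / (2 * R + 1 + (1 + d * (embConst d * (2 * Real.pi * R))) * t + 1))
    (by positivity)).trans ?_
  gcongr
  rw [div_mul_eq_mul_div, div_le_iff₀ (by positivity)]
  nlinarith

/-- The density stays nonnegative. -/
lemma density_nonneg (h : IsEPFlow ε T R b g) (hd : d ≤ 3)
    (h0 : ∀ᵐ x ∂torusMeasure d, 0 ≤ (synth (g 0) x).re) {t : ℝ} (ht : t ∈ Set.Icc 0 T)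
    (x : Torus d) : 0 ≤ (synth (g t) x).re := by
  have h0T : (0 : ℝ) ∈ Set.Icc 0 T := ⟨le_rfl, ht.1.trans ht.2⟩
  have hc : Continuous fun x => (synth (g t) x).re :=
    Complex.continuous_re.comp (continuous_synth (h.summable_density hd ht))
  have h1 : ∫ x, |(synth (g 0) x).re| ∂torusMeasure d = 1 := by
    refine Eq.trans (integral_congr_ae ?_) (h.density_mass hd h0T)
    filter_upwards [h0] with x hx using abs_of_nonneg hx
  have h2 := h.integral_abs_density_le hd ht
  -- The `L¹` norm is at most its initial value, which equals the mass. The nonnegative continuous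
  -- integrand must therefore vanish everywhere.
  have h3 : ∫ x, (|(synth (g t) x).re| - (synth (g t) x).re) ∂torusMeasure d ≤ 0 := by
    rw [integral_sub hc.abs.integrable_torus hc.integrable_torus, h.density_mass hd ht]
    linarith
  have hnn : ∀ x, 0 ≤ |(synth (g t) x).re| - (synth (g t) x).re := fun x =>
    sub_nonneg.mpr (le_abs_self _)
  have h4 := le_antisymm h3 (integral_nonneg hnn)
  rw [integral_eq_zero_iff_of_nonneg hnn (hc.abs.sub hc).integrable_torus] at h4
  have h5 : |(synth (g t) x).re| - (synth (g t) x).re = 0 := congrFun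
    (Continuous.ae_eq_iff_eq (torusMeasure d) (hc.abs.sub hc) continuous_zero |>.mp h4) x
  have := abs_nonneg (synth (g t) x).re
  linarith

end IsEPFlow

lemma IsEPFlow.isEPSolution {ε T R : ℝ} {b : ℝ → Fin d → Freq d → ℂ} {g : ℝ → Freq d → ℂ}
    (h : IsEPFlow ε T R b g) (hd : d ≤ 3) (hε : ε ≠ 0) {v₀ : Torus d → Fin d → ℝ}
    {ρ₀ : Torus d → ℝ} (hv₀ : (fun x i => (synth (b 0 i) x).re) =ᵐ[torusMeasure d] v₀)
    (hρ₀ : (fun x => (synth (g 0) x).re) =ᵐ[torusMeasure d] ρ₀)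
    (hpos : ∀ᵐ x ∂torusMeasure d, 0 ≤ ρ₀ x) :
    IsEPSolution ε T v₀ ρ₀ (fun t x i => (synth (b t i) x).re) fun t x => (synth (g t) x).re where
  velocity_regular := h.contC1_velocity hd
  density_continuous := continuousOn_re_synth hd h.continuousOn_density h.sobBound_density
  density_nonneg t ht x := by
    refine h.density_nonneg hd ?_ ht x
    filter_upwards [hpos, hρ₀] with x h1 h2
    rw [h2]
    exact h1
  density_mass t ht := h.density_mass hd ht
  mass_conservation ψ hψ t ht := h.mass_conservation hd hψ ht
  momentum_poisson := h.momentum_poisson hd hε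
  initial_velocity := hv₀
  initial_density := hρ₀

/-! ### From the perturbation to the Euler–Poisson system -/

/-- The coefficients of the constant function `1`. -/
def oneSeq (k : Freq d) : ℂ := if k = 0 then 1 else 0

lemma sobBound_oneSeq (m : ℕ) : SobBound m (oneSeq : Freq d → ℂ) 1 := by
  classical
  refine ⟨zero_le_one, fun S => ?_⟩
  have h : ∀ k : Freq d, jb k ^ (2 * m) * ‖oneSeq k‖ ^ 2 = if k = 0 then 1 else 0 := by
    intro k
    rcases eq_or_ne k 0 with rfl | hk
    · have : jb (0 : Freq d) = 1 := by simp [jb]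
      simp [oneSeq, this]
    · simp [oneSeq, hk]
  simp only [h, Finset.sum_ite_eq']
  split_ifs <;> norm_num

lemma isRealSeq_oneSeq : IsRealSeq (oneSeq : Freq d → ℂ) := by
  intro k
  simp only [oneSeq, neg_eq_zero]
  split_ifs <;> simp

lemma synth_oneSeq (x : Torus d) : synth oneSeq x = 1 := by
  rw [synth, tsum_eq_single 0 fun k hk => by simp [oneSeq, hk]]
  rw [oneSeq, if_pos rfl, one_mul, chr_zero]

lemma conv_oneSeq (f : Freq d → ℂ) (k : Freq d) : conv f oneSeq k = f k := by
  rw [conv, tsum_eq_single 0 fun l hl => by simp [oneSeq, hl]]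
  simp [oneSeq]

section Perturbation

variable {s : ℕ} {ε T A Y : ℝ} {a u : ℝ → Fin d → Freq d → ℂ} {σ : ℝ → Freq d → ℂ}

/-- The velocity `a + ε u`. -/
def pertVelocity (ε : ℝ) (a u : Fin d → Freq d → ℂ) (i : Fin d) (k : Freq d) : ℂ :=
  a i k + ε * u i k

/-- The rescaled fluctuation of the density. -/
def pertFluct (a : Fin d → Freq d → ℂ) (σ : Freq d → ℂ) (k : Freq d) : ℂ :=
  pressureSource a k + absD σ k

/-- The density associated with the perturbation `σ`. -/
def pertDensity (ε : ℝ) (a : Fin d → Freq d → ℂ) (σ : Freq d → ℂ) (k : Freq d) : ℂ :=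
  oneSeq k + ((ε ^ 2 : ℝ) : ℂ) * pertFluct a σ k

/-- The corrector in the density yields exactly the Euler pressure force, and what remains is
divisible by `ε`. -/
lemma epVelocity_pert (hε : ε ≠ 0) {a u : Fin d → Freq d → ℂ} {σ : Freq d → ℂ}
    (ha : ∀ i, SobBound 2 (a i) A) (hu : ∀ i, SobBound 2 (u i) Y) (i : Fin d) (k : Freq d) :
    epVelocity ε (pertVelocity ε a u) (pertDensity ε a σ) i k =
      eulerField a i k + ε * velField ε a u σ i k := by
  have hε' : (ε : ℂ) ≠ 0 := by exact_mod_cast hε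
  have hd1 : ∀ {f : Freq d → ℂ} {R : ℝ} (j : Fin d), SobBound 2 f R →
      SobBound 1 (dseq j f) (2 * Real.pi * R) := fun j hf => hf.dseq j
  have hb : ∀ j, SobBound 2 (pertVelocity ε a u j) (A + ‖(ε : ℂ)‖ * Y) := fun j =>
    (ha j).add ((hu j).smul _)
  have h1 : ∀ j, conv (pertVelocity ε a u j) (dseq j (pertVelocity ε a u i)) k =
      conv (a j) (dseq j (a i)) k + ε * (conv (fun l => a j l + ε * u j l) (dseq j (u i)) k +
        conv (u j) (dseq j (a i)) k) := by
    intro j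
    have e1 : dseq j (pertVelocity ε a u i) = fun l => dseq j (a i) l + ε * dseq j (u i) l := by
      funext l
      simp only [dseq, pertVelocity]
      ring
    rw [e1, conv_add_right (hb j) (hd1 j (ha i)) ((hd1 j (hu i)).smul _), conv_smul_right]
    have e2 : conv (pertVelocity ε a u j) (dseq j (a i)) k =
        conv (a j) (dseq j (a i)) k + ε * conv (u j) (dseq j (a i)) k := by
      rw [← conv_smul_left, ← conv_add_left (ha j) ((hu j).smul _) (hd1 j (ha i))]
      rfl
    rw [e2]
    change _ + _ * conv (fun l => a j l + ε * u j l) (dseq j (u i)) k = _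
    ring
  have h2 : Complex.I * dir k i * ((((ε ^ 2)⁻¹ : ℝ) : ℂ) *
      (pertDensity ε a σ k / (2 * Real.pi * modulus k))) =
      Complex.I * dir k i * (pressureSource a k / (2 * Real.pi * modulus k)) +
        ε * (Complex.I * dir k i * σ k / ε) := by
    rcases eq_or_ne k 0 with rfl | hk
    · simp [dir]
    have hk' : ((modulus k : ℝ) : ℂ) ≠ 0 := by exact_mod_cast (modulus_pos hk).ne'
    have hπ : ((Real.pi : ℝ) : ℂ) ≠ 0 := by exact_mod_cast Real.pi_ne_zero
    simp only [pertDensity, pertFluct, oneSeq, absD, if_neg hk, zero_add]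
    push_cast
    field_simp
  rw [epVelocity, h2]
  simp only [h1, Finset.sum_add_distrib, ← Finset.mul_sum, eulerField, velField]
  ring

/-- The flux of the constant density along `a` disappears by incompressibility, and the flux along
`ε u` gives the singular term. The zero mode is excluded because `|D|` is not invertible there. -/
lemma epDensity_pert (hε : ε ≠ 0) {a u : Fin d → Freq d → ℂ} {σ : Freq d → ℂ}
    (ha : ∀ i, SobBound 3 (a i) A) (hu : ∀ i, SobBound 2 (u i) Y) (hσ : SobBound 2 σ Y)
    {B : ℝ} (hq : SobBound 2 (pressureSource a) B)
    (hdiv : ∀ k, ∑ j, (k j : ℂ) * a j k = 0) {k : Freq d} (hk : k ≠ 0) :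
    epDensity (pertVelocity ε a u) (pertDensity ε a σ) k =
      ((ε ^ 2 : ℝ) : ℂ) * (pressureSourceDot a k +
        2 * Real.pi * modulus k * fieldField ε a (pressureSource a) (fieldSource a) u σ k) := by
  have hε' : (ε : ℂ) ≠ 0 := by exact_mod_cast hε
  have hk' : ((modulus k : ℝ) : ℂ) ≠ 0 := by exact_mod_cast (modulus_pos hk).ne'
  have hπ : ((Real.pi : ℝ) : ℂ) ≠ 0 := by exact_mod_cast Real.pi_ne_zero
  have hb : ∀ j, SobBound 2 (pertVelocity ε a u j) (A + ‖(ε : ℂ)‖ * Y) := fun j =>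
    ((ha j).of_le (by norm_num)).add ((hu j).smul _)
  have hσ' : SobBound 1 (absD σ) (2 * Real.pi * Y) := hσ.absD
  have h1 : ∀ j, conv (pertVelocity ε a u j) (pertDensity ε a σ) k =
      (a j k + ε * u j k) + ε ^ 2 * (conv (a j) (pressureSource a) k +
        ε * conv (u j) (pressureSource a) k +
        conv (fun l => a j l + ε * u j l) (absD σ) k) := by
    intro j
    have e1 : conv (pertVelocity ε a u j) (pertDensity ε a σ) k =
        conv (pertVelocity ε a u j) oneSeq k + ((ε ^ 2 : ℝ) : ℂ) *
          (conv (pertVelocity ε a u j) (pressureSource a) k +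
            conv (pertVelocity ε a u j) (absD σ) k) := by
      rw [← conv_add_right (hb j) (hq.of_le (show 1 ≤ 2 by norm_num)) hσ', ← conv_smul_right,
        ← conv_add_right (hb j) (sobBound_oneSeq 1)
          (((hq.of_le (show 1 ≤ 2 by norm_num)).add hσ').smul _)]
      rfl
    have e2 : conv (pertVelocity ε a u j) (pressureSource a) k =
        conv (a j) (pressureSource a) k + ε * conv (u j) (pressureSource a) k := by
      rw [← conv_smul_left, ← conv_add_left (ha j) ((hu j).smul _) hq]
      rfl
    rw [e1, e2, conv_oneSeq]
    push_cast
    rfl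
  have hdir : ∀ j, (modulus k : ℂ) * dir k j = k j := fun j => by
    rw [mul_comm, ← Complex.ofReal_mul, dir_mul_modulus]
    simp
  have h2 : 2 * Real.pi * modulus k * fieldField ε a (pressureSource a) (fieldSource a) u σ k =
      -∑ j, 2 * Real.pi * Complex.I * k j * (conv (fun l => a j l + ε * u j l) (absD σ) k +
        ε * conv (u j) (pressureSource a) k + u j k / ε + conv (a j) (pressureSource a) k) -
      pressureSourceDot a k := by
    have e : 2 * Real.pi * modulus k * (pressureSourceDot a k / (2 * Real.pi * modulus k)) =
        pressureSourceDot a k := by field_simp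
    rw [fieldField, fieldSource, mul_sub, mul_add, e, mul_neg, Finset.mul_sum, Finset.mul_sum,
      sub_add_eq_sub_sub_swap, ← neg_add', ← Finset.sum_add_distrib]
    congr 2
    refine Finset.sum_congr rfl fun j _ => ?_
    rw [← hdir j]
    ring
  have h3 : ∑ j, 2 * Real.pi * Complex.I * k j * a j k = 0 := by
    have := congrArg (fun z => 2 * Real.pi * Complex.I * z) (hdiv k)
    simpa only [Finset.mul_sum, mul_assoc, mul_zero] using this
  rw [h2, epDensity]
  simp only [dseq, h1]
  have h4 : ∀ j, 2 * Real.pi * Complex.I * k j * ((a j k + ε * u j k) +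
      (ε : ℂ) ^ 2 * (conv (a j) (pressureSource a) k + ε * conv (u j) (pressureSource a) k +
        conv (fun l => a j l + ε * u j l) (absD σ) k)) =
      2 * Real.pi * Complex.I * k j * a j k + (ε : ℂ) ^ 2 * (2 * Real.pi * Complex.I * k j *
        (conv (fun l => a j l + ε * u j l) (absD σ) k + ε * conv (u j) (pressureSource a) k +
          u j k / ε + conv (a j) (pressureSource a) k)) := fun j => by
    field_simp
    ring
  rw [Finset.sum_congr rfl fun j _ => h4 j, Finset.sum_add_distrib, h3, zero_add, ← Finset.mul_sum]
  push_cast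
  ring

lemma sobBound_pertFluct {m : ℕ} {a : Fin d → Freq d → ℂ} {σ : Freq d → ℂ} {B : ℝ}
    (hq : SobBound (m + 1) (pressureSource a) B) (hσ : SobBound (m + 1) σ Y) :
    SobBound m (pertFluct a σ) (B + 2 * Real.pi * Y) :=
  (hq.of_le (Nat.le_succ m)).add hσ.absD

lemma pressureSource_zero {a : Fin d → Freq d → ℂ} (ha : ∀ i, SobBound 2 (a i) A)
    (hdiv : ∀ k, ∑ j, (k j : ℂ) * a j k = 0) : pressureSource a 0 = 0 := by
  rw [pressureSource_eq ha hdiv]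
  simp

/-- A perturbation of an incompressible flow gives a solution of the Euler–Poisson system. -/
lemma IsEulerFlow.isEPFlow (hd : d ≤ 3) (hε : ε ≠ 0) (ha : IsEulerFlow 4 T A a)
    (hur : ∀ t ∈ Set.Icc 0 T, ∀ i, IsRealSeq (u t i)) (hσr : ∀ t ∈ Set.Icc 0 T, IsRealSeq (σ t))
    (hu : ∀ t ∈ Set.Icc 0 T, ∀ i, SobBound 3 (u t i) Y)
    (hσ : ∀ t ∈ Set.Icc 0 T, SobBound 3 (σ t) Y)
    (hu' : ∀ t ∈ Set.Icc 0 T, ∀ i k, HasDerivWithinAt (fun τ => u τ i k)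
      (velField ε (a t) (u t) (σ t) i k) (Set.Icc 0 T) t)
    (hσ' : ∀ t ∈ Set.Icc 0 T, ∀ k, HasDerivWithinAt (fun τ => σ τ k)
      (fieldField ε (a t) (pressureSource (a t)) (fieldSource (a t)) (u t) (σ t) k)
        (Set.Icc 0 T) t) :
    ∃ R, IsEPFlow ε T R (fun t => pertVelocity ε (a t) (u t))
      fun t => pertDensity ε (a t) (σ t) := by
  obtain ⟨B, hB⟩ := exists_sobBound_pressureSource hd (m := 3) (by norm_num) A
  have hq : ∀ t ∈ Set.Icc 0 T, SobBound 3 (pressureSource (a t)) B := fun t ht =>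
    hB (a t) (ha.sobBound t ht)
  have hmass : ∀ t ∈ Set.Icc 0 T, pertDensity ε (a t) (σ t) 0 = 1 := fun t ht => by
    rw [pertDensity, pertFluct, pressureSource_zero
      (fun i => (ha.sobBound t ht i).of_le (by norm_num)) (ha.div_free t ht)]
    simp [oneSeq, absD, modulus_zero]
  refine ⟨(|A| + ‖(ε : ℂ)‖ * Y) + (1 + ‖((ε ^ 2 : ℝ) : ℂ)‖ * (B + 2 * Real.pi * Y)),
    fun t ht i => ?_, fun t ht => ?_, fun t ht i => ?_, fun t ht => ?_, hmass,
    fun i k t ht => ?_, fun k t ht => ?_⟩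
  · have h1 := (hq t ht).1
    have h2 := (hσ t ht).1
    exact ((((ha.sobBound t ht i).of_le (by norm_num)).mono (le_abs_self A)).add
      ((hu t ht i).smul _)).mono
      (le_add_of_nonneg_right (by positivity))
  · have h1 := (hσ t ht).1
    have h2 : 0 ≤ |A| + ‖(ε : ℂ)‖ * Y := by positivity
    exact ((sobBound_oneSeq 2).add ((sobBound_pertFluct (hq t ht) (hσ t ht)).smul _)).mono
      (le_add_of_nonneg_left h2)
  · exact (ha.real t ht i).add ((hur t ht i).smul ε)
  · exact isRealSeq_oneSeq.add (((isRealSeq_pressureSource (ha.real t ht)).add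
      (hσr t ht).absD).smul _)
  · refine ((ha.hasDeriv i k t ht).add ((hu' t ht i k).const_mul (ε : ℂ))).congr_deriv ?_
    exact (epVelocity_pert hε (fun i => (ha.sobBound t ht i).of_le (by norm_num))
      (fun i => (hu t ht i).of_le (by norm_num)) i k).symm
  · rcases eq_or_ne k 0 with rfl | hk
    -- At the zero frequency the mass is constant and the divergence has no such mode.
    · refine ((hasDerivWithinAt_const t _ (1 : ℂ)).congr hmass (hmass t ht)).congr_deriv ?_
      simp [epDensity, dseq]
    · rw [epDensity_pert hε (fun i => (ha.sobBound t ht i).of_le (by norm_num))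
        (fun i => (hu t ht i).of_le (by norm_num)) ((hσ t ht).of_le (by norm_num))
        ((hq t ht).of_le (by norm_num)) (ha.div_free t ht) hk]
      exact ((((ha.hasDerivWithinAt_pressureSource hd le_rfl k ht).add
        ((hσ' t ht k).const_mul _)).const_mul _).const_add _)

end Perturbation

/-! ### Solutions near the Euler flow -/

lemma coef_sub_one_zero {f : Torus d → ℝ} (hf : Integrable f (torusMeasure d))
    (h : ∫ x, f x ∂torusMeasure d = 1) (c : ℝ) : coef (fun x => c * (f x - 1)) 0 = 0 := by
  rw [coef_eq]
  simp only [neg_zero, chr_zero, one_mul]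
  have h1 : ∫ x, ((c * (f x - 1) : ℝ) : ℂ) ∂torusMeasure d =
      ((∫ x, c * (f x - 1) ∂torusMeasure d : ℝ) : ℂ) := integral_ofReal
  rw [h1, integral_const_mul, integral_sub hf (integrable_const 1), h]
  simp

/-- The bound for the rescaled perturbation at time `t`. -/
def pertBound (d s : ℕ) (A : ℝ → ℝ) (ε M y t : ℝ) : ℝ :=
  A t + (d + 2 * Real.pi) * Real.sqrt ((1 + y) * Real.exp (energyRate d s A ε M t * t))

set_option maxHeartbeats 1000000 in
/-- The solution of the Euler–Poisson system near an incompressible flow. -/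
lemma exists_isEPSolution (hd : d ≤ 3) {s : ℕ} (hs : 3 ≤ s) {T : EReal}
    {vbar₀ : Torus d → Fin d → ℝ} {vbar : ℝ → Torus d → Fin d → ℝ} {p : ℝ → Torus d → ℝ}
    (hE : IsEulerSolution T vbar₀ vbar p) {T₁ : ℝ} (hT₁ : 0 < T₁) (hT : (T₁ : EReal) ≤ T)
    {A : ℝ → ℝ} (hA : MonotoneOn A (Set.Icc 0 T₁)) {a : ℝ → Fin d → Freq d → ℂ}
    (hadef : ∀ t i, a t i = coef fun x => vbar t x i)
    (ha : ∀ t ∈ Set.Icc 0 T₁, ∀ i, SobBound (s + 1) (a t i) (A t))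
    (hq : ∀ t ∈ Set.Icc 0 T₁, SobBound s (pressureSource (a t)) (A t))
    (hh : ∀ t ∈ Set.Icc 0 T₁, SobBound s (fieldSource (a t)) (A t))
    {ε C M : ℝ} (hε : 0 < ε) (hM : 0 < M) {v₀ : Torus d → Fin d → ℝ} {ρ₀ : Torus d → ℝ}
    (hρ₀ : ∀ᵐ x ∂torusMeasure d, 0 ≤ ρ₀ x) (hmass : ∫ x, ρ₀ x ∂torusMeasure d = 1)
    (hprep : BoundedPair s (fun x i => ε⁻¹ * (v₀ x i - vbar₀ x i))
      (fun x => (ε ^ 2)⁻¹ * (ρ₀ x - 1)) C)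
    (hgrow : (1 + (d * C ^ 2 + (C + A 0) ^ 2)) * Real.exp (energyRate d s A ε M T₁ * T₁) ≤ 1 + M) :
    ∃ (v : ℝ → Torus d → Fin d → ℝ) (ρ : ℝ → Torus d → ℝ), IsEPSolution ε T₁ v₀ ρ₀ v ρ ∧
      (∃ C', ∀ t ∈ Set.Icc 0 T₁, BoundedPair s (v t) (ρ t) C') ∧
      ∀ t ∈ Set.Icc 0 T₁, BoundedPair s (fun x i => ε⁻¹ * (v t x i - vbar t x i))
        (fun x => (ε ^ 2)⁻¹ * (ρ t x - 1))
        (pertBound d s A ε M (d * C ^ 2 + (C + A 0) ^ 2) t) := by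
  obtain ⟨m, rfl⟩ : ∃ m, s = m + 1 := ⟨s - 1, by omega⟩
  have hm : 2 ≤ m := by omega
  have h0T : (0 : ℝ) ∈ Set.Icc 0 T₁ := ⟨le_rfl, hT₁.le⟩
  have hTT : T₁ ∈ Set.Icc 0 T₁ := ⟨hT₁.le, le_rfl⟩
  have hsub : Set.Icc 0 T₁ ⊆ timeInterval T := fun t ht =>
    ⟨ht.1, (EReal.coe_le_coe_iff.mpr ht.2).trans hT⟩
  have hflow : IsEulerFlow (m + 1 + 1) T₁ (A T₁) a := by
    have hadef' : a = fun t i => coef fun x => vbar t x i := funext fun t => funext (hadef t)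
    rw [hadef']
    refine hE.isEulerFlow hd (by omega) hT₁ hT fun t ht i => ?_
    rw [← hadef]
    exact (ha t ht i).mono (hA ht hTT ht.2)
  have hvbar : ∀ t ∈ Set.Icc 0 T₁, ∀ x i, vbar t x i = (synth (a t i) x).re := fun t ht x i => by
    have h := (ha t ht i).summable_norm hd (by omega)
    rw [hadef] at h ⊢
    exact eq_re_synth_coef ((hE.velocity_regular i).2.1 t (hsub ht)).continuous h x
  have hsa : ∀ t ∈ Set.Icc 0 T₁, ∀ i, Summable fun k => ‖a t i k‖ := fun t ht i =>
    (ha t ht i).summable_norm hd (by omega)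
  have hA0 : 0 ≤ A 0 := (hq 0 h0T).1
  obtain ⟨⟨hvm, hvn⟩, hρm, hρn⟩ := hprep
  set u₀ : Fin d → Freq d → ℂ := fun i => coef fun x => ε⁻¹ * (v₀ x i - vbar₀ x i) with hu₀
  set n₀ : Freq d → ℂ := coef fun x => (ε ^ 2)⁻¹ * (ρ₀ x - 1) with hn₀
  have hu₀b : ∀ i, SobBound (m + 1) (u₀ i) C := fun i =>
    (hvm i).sobBound ((hsNorm_le_hsNormVec _ i).trans hvn)
  have hn₀b : SobBound m n₀ C := hρm.sobBound hρn
  -- Chosen so that corrector plus `|D| σ₀` is the given fluctuation `n₀`. Inverting `|D|` lifts the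
  -- density data from `H^(s-1)` to the `H^s` level of the velocity.
  set σ₀ : Freq d → ℂ := fun k => (n₀ k - pressureSource (a 0) k) / (2 * Real.pi * modulus k)
    with hσ₀
  have hσ₀b : SobBound (m + 1) σ₀ (C + A 0) :=
    (hn₀b.sub ((hq 0 h0T).of_le (Nat.le_succ m))).div_modulus
  have hy₀ : ∀ S : Finset (Freq d), (∑ i, ∑ k ∈ S, jb k ^ (2 * (m + 1)) * ‖u₀ i k‖ ^ 2) +
      ∑ k ∈ S, jb k ^ (2 * (m + 1)) * ‖σ₀ k‖ ^ 2 ≤ d * C ^ 2 + (C + A 0) ^ 2 := by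
    intro S
    refine add_le_add ?_ (hσ₀b.2 S)
    refine (Finset.sum_le_card_nsmul _ _ _ fun i _ => (hu₀b i).2 S).trans (le_of_eq ?_)
    simp
  obtain ⟨u, σ, hu0, hσ0, hsol⟩ := exists_perturbation (a := a) (u₀ := u₀) (σ₀ := σ₀)
    (q := fun t => pressureSource (a t)) (h := fun t => fieldSource (a t)) hd hs hT₁.le hA
    hflow.continuousOn (hflow.continuousOn_pressureSource hd (by omega))
    (hflow.continuousOn_fieldSource hd (by omega)) hflow.real
    (fun t ht => isRealSeq_pressureSource (hflow.real t ht))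
    (fun t ht => isRealSeq_fieldSource (hflow.real t ht)) ha hq hh hε hM
    (fun i => isRealSeq_coef _)
    (((isRealSeq_coef _).sub (isRealSeq_pressureSource (hflow.real 0 h0T))).div_modulus) hy₀ hgrow
  set Y : ℝ → ℝ := fun t => Real.sqrt ((1 + (d * C ^ 2 + (C + A 0) ^ 2)) *
    Real.exp (energyRate d (m + 1) A ε M t * t)) with hY
  have hY0 : ∀ t, 0 ≤ Y t := fun t => Real.sqrt_nonneg _
  have hYM : ∀ t ∈ Set.Icc 0 T₁, Y t ≤ Real.sqrt (1 + M) := by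
    intro t ht
    refine Real.sqrt_le_sqrt (le_trans ?_ hgrow)
    have h1 := energyConst_nonneg d (m + 1)
    have h2 := (hq t ht).1
    have h3 := hA ht hTT ht.2
    have h4 := ht.1
    have h5 := ht.2
    have h6 : 0 ≤ energyRate d (m + 1) A ε M t := by unfold energyRate; positivity
    have h7 : energyRate d (m + 1) A ε M t ≤ energyRate d (m + 1) A ε M T₁ := by
      unfold energyRate
      gcongr
    gcongr
    exact h6.trans h7
  have hur : ∀ t ∈ Set.Icc 0 T₁, ∀ i, IsRealSeq (u t i) := fun t ht => (hsol t ht).1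
  have hσr : ∀ t ∈ Set.Icc 0 T₁, IsRealSeq (σ t) := fun t ht => (hsol t ht).2.1
  have hub : ∀ t ∈ Set.Icc 0 T₁, ∀ i, SobBound (m + 1) (u t i) (Y t) := fun t ht =>
    (hsol t ht).2.2.1
  have hσb : ∀ t ∈ Set.Icc 0 T₁, SobBound (m + 1) (σ t) (Y t) := fun t ht => (hsol t ht).2.2.2.1
  have hflow4 : IsEulerFlow 4 T₁ (A T₁) a :=
    ⟨fun t ht i => (hflow.sobBound t ht i).of_le (by omega), hflow.real, hflow.div_free,
      hflow.hasDeriv⟩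
  obtain ⟨R, hR⟩ := hflow4.isEPFlow hd hε.ne' hur hσr (Y := Real.sqrt (1 + M))
    (fun t ht i => ((hub t ht i).of_le (by omega)).mono (hYM t ht))
    (fun t ht => ((hσb t ht).of_le (by omega)).mono (hYM t ht))
    (fun t ht i k => ((hsol t ht).2.2.2.2 k).1 i) (fun t ht k => ((hsol t ht).2.2.2.2 k).2)
  have hsu : ∀ t ∈ Set.Icc 0 T₁, ∀ i, Summable fun k => ‖u t i k‖ := fun t ht i =>
    (hub t ht i).summable_norm hd (by omega)
  have hfl : ∀ t ∈ Set.Icc 0 T₁, SobBound m (pertFluct (a t) (σ t)) (A t + 2 * Real.pi * Y t) :=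
    fun t ht => sobBound_pertFluct (hq t ht) (hσb t ht)
  have hflr : ∀ t ∈ Set.Icc 0 T₁, IsRealSeq (pertFluct (a t) (σ t)) := fun t ht =>
    (isRealSeq_pressureSource (hflow.real t ht)).add (hσr t ht).absD
  have hvel : ∀ t ∈ Set.Icc 0 T₁, ∀ x i, (synth (pertVelocity ε (a t) (u t) i) x).re =
      vbar t x i + ε * (synth (u t i) x).re := fun t ht x i => by
    have e : synth (pertVelocity ε (a t) (u t) i) x = synth (a t i) x + ε * synth (u t i) x := by
      rw [← synth_smul, ← synth_add (hsa t ht i)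
        (((hub t ht i).smul _).summable_norm hd (by omega))]
      rfl
    rw [e, hvbar t ht x i, Complex.add_re, Complex.re_ofReal_mul]
  have hden : ∀ t ∈ Set.Icc 0 T₁, ∀ x, (synth (pertDensity ε (a t) (σ t)) x).re =
      1 + ε ^ 2 * (synth (pertFluct (a t) (σ t)) x).re := fun t ht x => by
    have e : synth (pertDensity ε (a t) (σ t)) x =
        synth oneSeq x + ((ε ^ 2 : ℝ) : ℂ) * synth (pertFluct (a t) (σ t)) x := by
      rw [← synth_smul, ← synth_add ((sobBound_oneSeq 2).summable_norm hd le_rfl)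
        (((hfl t ht).smul _).summable_norm hd hm)]
      rfl
    rw [e, synth_oneSeq, Complex.add_re, Complex.re_ofReal_mul, Complex.one_re]
  refine ⟨fun t x i => (synth (pertVelocity ε (a t) (u t) i) x).re,
    fun t x => (synth (pertDensity ε (a t) (σ t)) x).re,
    hR.isEPSolution hd hε.ne' ?_ ?_ hρ₀, ?_, fun t ht => ?_⟩
  · have h1 : ∀ i, (fun x => ε⁻¹ * (v₀ x i - vbar₀ x i)) =ᵐ[torusMeasure d]
        fun x => (synth (u₀ i) x).re := fun i =>
      ae_eq_re_synth_coef (hvm i).1 ((hu₀b i).summable_norm hd (by omega))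
    have h2 : ∀ᵐ x ∂torusMeasure d, ∀ i, ε⁻¹ * (v₀ x i - vbar₀ x i) = (synth (u₀ i) x).re :=
      ae_all_iff.mpr h1
    filter_upwards [h2] with x hx
    funext i
    rw [hvel 0 h0T, hu0, ← hx i, hE.initial]
    field_simp
    ring
  · have h1 := ae_eq_re_synth_coef hρm.1 (hn₀b.summable_norm hd hm)
    have h2 : pertFluct (a 0) (σ 0) = n₀ := by
      funext k
      rw [hσ0, pertFluct, absD, hσ₀]
      rcases eq_or_ne k 0 with rfl | hk
      -- At the zero frequency both `n₀` and the pressure source vanish. Integrability comes from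
      -- the mass condition, since the integral of a nonintegrable function is `0`.
      · have hρi : Integrable ρ₀ (torusMeasure d) := by
          by_contra hni
          rw [integral_undef hni] at hmass
          exact zero_ne_one hmass
        rw [pressureSource_zero (fun i => (ha 0 h0T i).of_le (by omega)) (hflow.div_free 0 h0T),
          hn₀, coef_sub_one_zero hρi hmass]
        simp [modulus_zero]
      · have hk' : ((modulus k : ℝ) : ℂ) ≠ 0 := by exact_mod_cast (modulus_pos hk).ne'
        have hπ : ((Real.pi : ℝ) : ℂ) ≠ 0 := by exact_mod_cast Real.pi_ne_zero
        field_simp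
        ring
    filter_upwards [h1] with x hx
    rw [hden 0 h0T, h2, ← hx]
    field_simp
    ring
  · refine ⟨d * (A T₁ + ‖(ε : ℂ)‖ * Real.sqrt (1 + M)) + (1 + ‖((ε ^ 2 : ℝ) : ℂ)‖ *
      (A T₁ + 2 * Real.pi * Real.sqrt (1 + M))), fun t ht => ?_⟩
    have hAT : 0 ≤ A T₁ := (hq T₁ hTT).1
    have hb : ∀ i, SobBound (m + 1) (pertVelocity ε (a t) (u t) i)
        (A T₁ + ‖(ε : ℂ)‖ * Real.sqrt (1 + M)) := fun i =>
      ((hflow.sobBound t ht i).of_le (by omega)).add (((hub t ht i).mono (hYM t ht)).smul _)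
    have hg : SobBound m (pertDensity ε (a t) (σ t)) (1 + ‖((ε ^ 2 : ℝ) : ℂ)‖ *
        (A T₁ + 2 * Real.pi * Real.sqrt (1 + M))) := by
      refine (sobBound_oneSeq m).add (((hfl t ht).mono ?_).smul _)
      have h1 := hA ht hTT ht.2
      have h2 := hYM t ht
      gcongr
    have hv1 := fun i => memHs_re_synth ((hb i).summable_norm hd (by omega))
      (hR.real_velocity t ht i) (hb i)
    have hr1 := memHs_re_synth (hg.summable_norm hd hm) (hR.real_density t ht) hg
    refine ⟨⟨fun i => (hv1 i).1, (hsNormVec_le (by positivity) fun i => (hv1 i).2).trans ?_⟩,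
      hr1.1, hr1.2.trans ?_⟩
    · exact le_add_of_nonneg_right (by positivity)
    · exact le_add_of_nonneg_left (by positivity)
  · have hAt : 0 ≤ A t := (hq t ht).1
    have e1 : (fun x i => ε⁻¹ * ((synth (pertVelocity ε (a t) (u t) i) x).re - vbar t x i)) =
        fun x i => (synth (u t i) x).re := by
      funext x i
      rw [hvel t ht]
      field_simp
      ring
    have e2 : (fun x => (ε ^ 2)⁻¹ * ((synth (pertDensity ε (a t) (σ t)) x).re - 1)) =
        fun x => (synth (pertFluct (a t) (σ t)) x).re := by
      funext x
      rw [hden t ht]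
      field_simp
      ring
    have hv1 := fun i => memHs_re_synth (hsu t ht i) (hur t ht i) (hub t ht i)
    have hr1 := memHs_re_synth ((hfl t ht).summable_norm hd hm) (hflr t ht) (hfl t ht)
    rw [e1, e2]
    have hYt := hY0 t
    refine ⟨⟨fun i => (hv1 i).1, (hsNormVec_le (hY0 t) fun i => (hv1 i).2).trans ?_⟩,
      hr1.1, hr1.2.trans ?_⟩
    · change d * Y t ≤ A t + (d + 2 * Real.pi) * Y t
      have : 0 ≤ 2 * Real.pi * Y t := by positivity
      nlinarith
    · change A t + 2 * Real.pi * Y t ≤ A t + (d + 2 * Real.pi) * Y t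
      have : 0 ≤ d * Y t := by positivity
      nlinarith

lemma BoundedPair.mono {s : ℕ} {v : Torus d → Fin d → ℝ} {ρ : Torus d → ℝ} {C C' : ℝ}
    (h : BoundedPair s v ρ C) (hC : C ≤ C') : BoundedPair s v ρ C' :=
  ⟨⟨h.1.1, h.1.2.trans hC⟩, h.2.1, h.2.2.trans hC⟩

/-! ### Choice of the times of existence -/

/-- A flow in `L^∞_loc(H^(s+1))` has a monotone bound for its coefficients and its sources. -/
lemma exists_monotone_bound (hd : d ≤ 3) {s : ℕ} (hs : 3 ≤ s) {T : EReal} (hT : 0 < T)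
    {vbar : ℝ → Torus d → Fin d → ℝ}
    (hvbar : ∀ T' : ℝ, (T' : EReal) ≤ T → ∃ C : ℝ, ∀ t ∈ Set.Icc 0 T',
      MemHsVec (s + 1) (vbar t) ∧ hsNormVec (s + 1) (vbar t) ≤ C) :
    ∃ A : ℝ → ℝ, Monotone A ∧ (∀ t, 0 ≤ A t) ∧ ∀ t ∈ timeInterval T,
      (∀ i, SobBound (s + 1) (coef fun x => vbar t x i) (A t)) ∧
      SobBound s (pressureSource fun i => coef fun x => vbar t x i) (A t) ∧
      SobBound s (fieldSource fun i => coef fun x => vbar t x i) (A t) := by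
  obtain ⟨m, rfl⟩ : ∃ m, s = m + 1 := ⟨s - 1, by omega⟩
  have h1 : ∀ n : ℕ, ∃ C : ℝ, ∀ t ∈ Set.Icc (0 : ℝ) n, (t : EReal) ≤ T →
      MemHsVec (m + 1 + 1) (vbar t) ∧ hsNormVec (m + 1 + 1) (vbar t) ≤ C := by
    intro n
    induction T using EReal.rec with
    | bot => exact absurd hT (by simp)
    | coe r =>
      obtain ⟨C, hC⟩ := hvbar r le_rfl
      exact ⟨C, fun t ht htr => hC t ⟨ht.1, EReal.coe_le_coe_iff.mp htr⟩⟩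
    | top =>
      obtain ⟨C, hC⟩ := hvbar n le_top
      exact ⟨C, fun t ht _ => hC t ht⟩
  have h2 : ∀ n : ℕ, ∃ B : ℝ, 0 ≤ B ∧ ∀ t ∈ Set.Icc (0 : ℝ) n, (t : EReal) ≤ T →
      (∀ i, SobBound (m + 1 + 1) (coef fun x => vbar t x i) B) ∧
      SobBound (m + 1) (pressureSource fun i => coef fun x => vbar t x i) B ∧
      SobBound (m + 1) (fieldSource fun i => coef fun x => vbar t x i) B := by
    intro n
    obtain ⟨C, hC⟩ := h1 n
    obtain ⟨B, hB⟩ := exists_sobBound_pressureSource hd (m := m + 1) (by omega) C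
    obtain ⟨B', hB'⟩ := exists_sobBound_fieldSource hd (m := m) (by omega) C
    refine ⟨|C| + |B| + |B'|, by positivity, fun t ht htT => ?_⟩
    have hc : ∀ i, SobBound (m + 1 + 1) (coef fun x => vbar t x i) C := fun i =>
      ((hC t ht htT).1 i).sobBound ((hsNorm_le_hsNormVec (vbar t) i).trans (hC t ht htT).2)
    have e1 := le_abs_self C
    have e2 := le_abs_self B
    have e3 := le_abs_self B'
    have e4 := abs_nonneg C
    have e5 := abs_nonneg B
    have e6 := abs_nonneg B'
    exact ⟨fun i => (hc i).mono (by linarith), (hB _ hc).mono (by linarith),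
      (hB' _ hc).mono (by linarith)⟩
  choose B hB0 hB using h2
  -- The bounds on `[0, n]` are nonnegative; summing them up to the ceiling of `t` gives a monotone
  -- function above each of them.
  refine ⟨fun t => ∑ n ∈ Finset.range (⌈t⌉₊ + 1), B n, fun t t' htt' => ?_,
    fun t => Finset.sum_nonneg fun n _ => hB0 n, fun t ht => ?_⟩
  · refine Finset.sum_le_sum_of_subset_of_nonneg (Finset.range_mono ?_) fun n _ _ => hB0 n
    have := Nat.ceil_mono htt'
    omega
  · have hle : B ⌈t⌉₊ ≤ ∑ n ∈ Finset.range (⌈t⌉₊ + 1), B n :=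
      Finset.single_le_sum (f := B) (fun n _ => hB0 n) (Finset.self_mem_range_succ _)
    have h3 := hB ⌈t⌉₊ t ⟨ht.1, Nat.le_ceil t⟩ ht.2
    exact ⟨fun i => (h3.1 i).mono hle, h3.2.1.mono hle, h3.2.2.mono hle⟩

/-- Target times for the construction: for finite `T` the end point itself is attainable, so a
constant sequence works; otherwise they increase to infinity. -/
lemma exists_times {T : EReal} (hT : 0 < T) : ∃ τ : ℕ → ℝ, Monotone τ ∧ (∀ n, 0 < τ n) ∧
    (∀ n, (τ n : EReal) ≤ T) ∧ ∀ T' : ℝ, (T' : EReal) < T → ∃ n, T' ≤ τ n := by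
  induction T using EReal.rec with
  | bot => exact absurd hT (by simp)
  | coe r =>
    exact ⟨fun _ => r, monotone_const, fun _ => by exact_mod_cast hT, fun _ => le_rfl,
      fun T' h => ⟨0, (EReal.coe_lt_coe_iff.mp h).le⟩⟩
  | top =>
    refine ⟨fun n => n + 1, fun m n h => ?_, fun n => by positivity, fun n => le_top,
      fun T' _ => ?_⟩
    · have : (m : ℝ) ≤ n := by exact_mod_cast h
      simpa using this
    · obtain ⟨n, hn⟩ := exists_nat_ge T'
      exact ⟨n, by linarith⟩

/-- The bound on the rescaled perturbation that holds for small `ε`. -/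
def smallBound (d s : ℕ) (A : ℝ → ℝ) (y t : ℝ) : ℝ :=
  A t + (d + 2 * Real.pi) *
    Real.sqrt ((1 + y) * Real.exp (energyConst d s * (1 + A t) * 2 * t))

/-- The size that the energy reaches up to the time `t`. -/
def smallEnergy (d s : ℕ) (A : ℝ → ℝ) (y t : ℝ) : ℝ :=
  (1 + y) * Real.exp (energyConst d s * (1 + A t) * 2 * t)

lemma smallBound_mono {s : ℕ} {A : ℝ → ℝ} (hA : Monotone A) (hA0 : ∀ t, 0 ≤ A t) {y : ℝ}
    (hy : 0 ≤ y) {t t' : ℝ} (ht : 0 ≤ t) (h : t ≤ t') :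
    smallBound d s A y t ≤ smallBound d s A y t' := by
  have h1 := energyConst_nonneg d s
  have h2 := hA h
  have h3 := hA0 t
  have h4 := hA0 t'
  unfold smallBound
  gcongr

/-- Once `ε` is small relative to `M`, the rate no longer involves `M`. This breaks the circularity
between the energy allowed and the growth it produces. -/
lemma energyRate_le_of_small {s : ℕ} {A : ℝ → ℝ} (hA0 : ∀ t, 0 ≤ A t) {ε M t : ℝ}
    (hε : ε * (1 + Real.sqrt (2 * M)) ≤ 1) :
    energyRate d s A ε M t ≤ energyConst d s * (1 + A t) * 2 := by
  have h1 := energyConst_nonneg d s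
  have h2 := hA0 t
  unfold energyRate
  gcongr
  linarith

/-- For values of `ε` that are not small: with `M = (1 + y) e`, a time on which rate times length is
at most `1` suffices. -/
lemma exists_short_time {s : ℕ} {A : ℝ → ℝ} (hA : Monotone A) (hA0 : ∀ t, 0 ≤ A t) {y ε τ : ℝ}
    (hy : 0 ≤ y) (hε : 0 < ε) (hτ : 0 < τ) : ∃ M T₁, 0 < M ∧ 0 < T₁ ∧ T₁ ≤ τ ∧
      (1 + y) * Real.exp (energyRate d s A ε M T₁ * T₁) ≤ 1 + M := by
  set M := (1 + y) * Real.exp 1 with hM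
  have hC := energyConst_nonneg d s
  have hr : ∀ t, 0 ≤ energyRate d s A ε M t := fun t => by
    have := hA0 t
    unfold energyRate
    positivity
  have hM0 : 0 < M := by positivity
  have h1 := hr τ
  refine ⟨M, min τ (energyRate d s A ε M τ + 1)⁻¹, hM0, lt_min hτ (by positivity),
    min_le_left _ _, ?_⟩
  set T₁ := min τ (energyRate d s A ε M τ + 1)⁻¹ with hT₁
  have h2 : energyRate d s A ε M T₁ ≤ energyRate d s A ε M τ := by
    have h3 := hA (min_le_left τ (energyRate d s A ε M τ + 1)⁻¹)
    rw [← hT₁] at h3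
    unfold energyRate
    gcongr
  have h4 : energyRate d s A ε M T₁ * T₁ ≤ 1 := by
    calc energyRate d s A ε M T₁ * T₁
        ≤ energyRate d s A ε M τ * (energyRate d s A ε M τ + 1)⁻¹ := by
          refine mul_le_mul h2 (min_le_right _ _) ?_ h1
          exact (lt_min hτ (by positivity)).le
      _ ≤ 1 := by
          rw [← div_eq_mul_inv]
          exact div_le_one_of_le₀ (by linarith) (by positivity)
  calc (1 + y) * Real.exp (energyRate d s A ε M T₁ * T₁) ≤ M := by rw [hM]; gcongr
    _ ≤ 1 + M := by linarith

/-- The solutions of the Euler–Poisson system for one value of `ε`; the time of existence is at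
least `τ n` if `ε` is small compared with the growth up to `τ n`. -/
lemma exists_isEPSolution_time (hd : d ≤ 3) {s : ℕ} (hs : 3 ≤ s) {T : EReal}
    {vbar₀ : Torus d → Fin d → ℝ} {vbar : ℝ → Torus d → Fin d → ℝ} {p : ℝ → Torus d → ℝ}
    (hE : IsEulerSolution T vbar₀ vbar p) {A : ℝ → ℝ} (hA : Monotone A) (hA0 : ∀ t, 0 ≤ A t)
    (hb : ∀ t ∈ timeInterval T,
      (∀ i, SobBound (s + 1) (coef fun x => vbar t x i) (A t)) ∧
      SobBound s (pressureSource fun i => coef fun x => vbar t x i) (A t) ∧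
      SobBound s (fieldSource fun i => coef fun x => vbar t x i) (A t))
    {τ : ℕ → ℝ} (hτm : Monotone τ) (hτ0 : ∀ n, 0 < τ n) (hτT : ∀ n, (τ n : EReal) ≤ T)
    {ε C : ℝ} (hε : 0 < ε) {v₀ : Torus d → Fin d → ℝ} {ρ₀ : Torus d → ℝ}
    (hρ₀ : ∀ᵐ x ∂torusMeasure d, 0 ≤ ρ₀ x) (hmass : ∫ x, ρ₀ x ∂torusMeasure d = 1)
    (hprep : BoundedPair s (fun x i => ε⁻¹ * (v₀ x i - vbar₀ x i))
      (fun x => (ε ^ 2)⁻¹ * (ρ₀ x - 1)) C) :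
    ∃ (T₁ : ℝ) (v : ℝ → Torus d → Fin d → ℝ) (ρ : ℝ → Torus d → ℝ), 0 < T₁ ∧
      IsEPSolution ε T₁ v₀ ρ₀ v ρ ∧ (∃ C', ∀ t ∈ Set.Icc 0 T₁, BoundedPair s (v t) (ρ t) C') ∧
      ∀ n : ℕ, n ≤ ⌈1 / ε⌉₊ →
        ε * (1 + Real.sqrt (2 * smallEnergy d s A (d * C ^ 2 + (C + A 0) ^ 2) (τ n))) ≤ 1 →
        τ n ≤ T₁ ∧ ∀ t ∈ Set.Icc 0 T₁, BoundedPair s (fun x i => ε⁻¹ * (v t x i - vbar t x i))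
          (fun x => (ε ^ 2)⁻¹ * (ρ t x - 1)) (smallBound d s A (d * C ^ 2 + (C + A 0) ^ 2) t) := by
  classical
  set y := d * C ^ 2 + (C + A 0) ^ 2 with hy
  have hy0 : 0 ≤ y := by positivity
  set P : ℕ → Prop := fun n => ε * (1 + Real.sqrt (2 * smallEnergy d s A y (τ n))) ≤ 1 with hP
  have hsub : ∀ {T₁ : ℝ}, (T₁ : EReal) ≤ T → ∀ t ∈ Set.Icc 0 T₁, t ∈ timeInterval T :=
    fun hT t ht => ⟨ht.1, (EReal.coe_le_coe_iff.mpr ht.2).trans hT⟩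
  set a : ℝ → Fin d → Freq d → ℂ := fun t i => coef fun x => vbar t x i with hadef
  by_cases hex : ∃ n ≤ ⌈1 / ε⌉₊, P n
  · obtain ⟨n₀, hn₀, hPn₀⟩ := hex
    -- The cap `⌈1/ε⌉` ensures a greatest admissible index, even if every index is admissible, and
    -- eventually exceeds any fixed one as `ε → 0`.
    set N := Nat.findGreatest P ⌈1 / ε⌉₊ with hN
    have hPN : P N := Nat.findGreatest_spec hn₀ hPn₀
    set M := smallEnergy d s A y (τ N) with hM
    have hM0 : 0 < M := by rw [hM, smallEnergy]; positivity
    have hgrow : (1 + y) * Real.exp (energyRate d s A ε M (τ N) * τ N) ≤ 1 + M := by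
      have h1 := energyRate_le_of_small (d := d) (s := s) (t := τ N) hA0 hPN
      have h2 := (hτ0 N).le
      have h3 : (1 + y) * Real.exp (energyRate d s A ε M (τ N) * τ N) ≤ M :=
        calc _ ≤ (1 + y) * Real.exp (energyConst d s * (1 + A (τ N)) * 2 * τ N) := by gcongr
          _ = M := rfl
      linarith
    have hbN := fun t ht => hb t (hsub (hτT N) t ht)
    obtain ⟨v, ρ, h1, h2, h3⟩ := exists_isEPSolution hd hs hE (hτ0 N) (hτT N)
      (hA.monotoneOn _) (a := a) (fun _ _ => rfl) (fun t ht => (hbN t ht).1)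
      (fun t ht => (hbN t ht).2.1) (fun t ht => (hbN t ht).2.2) hε hM0 hρ₀ hmass hprep hgrow
    refine ⟨τ N, v, ρ, hτ0 N, h1, h2, fun n hn hPn =>
      ⟨hτm (Nat.le_findGreatest hn hPn), fun t ht => (h3 t ht).mono ?_⟩⟩
    -- Smallness at the index `N` bounds the rate at every earlier time `t` through `A t` alone. The
    -- bound is thus independent of `N`, hence of how far the solution extends.
    have h4 := energyRate_le_of_small (d := d) (s := s) (t := t) hA0 hPN
    have h5 := ht.1
    unfold pertBound smallBound
    gcongr
  · obtain ⟨M, T₁, hM0, hT₁, hT₁τ, hgrow⟩ :=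
      exists_short_time (d := d) (s := s) hA hA0 hy0 hε (hτ0 0)
    have hT₁T : (T₁ : EReal) ≤ T := (EReal.coe_le_coe_iff.mpr hT₁τ).trans (hτT 0)
    have hbN := fun t ht => hb t (hsub hT₁T t ht)
    obtain ⟨v, ρ, h1, h2, -⟩ := exists_isEPSolution hd hs hE hT₁ hT₁T
      (hA.monotoneOn _) (a := a) (fun _ _ => rfl) (fun t ht => (hbN t ht).1)
      (fun t ht => (hbN t ht).2.1) (fun t ht => (hbN t ht).2.2) hε hM0 hρ₀ hmass hprep hgrow
    exact ⟨T₁, v, ρ, hT₁, h1, h2, fun n hn hPn => absurd ⟨n, hn, hPn⟩ hex⟩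

end EulerPoisson

end

/-! ### Uniform bounds and limits of the times of existence -/

theorem theorem2p1 (d s : ℕ) (hd : d = 2 ∨ d = 3) (hs : d / 2 + 2 ≤ s)
    (T : EReal) (hT : 0 < T)
    (vbar₀ : EulerPoisson.Torus d → Fin d → ℝ)
    (vbar : ℝ → EulerPoisson.Torus d → Fin d → ℝ) (p : ℝ → EulerPoisson.Torus d → ℝ)
    (hEuler : EulerPoisson.IsEulerSolution T vbar₀ vbar p)
    -- `vbar ∈ L^∞([0,T], H^(s+1))` (`L^∞_loc([0,∞), H^(s+1))` if `T = ∞`)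
    (hvbar : ∀ T' : ℝ, (T' : EReal) ≤ T → ∃ C : ℝ, ∀ t ∈ Set.Icc 0 T',
      EulerPoisson.MemHsVec (s + 1) (vbar t) ∧ EulerPoisson.hsNormVec (s + 1) (vbar t) ≤ C)
    -- the values of the parameter `ε`: a sequence, or an interval `(0, ε₀)`, for instance
    (E : Set ℝ) (hE : ∀ ε ∈ E, 0 < ε)
    (v₀ : ℝ → EulerPoisson.Torus d → Fin d → ℝ) (ρ₀ : ℝ → EulerPoisson.Torus d → ℝ)
    (hρ₀ : ∀ ε ∈ E, ∀ᵐ x ∂(EulerPoisson.torusMeasure d), 0 ≤ ρ₀ ε x)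
    (hmass : ∀ ε ∈ E, ∫ x, ρ₀ ε x ∂(EulerPoisson.torusMeasure d) = 1)
    (hprep : ∃ C : ℝ, ∀ ε ∈ E,
      EulerPoisson.BoundedPair s (fun x i => ε⁻¹ * (v₀ ε x i - vbar₀ x i))
        (fun x => (ε ^ 2)⁻¹ * (ρ₀ ε x - 1)) C) :
    ∃ (Tε : ℝ → ℝ) (v : ℝ → ℝ → EulerPoisson.Torus d → Fin d → ℝ)
      (ρ : ℝ → ℝ → EulerPoisson.Torus d → ℝ),
      (∀ ε ∈ E, 0 < Tε ε ∧
        EulerPoisson.IsEPSolution ε (Tε ε) (v₀ ε) (ρ₀ ε) (v ε) (ρ ε) ∧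
        ∃ C : ℝ, ∀ t ∈ Set.Icc 0 (Tε ε), EulerPoisson.BoundedPair s (v ε t) (ρ ε t) C) ∧
      T ≤ liminf (fun ε => (Tε ε : EReal)) (𝓝[E] 0) ∧
      (∀ T' : ℝ, (T' : EReal) < T → ∃ ε₀ > 0, ∃ C : ℝ, ∀ ε ∈ E, ε < ε₀ →
        T' ≤ Tε ε ∧ ∀ t ∈ Set.Icc 0 T',
          EulerPoisson.BoundedPair s (fun x i => ε⁻¹ * (v ε t x i - vbar t x i))
            (fun x => (ε ^ 2)⁻¹ * (ρ ε t x - 1)) C) ∧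
      (T = ⊤ → Tendsto Tε (𝓝[E] 0) atTop) := by
  have hd3 : d ≤ 3 := by omega
  -- The integer part of `d / 2` is `1` in both dimensions.
  have hs3 : 3 ≤ s := by omega
  obtain ⟨C, hC⟩ := hprep
  obtain ⟨A, hA, hA0, hb⟩ := EulerPoisson.exists_monotone_bound hd3 hs3 hT hvbar
  obtain ⟨τ, hτm, hτ0, hτT, hτ⟩ := EulerPoisson.exists_times hT
  set y : ℝ := d * C ^ 2 + (C + A 0) ^ 2 with hy
  have hsol := fun (ε : ℝ) (hε : ε ∈ E) => EulerPoisson.exists_isEPSolution_time hd3 hs3 hEuler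
    hA hA0 hb hτm hτ0 hτT (hE ε hε) (hρ₀ ε hε) (hmass ε hε) (hC ε hε)
  choose! Tε v ρ hTε hEP hbd hsmall using hsol
  have key : ∀ T' : ℝ, (T' : EReal) < T → ∃ ε₀ > 0, ∃ C : ℝ, ∀ ε ∈ E, ε < ε₀ →
      T' ≤ Tε ε ∧ ∀ t ∈ Set.Icc 0 T',
        EulerPoisson.BoundedPair s (fun x i => ε⁻¹ * (v ε t x i - vbar t x i))
          (fun x => (ε ^ 2)⁻¹ * (ρ ε t x - 1)) C := by
    intro T' hT'
    obtain ⟨n, hn⟩ := hτ T' hT'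
    -- The first entry makes the index `n` admissible for `ε`, and the second keeps it below the cap
    -- `⌈1/ε⌉`.
    refine ⟨min (1 + Real.sqrt (2 * EulerPoisson.smallEnergy d s A y (τ n)))⁻¹ ((n : ℝ) + 1)⁻¹,
      lt_min (by positivity) (by positivity), EulerPoisson.smallBound d s A y T',
      fun ε hε hlt => ?_⟩
    have hε0 := hE ε hε
    have h1 : ε * (1 + Real.sqrt (2 * EulerPoisson.smallEnergy d s A y (τ n))) ≤ 1 := by
      have := (hlt.trans_le (min_le_left _ _)).le
      rwa [← one_div, le_div_iff₀ (by positivity)] at this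
    have h2 : n ≤ ⌈1 / ε⌉₊ := by
      have h3 := (hlt.trans_le (min_le_right _ _)).le
      rw [← one_div, le_div_iff₀ (by positivity)] at h3
      have h4 : (n : ℝ) ≤ 1 / ε := by
        rw [le_div_iff₀ hε0]
        linarith
      exact_mod_cast h4.trans (Nat.le_ceil _)
    obtain ⟨h3, h4⟩ := hsmall ε hε n h2 h1
    refine ⟨hn.trans h3, fun t ht => (h4 t ⟨ht.1, ht.2.trans (hn.trans h3)⟩).mono ?_⟩
    exact EulerPoisson.smallBound_mono hA hA0 (by positivity) ht.1 ht.2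
  have hev : ∀ T' : ℝ, (T' : EReal) < T → ∀ᶠ ε in 𝓝[E] 0, T' ≤ Tε ε := by
    intro T' hT'
    obtain ⟨ε₀, hε₀, _, h⟩ := key T' hT'
    filter_upwards [self_mem_nhdsWithin, mem_nhdsWithin_of_mem_nhds (Iio_mem_nhds hε₀)] with ε h1 h2
    exact (h ε h1 h2).1
  refine ⟨Tε, v, ρ, fun ε hε => ⟨hTε ε hε, hEP ε hε, hbd ε hε⟩, ?_, key, fun hTop => ?_⟩
  · refine le_of_forall_lt fun c hc => ?_
    obtain ⟨r, hcr, hrT⟩ := EReal.lt_iff_exists_real_btwn.mp hc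
    refine lt_of_lt_of_le hcr (le_liminf_of_le (by isBoundedDefault) ?_)
    filter_upwards [hev r hrT] with ε h using EReal.coe_le_coe_iff.mpr h
  · subst hTop
    exact tendsto_atTop.mpr fun T' => hev T' (EReal.coe_lt_top T')
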